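/- Let $B$ (blue) and $R$ (red) be two finite sets of at most $n$ points each in $\mathbb{R}^2$, such that $B\cup R$ contains at least three points and is in general position, that is, $B\cap R=\emptyset$, all points of $B\cup R$ have distinct $x$-coordinates and distinct $y$-coordinates, and no three of them are collinear. For two non-vertical lines $\ell_1,\ell_2$ with the slope of $\ell_1$ smaller than the slope of $\ell_2$, let $\ell_i^+$ and $\ell_i^-$ be the closed halfplanes above and below $\ell_i$. The bowtie double wedge of $\ell_1,\ell_2$ is the region $$\mathcal{W}_B(\ell_1,\ell_2)=(\ell_1^-\cap \ell_2^+)\cup(\ell_1^+\cap\ell_2^-).$$ Its red outliers are the points of $R$ in the interior of $\mathcal{W}_B(\ell_1,\ell_2)$, and its blue outliers are the points of $B$ in the interior of $\mathbb{R}^2\setminus\mathcal{W}_B(\ell_1,\ell_2)$; their number is $k_B(\ell_1,\ell_2)$. Then there is an algorithm on the real RAM (exact real arithmetic $+,-,\times,/$ and comparisons at unit cost, no rounding of reals; integers of $O(\log n)$ bits for counting and addressing) that, given $B$ and $R$, computes in $O(n^2\log n)$ steps two lines $\ell_1,\ell_2$ whose bowtie double wedge has no red outliers and which minimize the number $k_B(\ell_1,\ell_2)$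 of blue outliers among all bowtie double wedges without red outliers. -/

import Mathlib

/-! ## The machine model: a real RAM

A program is a finite piece of code of a structured imperative language. It works on finitely many
arrays of natural numbers and finitely many arrays of real numbers (scalars are cells at a constant
index). Real numbers are stored exactly; they can be added, subtracted, multiplied, divided and
compared, but they cannot be rounded or used as indices. Natural numbers are machine words. Every
memory access, arithmetic operation, comparison, assignment and branch costs one step. -/

namespace RealRAM

/-- The memory: cell `i` of the natural number array `a` is `nat a i`, and cell `i` of the real
array `a` is `real a i`. -/
structure State where
  nat : ℕ → ℕ → ℕ
  real : ℕ → ℕ → ℝ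

/-- Store `v` in cell `i` of the natural number array `a`. -/
def State.putNat (s : State) (a i v : ℕ) : State :=
  { s with nat := Function.update s.nat a (Function.update (s.nat a) i v) }

/-- Store `v` in cell `i` of the real array `a`. -/
noncomputable def State.putReal (s : State) (a i : ℕ) (v : ℝ) : State :=
  { s with real := Function.update s.real a (Function.update (s.real a) i v) }

/-- Expressions over the natural numbers. -/
inductive NatExpr : Type
  | const (c : ℕ)
  | get (a : ℕ) (i : NatExpr)
  | add (e f : NatExpr)
  | sub (e f : NatExpr)
  | mul (e f : NatExpr)
  | div (e f : NatExpr)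

/-- Value of a natural number expression (truncated subtraction, rounding division). -/
def NatExpr.eval (s : State) : NatExpr → ℕ
  | const c => c
  | get a i => s.nat a (i.eval s)
  | add e f => e.eval s + f.eval s
  | sub e f => e.eval s - f.eval s
  | mul e f => e.eval s * f.eval s
  | div e f => e.eval s / f.eval s

/-- Number of steps needed to evaluate a natural number expression. -/
def NatExpr.cost : NatExpr → ℕ
  | const _ => 1
  | get _ i => i.cost + 1
  | add e f => e.cost + f.cost + 1
  | sub e f => e.cost + f.cost + 1
  | mul e f => e.cost + f.cost + 1
  | div e f => e.cost + f.cost + 1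

/-- Expressions over the real numbers. The only constants are the integers. -/
inductive RealExpr : Type
  | const (c : ℤ)
  | get (a : ℕ) (i : NatExpr)
  | add (e f : RealExpr)
  | sub (e f : RealExpr)
  | mul (e f : RealExpr)
  | div (e f : RealExpr)

/-- Value of a real expression (a division by zero yields zero). -/
noncomputable def RealExpr.eval (s : State) : RealExpr → ℝ
  | const c => c
  | get a i => s.real a (i.eval s)
  | add e f => e.eval s + f.eval s
  | sub e f => e.eval s - f.eval s
  | mul e f => e.eval s * f.eval s
  | div e f => e.eval s / f.eval s

/-- Number of steps needed to evaluate a real expression. -/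
def RealExpr.cost : RealExpr → ℕ
  | const _ => 1
  | get _ i => i.cost + 1
  | add e f => e.cost + f.cost + 1
  | sub e f => e.cost + f.cost + 1
  | mul e f => e.cost + f.cost + 1
  | div e f => e.cost + f.cost + 1

/-- Tests. -/
inductive Test : Type
  | natLe (e f : NatExpr)
  | realLe (e f : RealExpr)
  | not (b : Test)
  | and (b c : Test)

/-- The test `b` succeeds in the state `s`. -/
def Test.Holds (s : State) : Test → Prop
  | natLe e f => e.eval s ≤ f.eval s
  | realLe e f => e.eval s ≤ f.eval s
  | not b => ¬ b.Holds s
  | and b c => b.Holds s ∧ c.Holds s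

/-- Number of steps needed to perform a test. -/
def Test.cost : Test → ℕ
  | natLe e f => e.cost + f.cost + 1
  | realLe e f => e.cost + f.cost + 1
  | not b => b.cost + 1
  | and b c => b.cost + c.cost + 1

/-- Programs. `setNat a i e` stores the value of `e` in cell `i` of the natural number array `a`,
`setReal` does the same for real arrays, and `loop b p` means "while `b` do `p`". -/
inductive Program : Type
  | skip
  | setNat (a : ℕ) (i e : NatExpr)
  | setReal (a : ℕ) (i : NatExpr) (e : RealExpr)
  | seq (p q : Program)
  | ite (b : Test) (p q : Program)
  | loop (b : Test) (p : Program)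

/-- `Exec W p s t s'`: started in the state `s`, the program `p` halts after exactly `t` steps in the
state `s'`, and every natural number that it stores is smaller than the word bound `W` (a machine
word has `log W` bits; a program that stores a larger number is stuck). -/
inductive Exec (W : ℕ) : Program → State → ℕ → State → Prop
  | skip (s : State) : Exec W .skip s 1 s
  | setNat (a : ℕ) (i e : NatExpr) (s : State) (h : e.eval s < W) :
      Exec W (.setNat a i e) s (i.cost + e.cost + 1) (s.putNat a (i.eval s) (e.eval s))
  | setReal (a : ℕ) (i : NatExpr) (e : RealExpr) (s : State) :
      Exec W (.setReal a i e) s (i.cost + e.cost + 1) (s.putReal a (i.eval s) (e.eval s))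
  | seq {p q : Program} {s s' s'' : State} {t t' : ℕ}
      (hp : Exec W p s t s') (hq : Exec W q s' t' s'') : Exec W (.seq p q) s (t + t') s''
  | iteTrue {b : Test} {p q : Program} {s s' : State} {t : ℕ}
      (hb : b.Holds s) (hp : Exec W p s t s') : Exec W (.ite b p q) s (b.cost + 1 + t) s'
  | iteFalse {b : Test} {p q : Program} {s s' : State} {t : ℕ}
      (hb : ¬ b.Holds s) (hq : Exec W q s t s') : Exec W (.ite b p q) s (b.cost + 1 + t) s'
  | loopTrue {b : Test} {p : Program} {s s' s'' : State} {t t' : ℕ}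
      (hb : b.Holds s) (hp : Exec W p s t s') (hl : Exec W (.loop b p) s' t' s'') :
      Exec W (.loop b p) s (b.cost + 1 + t + t') s''
  | loopFalse {b : Test} {p : Program} {s : State} (hb : ¬ b.Holds s) :
      Exec W (.loop b p) s (b.cost + 1) s

/-- The machine is deterministic: its running time and its final state are determined by the
program and the initial state. -/
theorem Exec.deterministic {W : ℕ} {p : Program} {s s₁ s₂ : State} {t₁ t₂ : ℕ}
    (h₁ : Exec W p s t₁ s₁) (h₂ : Exec W p s t₂ s₂) : t₁ = t₂ ∧ s₁ = s₂ := by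
  induction h₁ generalizing t₂ s₂ with
  | skip => cases h₂; exact ⟨rfl, rfl⟩
  | setNat => cases h₂; exact ⟨rfl, rfl⟩
  | setReal => cases h₂; exact ⟨rfl, rfl⟩
  | seq _ _ ihp ihq =>
    cases h₂ with
    | seq hp hq =>
      obtain ⟨rfl, rfl⟩ := ihp hp
      obtain ⟨rfl, rfl⟩ := ihq hq
      exact ⟨rfl, rfl⟩
  | iteTrue hb _ ih =>
    cases h₂ with
    | iteTrue _ hp => obtain ⟨rfl, rfl⟩ := ih hp; exact ⟨rfl, rfl⟩
    | iteFalse hb' _ => exact absurd hb hb'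
  | iteFalse hb _ ih =>
    cases h₂ with
    | iteTrue hb' _ => exact absurd hb' hb
    | iteFalse _ hp => obtain ⟨rfl, rfl⟩ := ih hp; exact ⟨rfl, rfl⟩
  | loopTrue hb _ _ ihp ihl =>
    cases h₂ with
    | loopTrue _ hp hl =>
      obtain ⟨rfl, rfl⟩ := ihp hp
      obtain ⟨rfl, rfl⟩ := ihl hl
      exact ⟨rfl, rfl⟩
    | loopFalse hb' => exact absurd hb hb'
  | loopFalse hb =>
    cases h₂ with
    | loopTrue hb' _ _ => exact absurd hb' hb
    | loopFalse _ => exact ⟨rfl, rfl⟩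

end RealRAM

/-! ## Bowtie double wedges and outliers -/

namespace Bowtie

/-- The non-vertical line `y = slope * x + intercept`. -/
structure Line where
  slope : ℝ
  intercept : ℝ

/-- The closed halfplane `ℓ⁺` on and above `ℓ`. -/
def Line.above (ℓ : Line) : Set (ℝ × ℝ) := {p | ℓ.slope * p.1 + ℓ.intercept ≤ p.2}

/-- The closed halfplane `ℓ⁻` on and below `ℓ`. -/
def Line.below (ℓ : Line) : Set (ℝ × ℝ) := {p | p.2 ≤ ℓ.slope * p.1 + ℓ.intercept}

/-- The east wedge of a pair of lines, the first of which has the smaller slope. -/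
def east (ℓ₁ ℓ₂ : Line) : Set (ℝ × ℝ) := ℓ₁.above ∩ ℓ₂.below

/-- The west wedge of a pair of lines, the first of which has the smaller slope. -/
def west (ℓ₁ ℓ₂ : Line) : Set (ℝ × ℝ) := ℓ₁.below ∩ ℓ₂.above

/-- The blue region `W_B` of a bowtie double wedge. It is only used for
`ℓ₁.slope < ℓ₂.slope`; the double wedges with a vertical bounding line contain that line, so that
they are not bowties. -/
def region (ℓ₁ ℓ₂ : Line) : Set (ℝ × ℝ) := west ℓ₁ ℓ₂ ∪ east ℓ₁ ℓ₂

/-- The red outliers: the red points in the interior of `W_B`. -/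
def redOutliers (R : Set (ℝ × ℝ)) (ℓ₁ ℓ₂ : Line) : Set (ℝ × ℝ) :=
  R ∩ interior (region ℓ₁ ℓ₂)

/-- The blue outliers: the blue points in the interior of the complement `W_R` of `W_B`. -/
def blueOutliers (B : Set (ℝ × ℝ)) (ℓ₁ ℓ₂ : Line) : Set (ℝ × ℝ) :=
  B ∩ interior (region ℓ₁ ℓ₂)ᶜ

/-- The lines `ℓ₁, ℓ₂` bound a bowtie double wedge without red outliers. -/
def IsFeasible (R : Set (ℝ × ℝ)) (ℓ₁ ℓ₂ : Line) : Prop :=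
  ℓ₁.slope < ℓ₂.slope ∧ redOutliers R ℓ₁ ℓ₂ = ∅

/-- The lines `ℓ₁, ℓ₂` bound a bowtie double wedge that has no red outliers and, among all of
these, the minimum number of blue outliers. -/
def IsOptimal (B R : Set (ℝ × ℝ)) (ℓ₁ ℓ₂ : Line) : Prop :=
  IsFeasible R ℓ₁ ℓ₂ ∧ ∀ ℓ₁' ℓ₂' : Line, IsFeasible R ℓ₁' ℓ₂' →
    (blueOutliers B ℓ₁ ℓ₂).ncard ≤ (blueOutliers B ℓ₁' ℓ₂').ncard

/-- General position: the `x`-coordinates are distinct, the `y`-coordinates are distinct, and no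
three of the points are collinear. -/
def GeneralPosition {ι : Type*} (p : ι → ℝ × ℝ) : Prop :=
  (Function.Injective fun i => (p i).1) ∧ (Function.Injective fun i => (p i).2) ∧
    ∀ i j k : ι, i ≠ j → j ≠ k → i ≠ k → ¬ Collinear ℝ {p i, p j, p k}

/-- The array with the entries of `f`, filled up with zeros. -/
noncomputable def toArray {m : ℕ} (f : Fin m → ℝ) (i : ℕ) : ℝ :=
  if h : i < m then f ⟨i, h⟩ else 0

/-- The initial memory: cells `0` and `1` of the natural number array `0` hold the numbers of blue
and red points, the real arrays `0` and `1` hold the `x`- and `y`-coordinates of the blue points,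
the real arrays `2` and `3` those of the red points, and all other cells hold zero. -/
noncomputable def inputState {m k : ℕ} (b : Fin m → ℝ × ℝ) (r : Fin k → ℝ × ℝ) : RealRAM.State where
  nat
    | 0, 0 => m
    | 0, 1 => k
    | _, _ => 0
  real
    | 0 => toArray fun i => (b i).1
    | 1 => toArray fun i => (b i).2
    | 2 => toArray fun i => (r i).1
    | 3 => toArray fun i => (r i).2
    | _ => fun _ => 0

/-- The first output line: its slope and intercept are in cells `0` and `1` of the real
array `4`. -/
def outputLine₁ (s : RealRAM.State) : Line := ⟨s.real 4 0, s.real 4 1⟩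

/-- The second output line: its slope and intercept are in cells `2` and `3` of the real
array `4`. -/
def outputLine₂ (s : RealRAM.State) : Line := ⟨s.real 4 2, s.real 4 3⟩

end Bowtie

/-!
The proof passes to the dual plane. A point `(a, b)` becomes the line `y = -a * x + b`, and a
pair of lines becomes a pair of points `u`, `v`, the coordinates of which are the slopes and the
intercepts. The vertical distance between a point and a line only changes its sign, so that a
double wedge has no red outliers if and only if no red dual line strictly separates `u` from `v`,
and the blue points that are no outliers are those whose dual lines meet the segment `uv`
(`ncard_blueOutliers`). After a small perturbation, the task is to find two points in the same
cell of the arrangement of the red lines that are separated by as many blue lines as possible.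

*Geometry of a cell.* A blue line that meets a cell of the red arrangement has two ends in it, on
the boundary of the cell or at infinity. Two artificial lines far away (`Far`) make the ends at
infinity finite; they occur only in the proof. As each end lies on a line that supports the cell,
the ends of a cell are in convex position (`End.supported`), and their counterclockwise order is
the lexicographic order of two computable numbers, the zone and the rank (`End.ccw`). A line
cannot separate points in convex position alternately (`Supported.not_alternating`). Thus the
line through `u` and `v` cuts off an interval of ends, and every blue line that meets the segment
`uv` has exactly one of its ends in this interval (`EndOrder.card_crossed_le`). Conversely, the
blue lines with exactly one end in an interval `[p, q]` all separate a point next to `p` from a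
point next to `q` (`EndOrder.separated`, `EndOrder.card_singles_le`). Hence an optimal double
wedge can be read off from an interval of ends of one cell in which the number of ends without
their mate is maximal (`isOptimal_of_isBestInterval`).

*The algorithm.* With `m` blue and `k` red lines, there are `2 * m * (k + 1)` ends. A cell is
encoded by the real number `∑ 2 ^ i`, where `i` runs over the red lines below the cell. The codes
of all ends are found by a sweep over the vertices in the order of their abscissas
(`sweepVertices_run`), since the code changes by one power of two at a vertex of a blue line. The
ends are then sorted by code, zone and rank with a tournament tree (`sortItems_run`). A scan over
the sorted ends finds a best interval (`scanItems_run`): a scanned end has weight `1`, except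
that the first end of a matched pair has weight `-1` once the second one has been scanned, a tree
maintains the maximum suffix sum of the weights, and a large negative weight at the change of
cells prevents intervals from meeting two cells. The sum of an interval that ends at the last
scanned end is the number of its ends without their mate (`Paired.sum_scanLeaf`). Each end and
each vertex costs `O(log n)` steps, so that the total time is `O(n ^ 2 * log n)`
(`bowtieProgram_run`, `bowtieTime_le`, `clog_add_one_le`).

The assertions about programs are proved in a small program logic (`Run`) that bounds the number
of steps along with the effect of a program; a syntactic frame condition (`Frame`) keeps track of
the arrays that a program leaves alone.
-/

/-! ### A program logic for the real RAM -/

namespace RealRAM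

instance (n : ℕ) : OfNat NatExpr n := ⟨.const n⟩
instance : Add NatExpr := ⟨.add⟩
instance : Sub NatExpr := ⟨.sub⟩
instance : Mul NatExpr := ⟨.mul⟩
instance : Div NatExpr := ⟨.div⟩
instance (n : ℕ) : OfNat RealExpr n := ⟨.const n⟩
instance : Add RealExpr := ⟨.add⟩
instance : Sub RealExpr := ⟨.sub⟩
instance : Mul RealExpr := ⟨.mul⟩
instance : Div RealExpr := ⟨.div⟩

/-- The natural number scalar stored in cell `0` of the array `a`. -/
abbrev NatExpr.var (a : ℕ) : NatExpr := .get a 0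

/-- The real scalar stored in cell `0` of the array `a`. -/
abbrev RealExpr.var (a : ℕ) : RealExpr := .get a 0

section Eval
variable (s : State)

@[simp] theorem NatExpr.eval_ofNat (n : ℕ) [n.AtLeastTwo] :
    (ofNat(n) : NatExpr).eval s = ofNat(n) := rfl
@[simp] theorem NatExpr.eval_zero : (0 : NatExpr).eval s = 0 := rfl
@[simp] theorem NatExpr.eval_one : (1 : NatExpr).eval s = 1 := rfl
@[simp] theorem NatExpr.eval_add (e f : NatExpr) : (e + f).eval s = e.eval s + f.eval s := rfl
@[simp] theorem NatExpr.eval_sub (e f : NatExpr) : (e - f).eval s = e.eval s - f.eval s := rfl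
@[simp] theorem NatExpr.eval_mul (e f : NatExpr) : (e * f).eval s = e.eval s * f.eval s := rfl
@[simp] theorem NatExpr.eval_div (e f : NatExpr) : (e / f).eval s = e.eval s / f.eval s := rfl
@[simp] theorem NatExpr.eval_get (a : ℕ) (i : NatExpr) :
    (NatExpr.get a i).eval s = s.nat a (i.eval s) := rfl
@[simp] theorem RealExpr.eval_zero : (0 : RealExpr).eval s = 0 := by
  show ((0 : ℕ) : ℤ) = (0 : ℝ); norm_num
@[simp] theorem RealExpr.eval_one : (1 : RealExpr).eval s = 1 := by
  show (((1 : ℕ) : ℤ) : ℝ) = (1 : ℝ); norm_num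
@[simp] theorem RealExpr.eval_ofNat (n : ℕ) [n.AtLeastTwo] :
    (ofNat(n) : RealExpr).eval s = (ofNat(n) : ℝ) := by
  show (((n : ℕ) : ℤ) : ℝ) = (OfNat.ofNat n : ℝ)
  rw [Int.cast_natCast]; rfl
@[simp] theorem RealExpr.eval_add (e f : RealExpr) : (e + f).eval s = e.eval s + f.eval s := rfl
@[simp] theorem RealExpr.eval_sub (e f : RealExpr) : (e - f).eval s = e.eval s - f.eval s := rfl
@[simp] theorem RealExpr.eval_mul (e f : RealExpr) : (e * f).eval s = e.eval s * f.eval s := rfl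
@[simp] theorem RealExpr.eval_div (e f : RealExpr) : (e / f).eval s = e.eval s / f.eval s := rfl
@[simp] theorem RealExpr.eval_get (a : ℕ) (i : NatExpr) :
    (RealExpr.get a i).eval s = s.real a (i.eval s) := rfl

/-- The test `e < f` on real numbers. -/
abbrev Test.realLt (e f : RealExpr) : Test := .not (.realLe f e)
/-- Disjunction of two tests. -/
def Test.or (b c : Test) : Test := .not (.and (.not b) (.not c))

@[simp] theorem Test.holds_natLe (e f : NatExpr) :
    (Test.natLe e f).Holds s ↔ e.eval s ≤ f.eval s := Iff.rfl
@[simp] theorem Test.holds_realLe (e f : RealExpr) :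
    (Test.realLe e f).Holds s ↔ e.eval s ≤ f.eval s := Iff.rfl
@[simp] theorem Test.holds_not (b : Test) : (Test.not b).Holds s ↔ ¬ b.Holds s := Iff.rfl
@[simp] theorem Test.holds_and (b c : Test) :
    (Test.and b c).Holds s ↔ b.Holds s ∧ c.Holds s := Iff.rfl
@[simp] theorem Test.holds_or (b c : Test) :
    (Test.or b c).Holds s ↔ b.Holds s ∨ c.Holds s := by
  show ¬ (¬ b.Holds s ∧ ¬ c.Holds s) ↔ _
  tauto

@[simp] theorem State.nat_putNat (a i v a' : ℕ) :
    (s.putNat a i v).nat a' = if a' = a then Function.update (s.nat a) i v else s.nat a' := by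
  by_cases h : a' = a
  · subst h; simp [State.putNat]
  · simp [State.putNat, h]
@[simp] theorem State.real_putNat (a i v : ℕ) : (s.putNat a i v).real = s.real := rfl
@[simp] theorem State.nat_putReal (a i : ℕ) (v : ℝ) : (s.putReal a i v).nat = s.nat := rfl
@[simp] theorem State.real_putReal (a i : ℕ) (v : ℝ) (a' : ℕ) :
    (s.putReal a i v).real a' =
      if a' = a then Function.update (s.real a) i v else s.real a' := by
  by_cases h : a' = a
  · subst h; simp [State.putReal]
  · simp [State.putReal, h]
end Eval

/-- Does the program contain an assignment to the natural number array `a`? -/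
def Program.writesNat (a : ℕ) : Program → Bool
  | skip => false
  | setNat a' _ _ => a' == a
  | setReal _ _ _ => false
  | seq p q => p.writesNat a || q.writesNat a
  | ite _ p q => p.writesNat a || q.writesNat a
  | loop _ p => p.writesNat a

/-- Does the program contain an assignment to the real array `a`? -/
def Program.writesReal (a : ℕ) : Program → Bool
  | skip => false
  | setNat _ _ _ => false
  | setReal a' _ _ => a' == a
  | seq p q => p.writesReal a || q.writesReal a
  | ite _ p q => p.writesReal a || q.writesReal a
  | loop _ p => p.writesReal a

/-- The states `s` and `s'` agree on all arrays to which `p` does not contain an assignment. -/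
def Frame (p : Program) (s s' : State) : Prop :=
  (∀ a, p.writesNat a = false → s'.nat a = s.nat a) ∧
    ∀ a, p.writesReal a = false → s'.real a = s.real a

theorem Frame.refl (p : Program) (s : State) : Frame p s s := ⟨fun _ _ => rfl, fun _ _ => rfl⟩

theorem Frame.trans {p : Program} {s s' s'' : State} (h : Frame p s s') (h' : Frame p s' s'') :
    Frame p s s'' :=
  ⟨fun a ha => (h'.1 a ha).trans (h.1 a ha), fun a ha => (h'.2 a ha).trans (h.2 a ha)⟩

theorem Frame.mono {p q : Program} {s s' : State} (h : Frame p s s')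
    (hn : ∀ a, q.writesNat a = false → p.writesNat a = false)
    (hr : ∀ a, q.writesReal a = false → p.writesReal a = false) : Frame q s s' :=
  ⟨fun a ha => h.1 a (hn a ha), fun a ha => h.2 a (hr a ha)⟩

theorem Exec.frame {W : ℕ} {p : Program} {s s' : State} {t : ℕ} (h : Exec W p s t s') :
    Frame p s s' := by
  induction h with
  | skip => exact Frame.refl _ _
  | setNat a i e s h =>
    refine ⟨fun b hb => ?_, fun b hb => rfl⟩
    have : b ≠ a := by rintro rfl; simp [Program.writesNat] at hb
    simp [this]
  | setReal a i e s =>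
    refine ⟨fun b hb => rfl, fun b hb => ?_⟩
    have : b ≠ a := by rintro rfl; simp [Program.writesReal] at hb
    simp [this]
  | seq _ _ ihp ihq =>
    refine Frame.trans (ihp.mono ?_ ?_) (ihq.mono ?_ ?_) <;>
      simp +contextual [Program.writesNat, Program.writesReal]
  | iteTrue _ _ ih =>
    refine ih.mono ?_ ?_ <;> simp +contextual [Program.writesNat, Program.writesReal]
  | iteFalse _ _ ih =>
    refine ih.mono ?_ ?_ <;> simp +contextual [Program.writesNat, Program.writesReal]
  | loopTrue _ _ _ ihp ihl =>
    exact Frame.trans (ihp.mono (fun _ h => h) (fun _ h => h)) ihl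
  | loopFalse => exact Frame.refl _ _

/-- Started in `s`, the program `p` halts within `T` steps in a state that satisfies `Q`. -/
def Run (W : ℕ) (p : Program) (s : State) (T : ℕ) (Q : State → Prop) : Prop :=
  ∃ t s', Exec W p s t s' ∧ t ≤ T ∧ Q s'

section Rules
variable {W : ℕ} {p q body : Program} {b : Test} {s : State} {T T₁ T₂ c n : ℕ}
  {Q Q' : State → Prop}

theorem Run.mono (h : Run W p s T₁ Q) (hT : T₁ ≤ T₂) (hQ : ∀ s', Q s' → Q' s') :
    Run W p s T₂ Q' := by
  obtain ⟨t, s', he, ht, hq⟩ := h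
  exact ⟨t, s', he, ht.trans hT, hQ _ hq⟩

/-- A run may be assumed to leave alone the arrays to which the program does not assign. -/
theorem Run.framed (h : Run W p s T₁ Q) (hT : T₁ ≤ T₂)
    (hQ : ∀ s', Frame p s s' → Q s' → Q' s') : Run W p s T₂ Q' := by
  obtain ⟨t, s', he, ht, hq⟩ := h
  exact ⟨t, s', he, ht.trans hT, hQ _ he.frame hq⟩

theorem Run.seq (h : Run W p s T₁ fun s' => Run W q s' T₂ Q) :
    Run W (.seq p q) s (T₁ + T₂) Q := by
  obtain ⟨t, s', he, ht, t', s'', he', ht', hq⟩ := h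
  exact ⟨t + t', s'', .seq he he', by omega, hq⟩

theorem Run.ite (h₁ : b.Holds s → Run W p s T Q) (h₂ : ¬ b.Holds s → Run W q s T Q) :
    Run W (.ite b p q) s (b.cost + 1 + T) Q := by
  by_cases hb : b.Holds s
  · obtain ⟨t, s', he, ht, hq⟩ := h₁ hb
    exact ⟨_, s', .iteTrue hb he, by omega, hq⟩
  · obtain ⟨t, s', he, ht, hq⟩ := h₂ hb
    exact ⟨_, s', .iteFalse hb he, by omega, hq⟩

open Classical in
/-- The effect of a program without loops. -/
noncomputable def Program.eff : Program → State → State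
  | skip, s => s
  | setNat a i e, s => s.putNat a (i.eval s) (e.eval s)
  | setReal a i e, s => s.putReal a (i.eval s) (e.eval s)
  | seq p q, s => q.eff (p.eff s)
  | ite b p q, s => if b.Holds s then p.eff s else q.eff s
  | loop _ _, s => s

/-- A bound for the running time of a program without loops. -/
def Program.time : Program → ℕ
  | skip => 1
  | setNat _ i e => i.cost + e.cost + 1
  | setReal _ i e => i.cost + e.cost + 1
  | seq p q => p.time + q.time
  | ite b p q => b.cost + 1 + (p.time + q.time)
  | loop _ _ => 0

/-- A program without loops, started in a state, stores only words below `W`. -/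
def Program.Safe (W : ℕ) : Program → State → Prop
  | skip, _ => True
  | setNat _ _ e, s => e.eval s < W
  | setReal _ _ _, _ => True
  | seq p q, s => p.Safe W s ∧ q.Safe W (p.eff s)
  | ite b p q, s => (b.Holds s → p.Safe W s) ∧ (¬ b.Holds s → q.Safe W s)
  | loop _ _, _ => False

theorem Program.Safe.run : ∀ {p : Program} {s : State}, p.Safe W s →
    Run W p s p.time fun s' => s' = p.eff s
  | .skip, s, _ => ⟨_, _, .skip s, le_rfl, rfl⟩
  | .setNat a i e, s, h => ⟨_, _, .setNat a i e s h, le_rfl, rfl⟩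
  | .setReal a i e, s, _ => ⟨_, _, .setReal a i e s, le_rfl, rfl⟩
  | .seq p q, s, h => by
    refine Run.seq (Run.mono h.1.run le_rfl ?_)
    rintro s' rfl
    exact h.2.run
  | .ite b p q, s, h => by
    refine Run.ite (fun hb => ?_) (fun hb => ?_)
    · refine (h.1 hb).run.mono (by omega) ?_
      rintro s' rfl; simp [Program.eff, hb]
    · refine (h.2 hb).run.mono (by omega) ?_
      rintro s' rfl; simp [Program.eff, hb]

theorem Run.of_safe (h : p.Safe W s) (hT : p.time ≤ T) (hQ : Q (p.eff s)) : Run W p s T Q :=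
  h.run.mono hT (by rintro s' rfl; exact hQ)

/-- The rule for loops; `I i` is the invariant when at most `i` iterations remain. -/
theorem Run.loop (I : ℕ → State → Prop) (h0 : ∀ s, I 0 s → ¬ b.Holds s)
    (hstep : ∀ i s, I (i + 1) s → b.Holds s → Run W body s c (I i))
    (hQ : ∀ i s, I i s → ¬ b.Holds s → Q s) (hI : I n s) :
    Run W (.loop b body) s (n * (b.cost + 1 + c) + (b.cost + 1)) Q := by
  induction n generalizing s with
  | zero => exact ⟨_, s, .loopFalse (h0 s hI), by omega, hQ 0 s hI (h0 s hI)⟩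
  | succ n ih =>
    by_cases hb : b.Holds s
    · obtain ⟨t, s', he, ht, hI'⟩ := hstep n s hI hb
      obtain ⟨t', s'', he', ht', hq⟩ := ih hI'
      refine ⟨_, s'', .loopTrue hb he he', ?_, hq⟩
      rw [add_mul]; omega
    · exact ⟨_, s, .loopFalse hb, by omega, hQ _ s hI hb⟩

end Rules

/-- `for v = 0, …, N - 1 do body`, where `v` is a natural number scalar. -/
def forLoop (v : ℕ) (N : NatExpr) (body : Program) : Program :=
  .seq (.setNat v 0 0)
    (.loop (.natLe (.var v + 1) N) (.seq body (.setNat v 0 (.var v + 1))))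

/-- The rule for `for` loops; `I i` is the invariant after `i` iterations. -/
theorem Run.forLoop {W v : ℕ} {N : NatExpr} {body : Program} {s : State} {n c T : ℕ}
    {Q : State → Prop} (I : ℕ → State → Prop) (hW : n < W) (hv : body.writesNat v = false)
    (hN : ∀ s', Frame (forLoop v N body) s s' → N.eval s' = n)
    (h0 : I 0 (s.putNat v 0 0))
    (hstep : ∀ i < n, ∀ s', Frame (forLoop v N body) s s' → s'.nat v 0 = i → I i s' →
      Run W body s' c fun s'' => I (i + 1) (s''.putNat v 0 (i + 1)))
    (hT : n * (c + N.cost + 15) + N.cost + 15 ≤ T)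
    (hQ : ∀ s', Frame (forLoop v N body) s s' → I n s' → Q s') :
    Run W (forLoop v N body) s T Q := by
  have hput : ∀ (s' : State) (x : ℕ), Frame (RealRAM.forLoop v N body) s s' →
      Frame (RealRAM.forLoop v N body) s (s'.putNat v 0 x) := by
    intro s' x hf
    refine ⟨fun a ha => ?_, fun a ha => hf.2 a ha⟩
    have : a ≠ v := by
      rintro rfl; simp [RealRAM.forLoop, Program.writesNat] at ha
    simp [this, hf.1 a ha]
  have hloop : Run W (.loop (.natLe (.var v + 1) N) (.seq body (.setNat v 0 (.var v + 1))))
      (s.putNat v 0 0) (n * ((Test.natLe (.var v + 1) N).cost + 1 + (c + 6)) +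
        ((Test.natLe (.var v + 1) N).cost + 1)) Q := by
    refine Run.loop (fun r s' => r ≤ n ∧ s'.nat v 0 = n - r ∧ I (n - r) s' ∧
      Frame (RealRAM.forLoop v N body) s s') ?_ ?_ ?_ ?_
    · rintro s' ⟨_, h2, _, h4⟩
      simp [h2, hN s' h4]
    · rintro r s' ⟨h1, h2, h3, h4⟩ _
      refine Run.seq (T₂ := 6) ((hstep (n - (r + 1)) (by omega) s' h4 h2 h3).framed le_rfl ?_)
      intro s'' hf hI
      have hvv : s''.nat v 0 = n - (r + 1) := by rw [hf.1 v hv, h2]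
      have e : n - (r + 1) + 1 = n - r := by omega
      refine Run.of_safe ?_ (Nat.le_refl 6) ?_
      · simp [Program.Safe, hvv]; omega
      · simp only [Program.eff, NatExpr.eval_add, NatExpr.eval_get, NatExpr.eval_zero,
          NatExpr.eval_one, hvv, e]
        rw [e] at hI
        refine ⟨by omega, by simp, hI, hput _ _ (h4.trans (hf.mono ?_ ?_))⟩ <;>
          simp +contextual [Program.writesNat, Program.writesReal, RealRAM.forLoop]
    · rintro r s' ⟨h1, h2, h3, h4⟩ hb
      have : r = 0 := by
        simp [h2, hN s' h4] at hb
        omega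
      subst this
      exact hQ s' h4 (by simpa using h3)
    · exact ⟨le_rfl, by simp, by simpa using h0, hput _ _ (Frame.refl _ _)⟩
  have h1 : Run W (.setNat v 0 0) s 3 fun s' => s' = s.putNat v 0 0 :=
    Run.of_safe (by simp [Program.Safe]; omega) (Nat.le_refl 3) (by simp [Program.eff])
  have h2 := Run.seq (h1.mono le_rfl (by rintro s' rfl; exact hloop))
  refine h2.mono ?_ (fun _ h => h)
  · refine le_trans ?_ hT
    have : (Test.natLe (.var v + 1) N).cost = N.cost + 5 := by
      show (1 + 1) + 1 + 1 + N.cost + 1 = _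
      omega
    rw [this]
    have : n * (N.cost + 5 + 1 + (c + 6)) ≤ n * (c + N.cost + 15) :=
      Nat.mul_le_mul_left _ (by omega)
    omega

end RealRAM

/-! ### Arrays used by the algorithm -/

namespace RealRAM

/-! Names for the natural number arrays. Array `0` holds the numbers of blue and red points. -/

notation "loopI" => 1
notation "treeSize" => 2
notation "cursor" => 3
notation "winnerArr" => 4
notation "orderArr" => 5
notation "argBest" => 6
notation "openAt" => 7
notation "endLine" => 8
notation "bestP" => 9
notation "bestQ" => 10
notation "itemCount" => 11
notation "tmpA" => 12
notation "tmpB" => 13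
notation "tmpC" => 14
notation "tmpD" => 15
notation "pointLine" => 16

/-! Names for the real arrays. The arrays `0`, …, `3` hold the coordinates of the points, and array
`4` holds the output. -/

notation "slopeArr" => 5
notation "iceptArr" => 6
notation "powArr" => 7
notation "lineCode" => 8
notation "keyA" => 9
notation "keyB" => 10
notation "keyC" => 11
notation "sumArr" => 12
notation "sufArr" => 13
notation "bestVal" => 14
notation "bigVal" => 15
notation "absc" => 16
notation "loVal" => 17
notation "hiVal" => 18
notation "sgnVal" => 19
notation "crossVal" => 20

/-! ### Complete binary trees stored in arrays -/

/-- The nodes `1, …, 2 ^ L - 1` of a complete binary tree carry the value `f` of the values of their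
children `2 * i` and `2 * i + 1`. The leaves are the nodes `2 ^ L, …, 2 ^ (L + 1) - 1`. -/
def TreeOK {α : Type*} (L : ℕ) (f : α → α → α) (v : ℕ → α) : Prop :=
  ∀ i, 1 ≤ i → i < 2 ^ L → v i = f (v (2 * i)) (v (2 * i + 1))

/-- A relation between values and intervals that holds at the leaves and is inherited by parents
holds at the root. -/
theorem TreeOK.root {α : Type*} {L : ℕ} {f : α → α → α} {v : ℕ → α} (h : TreeOK L f v)
    (P : α → ℕ → ℕ → Prop) (hleaf : ∀ p < 2 ^ L, P (v (2 ^ L + p)) p (p + 1))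
    (hf : ∀ a b lo mid hi, lo < mid → mid < hi → P a lo mid → P b mid hi → P (f a b) lo hi) :
    P (v 1) 0 (2 ^ L) := by
  have key : ∀ h d, d + h = L → ∀ q < 2 ^ d, P (v (2 ^ d + q)) (q * 2 ^ h) ((q + 1) * 2 ^ h) := by
    intro h'
    induction h' with
    | zero =>
      rintro d rfl q hq
      simpa using hleaf q hq
    | succ h' ih =>
      intro d hd q hq
      have hp : 2 ^ d < 2 ^ L := Nat.pow_lt_pow_right (by norm_num) (by omega)
      have hp' : 2 ^ (d + 1) ≤ 2 ^ L := Nat.pow_le_pow_right (by norm_num) (by omega)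
      have e : 2 ^ (d + 1) = 2 * 2 ^ d := by ring
      rw [h (2 ^ d + q) (by have := Nat.one_le_two_pow (n := d); omega) (by omega)]
      have h1 := ih (d + 1) (by omega) (2 * q) (by omega)
      have h2 := ih (d + 1) (by omega) (2 * q + 1) (by omega)
      have e1 : 2 * (2 ^ d + q) = 2 ^ (d + 1) + 2 * q := by rw [e]; ring
      have e2 : 2 ^ (d + 1) + 2 * q + 1 = 2 ^ (d + 1) + (2 * q + 1) := by ring
      have e3 : q * 2 ^ (h' + 1) = 2 * q * 2 ^ h' := by ring
      have e4 : (q + 1) * 2 ^ (h' + 1) = (2 * q + 1 + 1) * 2 ^ h' := by ring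
      rw [e1, e2, e3, e4]
      have : 0 < 2 ^ h' := by positivity
      exact hf _ _ _ _ _ (by nlinarith) (by nlinarith) h1 h2
  simpa using key L 0 (by omega) 0 (by simp)

/-- A tree all of whose leaves carry a value `z` with `f z z = z` carries `z` everywhere. -/
theorem TreeOK.const {α : Type*} {L : ℕ} {f : α → α → α} {v : ℕ → α} (h : TreeOK L f v) {z : α}
    (hz : f z z = z) (hleaf : ∀ i, 2 ^ L ≤ i → v i = z) {i : ℕ} (hi : 1 ≤ i) : v i = z := by
  by_cases hL : i < 2 ^ L
  · rw [h i hi hL, h.const hz hleaf (i := 2 * i) (by omega),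
      h.const hz hleaf (i := 2 * i + 1) (by omega), hz]
  · exact hleaf i (by omega)
termination_by 2 ^ L - i

/-- Recompute the ancestors of the node `cursor`; `comb` recomputes the node `cursor`. -/
def walkUp (comb : Program) : Program :=
  .loop (.natLe 2 (.var cursor)) (.seq (.setNat cursor 0 (.var cursor / 2)) comb)

theorem walkUp_run {α : Type*} {W L c p : ℕ} {comb : Program} (node : State → ℕ → α)
    (f : α → α → α) (Inv : State → Prop) (hW : 2 ^ (L + 1) ≤ W)
    (hInv : ∀ s x, Inv s → Inv (s.putNat cursor 0 x))
    (hnode : ∀ s x, node (s.putNat cursor 0 x) = node s)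
    (hcomb : ∀ s i, Inv s → 1 ≤ i → i < 2 ^ L → s.nat cursor 0 = i →
      Run W comb s c fun s' => Inv s' ∧ s'.nat cursor 0 = i ∧
        node s' = Function.update (node s) i (f (node s (2 * i)) (node s (2 * i + 1))))
    {s : State} (hs : Inv s) (hp : p < 2 ^ L) (hcur : s.nat cursor 0 = 2 ^ L + p)
    (hOK : ∀ i, 1 ≤ i → i < 2 ^ L → i ≠ (2 ^ L + p) / 2 →
      node s i = f (node s (2 * i)) (node s (2 * i + 1))) :
    Run W (walkUp comb) s (L * (c + 12) + 5) fun s' => Inv s' ∧ TreeOK L f (node s') ∧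
      ∀ i, 2 ^ L ≤ i → node s' i = node s i := by
  have e : 2 ^ (L + 1) = 2 * 2 ^ L := by ring
  refine (Run.loop (n := L) (c := 6 + c) (fun r s' => ∃ x, s'.nat cursor 0 = x ∧ 1 ≤ x ∧
    x < 2 ^ (r + 1) ∧ x < 2 ^ (L + 1) ∧ Inv s' ∧
    (∀ i, 1 ≤ i → i < 2 ^ L → i ≠ x / 2 →
      node s' i = f (node s' (2 * i)) (node s' (2 * i + 1))) ∧
    ∀ i, 2 ^ L ≤ i → node s' i = node s i) ?_ ?_ ?_ ?_).mono ?_ (fun _ h => h)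
  · rintro s' ⟨x, h1, h2, h3, -⟩
    simp at h3 ⊢
    omega
  · rintro r s' ⟨x, h1, h2, h3, h4, h5, h6, h7⟩ hb
    simp [h1] at hb
    have hstep : Run W (.setNat cursor 0 (.var cursor / 2)) s' 6 fun s'' =>
        s'' = s'.putNat cursor 0 (x / 2) :=
      Run.of_safe (by simp [Program.Safe, h1]; omega) (Nat.le_refl 6) (by simp [Program.eff, h1])
    refine Run.seq (hstep.mono le_rfl ?_)
    rintro s'' rfl
    refine (hcomb _ (x / 2) (hInv _ _ h5) (by omega) (by omega) (by simp)).mono le_rfl ?_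
    rintro s'' ⟨g1, g2, g3⟩
    rw [hnode] at g3
    have e' : 2 ^ (r + 1 + 1) = 2 * 2 ^ (r + 1) := by ring
    refine ⟨x / 2, g2, by omega, by omega, by omega, g1, ?_, ?_⟩
    · intro i hi1 hi2 hi3
      rw [g3]
      by_cases hix : i = x / 2
      · subst hix
        rw [Function.update_self, Function.update_of_ne (by omega),
          Function.update_of_ne (by omega)]
      · rw [Function.update_of_ne hix, Function.update_of_ne (by omega),
          Function.update_of_ne (by omega)]
        exact h6 i hi1 hi2 hix
    · intro i hi
      rw [g3, Function.update_of_ne (by omega)]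
      exact h7 i hi
  · rintro r s' ⟨x, h1, h2, h3, h4, h5, h6, h7⟩ hb
    simp [h1] at hb
    exact ⟨h5, fun i hi1 hi2 => h6 i hi1 hi2 (by omega), h7⟩
  · exact ⟨_, hcur, by omega, by omega, by omega, hs, hOK, fun _ _ => rfl⟩
  · show L * (4 + 1 + (6 + c)) + 5 ≤ _
    apply Nat.add_le_add_right
    exact Nat.mul_le_mul_left _ (by omega)

/-! ### Sorting with a tournament tree -/

/-- Sort keys, compared lexicographically. -/
abbrev Key := ℝ ×ₗ ℝ ×ₗ ℝ

/-- The sort key with the given components. -/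
def mkKey (x y z : ℝ) : Key := toLex (x, toLex (y, z))

/-- The sort key of the item `e`. -/
def State.key (s : State) (e : ℕ) : Key := mkKey (s.real keyA e) (s.real keyB e) (s.real keyC e)

theorem mkKey_le {x y z x' y' z' : ℝ} : mkKey x y z ≤ mkKey x' y' z' ↔
    x < x' ∨ (x ≤ x' ∧ (y < y' ∨ (y ≤ y' ∧ z ≤ z'))) := by
  simp only [mkKey, Prod.Lex.toLex_le_toLex]
  constructor
  · rintro (h | ⟨rfl, h | ⟨rfl, h⟩⟩)
    · exact .inl h
    · exact .inr ⟨le_rfl, .inl h⟩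
    · exact .inr ⟨le_rfl, .inr ⟨le_rfl, h⟩⟩
  · rintro (h | ⟨h, h'⟩)
    · exact .inl h
    · rcases h.lt_or_eq with h | rfl
      · exact .inl h
      · refine .inr ⟨rfl, ?_⟩
        rcases h' with h' | ⟨h', h''⟩
        · exact .inl h'
        · rcases h'.lt_or_eq with h | rfl
          · exact .inl h
          · exact .inr ⟨rfl, h''⟩

/-- Comparison of the sort keys of two items. -/
def keyLe (a b : NatExpr) : Test :=
  .or (.realLt (.get keyA a) (.get keyA b)) (.and (.realLe (.get keyA a) (.get keyA b))
    (.or (.realLt (.get keyB a) (.get keyB b)) (.and (.realLe (.get keyB a) (.get keyB b))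
      (.realLe (.get keyC a) (.get keyC b)))))

theorem keyLe_holds (s : State) (a b : NatExpr) :
    (keyLe a b).Holds s ↔ s.key (a.eval s) ≤ s.key (b.eval s) := by
  simp [keyLe, State.key, mkKey_le]

/-- The winner of a match: `0` stands for "nobody" and `e + 1` for the item `e`. -/
noncomputable def playMatch (K : ℕ → Key) (a b : ℕ) : ℕ :=
  open Classical in if a ≠ 0 ∧ (b = 0 ∨ K (a - 1) ≤ K (b - 1)) then a else b

/-- Replay the match at the node `cursor`. -/
def replay : Program :=
  .ite (.and (.natLe 1 (.get winnerArr (2 * .var cursor)))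
      (.or (.natLe (.get winnerArr (2 * .var cursor + 1)) 0)
        (keyLe (.get winnerArr (2 * .var cursor) - 1) (.get winnerArr (2 * .var cursor + 1) - 1))))
    (.setNat winnerArr (.var cursor) (.get winnerArr (2 * .var cursor)))
    (.setNat winnerArr (.var cursor) (.get winnerArr (2 * .var cursor + 1)))

/-- Sort the items `0, …, itemCount - 1` into the array `orderArr`: enter them into a tournament,
and repeatedly remove the winner. Afterwards the tournament is empty again. -/
def sortItems : Program :=
  .seq
    (forLoop loopI (.var itemCount)
      (.seq (.setNat cursor 0 (.var treeSize + .var loopI))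
        (.seq (.setNat winnerArr (.var cursor) (.var loopI + 1)) (walkUp replay))))
    (forLoop loopI (.var itemCount)
      (.seq (.setNat orderArr (.var loopI) (.get winnerArr 1 - 1))
        (.seq (.setNat cursor 0 (.var treeSize + .get orderArr (.var loopI)))
          (.seq (.setNat winnerArr (.var cursor) 0) (walkUp replay)))))

/-- The sequence `o 0, …, o (N - 1)` lists the items `0, …, N - 1` in the order of their keys. -/
structure IsSorting (K : ℕ → Key) (N : ℕ) (o : ℕ → ℕ) : Prop where
  lt : ∀ r < N, o r < N
  inj : ∀ r < N, ∀ r' < N, o r = o r' → r = r'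
  mono : ∀ r r', r < r' → r' < N → K (o r) ≤ K (o r')

theorem IsSorting.surj {K : ℕ → Key} {N : ℕ} {o : ℕ → ℕ} (h : IsSorting K N o) {e : ℕ}
    (he : e < N) : ∃ r < N, o r = e := by
  have hinj : Function.Injective fun r : Fin N => (⟨o r, h.lt r r.2⟩ : Fin N) := by
    intro r r' hr
    exact Fin.ext (h.inj r r.2 r' r'.2 (by simpa using hr))
  obtain ⟨r, hr⟩ := Finite.injective_iff_surjective.1 hinj ⟨e, he⟩
  exact ⟨r, r.2, by simpa using hr⟩

/-- The winner of a tournament is an item with minimum key. -/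
theorem tournament_root {K : ℕ → Key} {L : ℕ} {v : ℕ → ℕ} (h : TreeOK L (playMatch K) v)
    (hne : ∃ p < 2 ^ L, v (2 ^ L + p) ≠ 0) :
    (∃ p < 2 ^ L, v (2 ^ L + p) = v 1) ∧ v 1 ≠ 0 ∧
      ∀ p < 2 ^ L, v (2 ^ L + p) ≠ 0 → K (v 1 - 1) ≤ K (v (2 ^ L + p) - 1) := by
  have := h.root (fun a lo hi => (a = 0 ∧ ∀ p, lo ≤ p → p < hi → v (2 ^ L + p) = 0) ∨
    (a ≠ 0 ∧ (∃ p, lo ≤ p ∧ p < hi ∧ v (2 ^ L + p) = a) ∧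
      ∀ p, lo ≤ p → p < hi → v (2 ^ L + p) ≠ 0 → K (a - 1) ≤ K (v (2 ^ L + p) - 1))) ?_ ?_
  · rcases this with ⟨-, h0⟩ | ⟨h1, ⟨p, -, hp, hpv⟩, h3⟩
    · obtain ⟨p, hp, hp'⟩ := hne
      exact absurd (h0 p (Nat.zero_le _) hp) hp'
    · exact ⟨⟨p, hp, hpv⟩, h1, fun p hp => h3 p (Nat.zero_le _) hp⟩
  · intro p hp
    by_cases h0 : v (2 ^ L + p) = 0
    · left
      refine ⟨h0, fun q h1 h2 => ?_⟩
      obtain rfl : q = p := by omega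
      exact h0
    · right
      refine ⟨h0, ⟨p, le_rfl, by omega, rfl⟩, fun q h1 h2 _ => ?_⟩
      obtain rfl : q = p := by omega
      exact le_rfl
  · rintro a b lo mid hi hlm hmh ha hb
    unfold playMatch
    rcases ha with ⟨rfl, ha⟩ | ⟨ha, ⟨p, hp1, hp2, hp3⟩, ha'⟩
    · simp only [ne_eq, not_true_eq_false, false_and, if_false]
      rcases hb with ⟨rfl, hb⟩ | ⟨hb, ⟨p, hp1, hp2, hp3⟩, hb'⟩
      · left
        refine ⟨rfl, fun p h1 h2 => ?_⟩
        by_cases hpm : p < mid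
        exacts [ha p h1 hpm, hb p (by omega) h2]
      · right
        refine ⟨hb, ⟨p, by omega, hp2, hp3⟩, fun q h1 h2 h3 => ?_⟩
        by_cases hpm : q < mid
        exacts [absurd (ha q h1 hpm) h3, hb' q (by omega) h2 h3]
    · right
      rcases hb with ⟨rfl, hb⟩ | ⟨hb, ⟨q, hq1, hq2, hq3⟩, hb'⟩
      · simp only [ne_eq, ha, not_false_eq_true, true_or, and_self, if_true]
        refine ⟨trivial, ⟨p, hp1, by omega, hp3⟩, fun q h1 h2 h3 => ?_⟩
        by_cases hpm : q < mid
        exacts [ha' q h1 hpm h3, absurd (hb q (by omega) h2) h3]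
      · by_cases hab : K (a - 1) ≤ K (b - 1)
        · simp only [ne_eq, ha, not_false_eq_true, hab, or_true, and_self, if_true]
          refine ⟨trivial, ⟨p, hp1, by omega, hp3⟩, fun q h1 h2 h3 => ?_⟩
          by_cases hpm : q < mid
          exacts [ha' q h1 hpm h3, hab.trans (hb' q (by omega) h2 h3)]
        · simp only [ne_eq, ha, not_false_eq_true, hab, hb, or_self, and_false, if_false]
          refine ⟨trivial, ⟨q, by omega, hq2, hq3⟩, fun q h1 h2 h3 => ?_⟩
          by_cases hpm : q < mid
          exacts [(le_of_not_ge hab).trans (ha' q h1 hpm h3), hb' q (by omega) h2 h3]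

/-- The part of the memory on which a tournament depends. -/
def TourInv (s₀ : State) (L : ℕ) (s : State) : Prop :=
  s.key = s₀.key ∧ s.nat treeSize 0 = 2 ^ L

theorem replay_walkUp {W L p : ℕ} {s₀ s : State} (hW : 2 ^ (L + 1) ≤ W)
    (hw : ∀ i, s.nat winnerArr i < W) (hs : TourInv s₀ L s) (hp : p < 2 ^ L)
    (hcur : s.nat cursor 0 = 2 ^ L + p)
    (hOK : ∀ i, 1 ≤ i → i < 2 ^ L → i ≠ (2 ^ L + p) / 2 → s.nat winnerArr i =
      playMatch s₀.key (s.nat winnerArr (2 * i)) (s.nat winnerArr (2 * i + 1))) :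
    Run W (walkUp replay) s (L * (replay.time + 12) + 5) fun s' =>
      TreeOK L (playMatch s₀.key) (s'.nat winnerArr) ∧
      (∀ i, s'.nat winnerArr i < W) ∧
      ∀ i, 2 ^ L ≤ i → s'.nat winnerArr i = s.nat winnerArr i := by
  refine (walkUp_run (fun s => s.nat winnerArr) (playMatch s₀.key)
    (fun s => TourInv s₀ L s ∧ ∀ i, s.nat winnerArr i < W) hW ?_ ?_ ?_ ⟨hs, hw⟩ hp hcur hOK).mono
    le_rfl
    (fun s' h => ⟨h.2.1, h.1.2, h.2.2⟩)
  · rintro s x ⟨⟨h1, h2⟩, h3⟩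
    refine ⟨⟨?_, by simpa using h2⟩, by simpa using h3⟩
    rw [← h1]; rfl
  · intro s x; simp
  · rintro s i ⟨⟨h1, h2⟩, h3⟩ hi1 hi2 hc
    refine Run.of_safe ?_ le_rfl ?_
    · simp [replay, Program.Safe, h3]
    · have hk : ∀ (j v : ℕ), (s.putNat winnerArr j v).key = s₀.key := by
        intro j v; rw [← h1]; rfl
      have hf : ∀ x, x < W → (TourInv s₀ L (s.putNat winnerArr i x) ∧
          ∀ j, (s.putNat winnerArr i x).nat winnerArr j < W) ∧
          (s.putNat winnerArr i x).nat cursor 0 = i := by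
        intro x hx
        refine ⟨⟨⟨hk _ _, by simpa using h2⟩, fun j => ?_⟩, by simpa using hc⟩
        by_cases hj : j = i
        · subst hj; simpa using hx
        · simpa [hj] using h3 j
      simp only [replay, Program.eff]
      split_ifs with h
      · simp only [NatExpr.eval_get, NatExpr.eval_zero, hc]
        refine ⟨(hf _ (h3 _)).1, (hf _ (h3 _)).2, ?_⟩
        simp [hc, Nat.one_le_iff_ne_zero, keyLe_holds, h1] at h ⊢
        simp [playMatch, h]
      · simp only [NatExpr.eval_get, NatExpr.eval_zero, hc]
        refine ⟨(hf _ (h3 _)).1, (hf _ (h3 _)).2, ?_⟩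
        simp only [hc, Nat.one_le_iff_ne_zero, Test.holds_natLe, NatExpr.eval_get,
          NatExpr.eval_mul, NatExpr.eval_ofNat, NatExpr.eval_add, NatExpr.eval_sub,
          NatExpr.eval_zero, NatExpr.eval_one, Nat.le_zero, Test.holds_and, Test.holds_or,
          keyLe_holds, h1] at h ⊢
        simp [playMatch, h]

/-- A bound for the number of steps of `sortItems`. -/
def sortTime (N L : ℕ) : ℕ := 2 * (N * (L * (replay.time + 12) + 50) + 20)

theorem sortItems_run {W L N : ℕ} {s : State} (hW : 2 ^ (L + 1) ≤ W) (hN : N ≤ 2 ^ L)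
    (hcount : s.nat itemCount 0 = N) (hsize : s.nat treeSize 0 = 2 ^ L)
    (hzero : ∀ i, 1 ≤ i → s.nat winnerArr i = 0) (hlt : ∀ i, s.nat winnerArr i < W) :
    Run W sortItems s (sortTime N L) fun s' => IsSorting s.key N (s'.nat orderArr) ∧
      (∀ i, 1 ≤ i → s'.nat winnerArr i = 0) ∧ ∀ i, s'.nat winnerArr i < W := by
  have e : 2 ^ (L + 1) = 2 * 2 ^ L := by ring
  have hL := Nat.one_le_two_pow (n := L)
  have key_eq : ∀ {p : Program} {s s' : State}, Frame p s s' → p.writesReal keyA = false →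
      p.writesReal keyB = false → p.writesReal keyC = false → s'.key = s.key := by
    intro p s s' hf h1 h2 h3
    funext x
    simp only [State.key]
    rw [hf.2 _ h1, hf.2 _ h2, hf.2 _ h3]
  have all_zero : ∀ {s' : State}, TreeOK L (playMatch s.key) (s'.nat winnerArr) →
      (∀ p, s'.nat winnerArr (2 ^ L + p) = 0) → ∀ i, 1 ≤ i → s'.nat winnerArr i = 0 := by
    intro s' h h' i hi
    refine h.const (by simp [playMatch]) (fun i hi => ?_) hi
    obtain ⟨p, rfl⟩ := Nat.exists_eq_add_of_le hi
    exact h' p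
  -- A leaf is set, and the matches of its ancestors are replayed.
  have hset : ∀ {s₁ : State} (p x : ℕ), s₁.key = s.key → s₁.nat treeSize 0 = 2 ^ L →
      (∀ i, s₁.nat winnerArr i < W) → TreeOK L (playMatch s.key) (s₁.nat winnerArr) → p < 2 ^ L →
      x < W →
      Run W (walkUp replay) ((s₁.putNat cursor 0 (2 ^ L + p)).putNat winnerArr (2 ^ L + p) x)
        (L * (replay.time + 12) + 5) fun s' =>
          (TreeOK L (playMatch s.key) (s'.nat winnerArr) ∧ ∀ i, s'.nat winnerArr i < W) ∧
          (∀ q, s'.nat winnerArr (2 ^ L + q) =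
            if q = p then x else s₁.nat winnerArr (2 ^ L + q)) := by
    intro s₁ p x h1 h2 h3 h4 h5 h6
    refine (replay_walkUp (s₀ := s) (p := p)
      (s := (s₁.putNat cursor 0 (2 ^ L + p)).putNat winnerArr (2 ^ L + p) x)
      hW ?_ ⟨h1, by simpa using h2⟩ h5 (by simp) ?_).mono
      le_rfl ?_
    · intro i
      by_cases hi : i = 2 ^ L + p
      · subst hi; simpa using h6
      · simpa [hi] using h3 i
    · intro i hi1 hi2 hi3
      simp [show i ≠ 2 ^ L + p by omega, show 2 * i ≠ 2 ^ L + p by omega,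
        show 2 * i + 1 ≠ 2 ^ L + p by omega]
      exact h4 i hi1 hi2
    · rintro s' ⟨g1, g2, g3⟩
      refine ⟨⟨g1, g2⟩, fun q => ?_⟩
      rw [g3 _ (by omega)]
      by_cases hq : q = p
      · subst hq; simp
      · simp [hq]
  have hins : Run W (forLoop loopI (.var itemCount)
      (.seq (.setNat cursor 0 (.var treeSize + .var loopI))
        (.seq (.setNat winnerArr (.var cursor) (.var loopI + 1)) (walkUp replay)))) s
      (N * (L * (replay.time + 12) + 50) + 20) fun s' =>
      (TreeOK L (playMatch s.key) (s'.nat winnerArr) ∧ ∀ i, s'.nat winnerArr i < W) ∧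
        ∀ p, s'.nat winnerArr (2 ^ L + p) = if p < N then p + 1 else 0 := by
    refine Run.forLoop (c := L * (replay.time + 12) + 25) (n := N) (fun t s' =>
      (TreeOK L (playMatch s.key) (s'.nat winnerArr) ∧ ∀ i, s'.nat winnerArr i < W) ∧
        ∀ p, s'.nat winnerArr (2 ^ L + p) = if p < t then p + 1 else 0) (by omega) rfl ?_ ?_ ?_ ?_
        ?_
    · intro s' hf
      simp [hf.1 itemCount rfl, hcount]
    · refine ⟨⟨fun i h1 h2 => ?_, by simpa using hlt⟩, fun p => ?_⟩
      · simp [hzero i h1, hzero (2 * i) (by omega), hzero (2 * i + 1) (by omega), playMatch]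
      · simp [hzero (2 ^ L + p) (by omega)]
    · rintro t ht s' hf hv ⟨⟨h1, h2⟩, h3⟩
      have hk : s'.key = s.key := key_eq hf rfl rfl rfl
      have hs : s'.nat treeSize 0 = 2 ^ L := by rw [hf.1 treeSize rfl, hsize]
      have hstep : Run W (.setNat cursor 0 (.var treeSize + .var loopI)) s' 10 fun s'' =>
          s'' = s'.putNat cursor 0 (2 ^ L + t) :=
        Run.of_safe (by simp [Program.Safe, hs, hv]; omega) (by decide)
          (by simp [Program.eff, hs, hv])
      refine (Run.seq (hstep.mono (T₂ := 10) (Q' := fun s'' => Run W _ s''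
        (10 + (L * (replay.time + 12) + 5)) _) le_rfl ?_)).mono (by omega) (fun _ h => h)
      rintro s'' rfl
      have hstep' : Run W (.setNat winnerArr (.var cursor) (.var loopI + 1))
          (s'.putNat cursor 0 (2 ^ L + t)) 10 fun s'' =>
          s'' = (s'.putNat cursor 0 (2 ^ L + t)).putNat winnerArr (2 ^ L + t) (t + 1) :=
        Run.of_safe (by simp [Program.Safe, hv]; omega) (by decide)
          (by simp [Program.eff, hv])
      refine Run.seq (hstep'.mono le_rfl ?_)
      rintro s'' rfl
      refine (hset t (t + 1) hk hs h2 h1 (by omega) (by omega)).mono le_rfl ?_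
      rintro s'' ⟨g1, g2⟩
      simp only [State.nat_putNat, if_neg (show (winnerArr : ℕ) ≠ loopI by decide)]
      refine ⟨g1, fun p => ?_⟩
      rw [g2]
      by_cases hp : p = t
      · simp [hp]
      · simp only [hp, if_false, h3]
        by_cases hp' : p < t
        · simp [hp', show p < t + 1 by omega]
        · simp [hp', show ¬ p < t + 1 by omega]
    · simp only [NatExpr.cost]
      have : N * (L * (replay.time + 12) + 25 + (1 + 1) + 15) ≤
        N * (L * (replay.time + 12) + 50) := Nat.mul_le_mul_left _ (by omega)
      omega
    · rintro s' - h
      exact h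
  have hext : ∀ s₂ : State, s₂.key = s.key → s₂.nat treeSize 0 = 2 ^ L → s₂.nat itemCount 0 = N →
      ((TreeOK L (playMatch s.key) (s₂.nat winnerArr) ∧ ∀ i, s₂.nat winnerArr i < W) ∧
        ∀ p, s₂.nat winnerArr (2 ^ L + p) = if p < N then p + 1 else 0) →
      Run W (forLoop loopI (.var itemCount)
      (.seq (.setNat orderArr (.var loopI) (.get winnerArr 1 - 1))
        (.seq (.setNat cursor 0 (.var treeSize + .get orderArr (.var loopI)))
          (.seq (.setNat winnerArr (.var cursor) 0) (walkUp replay))))) s₂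
      (N * (L * (replay.time + 12) + 50) + 20) fun s' => IsSorting s.key N (s'.nat orderArr) ∧
      (∀ i, 1 ≤ i → s'.nat winnerArr i = 0) ∧ ∀ i, s'.nat winnerArr i < W := by
    intro s₂ hk₂ hs₂ hc₂ hI₂
    refine Run.forLoop (c := L * (replay.time + 12) + 33) (n := N) (fun t s' =>
      (TreeOK L (playMatch s.key) (s'.nat winnerArr) ∧ ∀ i, s'.nat winnerArr i < W) ∧
      (∀ p, s'.nat winnerArr (2 ^ L + p) =
        open Classical in if p < N ∧ ∀ r < t, s'.nat orderArr r ≠ p then p + 1 else 0) ∧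
      (∀ r < t, s'.nat orderArr r < N) ∧
      (∀ r < t, ∀ r' < t, s'.nat orderArr r = s'.nat orderArr r' → r = r') ∧
      (∀ r r', r < r' → r' < t → s.key (s'.nat orderArr r) ≤ s.key (s'.nat orderArr r')) ∧
      ∀ r < t, ∀ p < N, (∀ r < t, s'.nat orderArr r ≠ p) →
        s.key (s'.nat orderArr r) ≤ s.key p) (by omega) rfl ?_ ?_ ?_ ?_ ?_
    · intro s' hf
      simp [hf.1 itemCount rfl, hc₂]
    · simpa using hI₂
    · rintro t ht s' hf hv ⟨⟨h1, h2⟩, h3, h4, h5, h6, h7⟩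
      have hk : s'.key = s.key := (key_eq hf rfl rfl rfl).trans hk₂
      have hs : s'.nat treeSize 0 = 2 ^ L := by rw [hf.1 treeSize rfl, hs₂]
      -- Fewer than `N` items have been extracted, so that some item is left.
      have hleft : ∃ p < N, ∀ r < t, s'.nat orderArr r ≠ p := by
        by_contra hcon
        push Not at hcon
        have hsub : Finset.range N ⊆ (Finset.range t).image (s'.nat orderArr) := by
          intro p hp
          obtain ⟨r, hr, hr'⟩ := hcon p (Finset.mem_range.1 hp)
          exact Finset.mem_image.2 ⟨r, Finset.mem_range.2 hr, hr'⟩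
        have := (Finset.card_le_card hsub).trans Finset.card_image_le
        simp at this
        omega
      obtain ⟨p₀, hp₀, hp₀'⟩ := hleft
      have hleaf : ∀ p, s'.nat winnerArr (2 ^ L + p) ≠ 0 ↔
          p < N ∧ ∀ r < t, s'.nat orderArr r ≠ p := by
        intro p
        rw [h3]
        split_ifs with h
        exacts [iff_of_true (by omega) h, iff_of_false (by simp) h]
      obtain ⟨⟨p₁, hp₁, hp₁v⟩, hr0, hmin⟩ := tournament_root h1
        ⟨p₀, by omega, (hleaf p₀).2 ⟨hp₀, hp₀'⟩⟩
      have hp₁' : p₁ < N ∧ ∀ r < t, s'.nat orderArr r ≠ p₁ := (hleaf p₁).1 (by rw [hp₁v]; exact hr0)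
      have hroot : s'.nat winnerArr 1 = p₁ + 1 := by rw [← hp₁v, h3, if_pos hp₁']
      rw [hroot] at hmin
      simp only [Nat.add_sub_cancel] at hmin
      have hmin' : ∀ p < N, (∀ r < t, s'.nat orderArr r ≠ p) → s.key p₁ ≤ s.key p := by
        intro p hp hp'
        have := hmin p (by omega) ((hleaf p).2 ⟨hp, hp'⟩)
        rwa [h3, if_pos ⟨hp, hp'⟩] at this
      have hstep : Run W (.setNat orderArr (.var loopI) (.get winnerArr 1 - 1)) s' 10 fun s'' =>
          s'' = s'.putNat orderArr t p₁ :=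
        Run.of_safe (by simp [Program.Safe, hroot]; omega) (by decide)
          (by simp [Program.eff, hroot, hv])
      refine (Run.seq (hstep.mono (T₂ := 10) (Q' := fun s'' => Run W _ s''
        (10 + (6 + (L * (replay.time + 12) + 5))) _) le_rfl ?_)).mono (by omega) (fun _ h => h)
      rintro s'' rfl
      have hstep' : Run W (.setNat cursor 0 (.var treeSize + .get orderArr (.var loopI)))
          (s'.putNat orderArr t p₁) 10 fun s'' =>
          s'' = (s'.putNat orderArr t p₁).putNat cursor 0 (2 ^ L + p₁) :=
        Run.of_safe (by simp [Program.Safe, hv, hs]; omega) (by decide)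
          (by simp [Program.eff, hv, hs])
      refine Run.seq (hstep'.mono le_rfl ?_)
      rintro s'' rfl
      have hstep'' : Run W (.setNat winnerArr (.var cursor) 0)
          ((s'.putNat orderArr t p₁).putNat cursor 0 (2 ^ L + p₁)) 6 fun s'' =>
          s'' = ((s'.putNat orderArr t p₁).putNat cursor 0 (2 ^ L + p₁)).putNat winnerArr
            (2 ^ L + p₁) 0 :=
        Run.of_safe (by simp [Program.Safe]; omega) (by decide) (by simp [Program.eff])
      refine Run.seq (hstep''.mono le_rfl ?_)
      rintro s'' rfl
      refine (hset (s₁ := s'.putNat orderArr t p₁) p₁ 0 hk (by simpa using hs) (by simpa using h2)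
        (by simpa using h1) hp₁ (by omega)).framed le_rfl ?_
      rintro s'' hfr ⟨g1, g2⟩
      have hord : s''.nat orderArr = Function.update (s'.nat orderArr) t p₁ := by
        rw [hfr.1 orderArr rfl]; simp
      have hord1 : s''.nat orderArr t = p₁ := by rw [hord]; simp
      have hord2 : ∀ r < t, s''.nat orderArr r = s'.nat orderArr r := by
        intro r hr; rw [hord, Function.update_of_ne (by omega)]
      simp only [State.nat_putNat, if_neg (show (winnerArr : ℕ) ≠ loopI by decide),
        if_neg (show (orderArr : ℕ) ≠ loopI by decide)]
      have hlast : ∀ r < t + 1, r = t ∨ r < t := by intro r hr; omega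
      refine ⟨g1, fun p => ?_, ?_, ?_, ?_, ?_⟩
      · rw [g2]
        by_cases hp : p = p₁
        · subst hp
          rw [if_pos rfl, if_neg]
          rintro ⟨-, hcon⟩
          exact hcon t (by omega) hord1
        · rw [if_neg hp]
          simp only [State.nat_putNat, if_neg (show (winnerArr : ℕ) ≠ orderArr by decide), h3]
          congr 1
          refine propext (and_congr_right fun _ => ⟨fun h r hr => ?_, fun h r hr => ?_⟩)
          · rcases hlast r hr with rfl | hr'
            · rw [hord1]; exact fun h => hp h.symm
            · rw [hord2 r hr']; exact h r hr'
          · rw [← hord2 r hr]; exact h r (by omega)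
      · intro r hr
        rcases hlast r hr with rfl | hr'
        · rw [hord1]; exact hp₁'.1
        · rw [hord2 r hr']; exact h4 r hr'
      · intro r hr r' hr' heq
        rcases hlast r hr with rfl | h <;> rcases hlast r' hr' with h' | h'
        · exact h'.symm
        · rw [hord1, hord2 _ h'] at heq
          exact absurd heq.symm (hp₁'.2 _ h')
        · subst h'
          rw [hord1, hord2 _ h] at heq
          exact absurd heq (hp₁'.2 _ h)
        · rw [hord2 _ h, hord2 _ h'] at heq
          exact h5 r h r' h' heq
      · intro r r' hrr hr'
        rcases hlast r' hr' with rfl | h'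
        · rw [hord1, hord2 r hrr]
          exact h7 r hrr p₁ hp₁'.1 hp₁'.2
        · rw [hord2 r (by omega), hord2 r' h']
          exact h6 r r' hrr h'
      · intro r hr p hp hp'
        have hp'' : ∀ r < t, s'.nat orderArr r ≠ p := by
          intro r hr; rw [← hord2 r hr]; exact hp' r (by omega)
        rcases hlast r hr with rfl | h
        · rw [hord1]; exact hmin' p hp hp''
        · rw [hord2 r h]; exact h7 r h p hp hp''
    · simp only [NatExpr.cost]
      have : N * (L * (replay.time + 12) + 33 + (1 + 1) + 15) ≤
        N * (L * (replay.time + 12) + 50) := Nat.mul_le_mul_left _ (by omega)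
      omega
    · rintro s' - ⟨⟨h1, h2⟩, h3, h4, h5, h6, h7⟩
      have hsort : IsSorting s.key N (s'.nat orderArr) := ⟨h4, h5, h6⟩
      refine ⟨hsort, all_zero h1 fun p => ?_, h2⟩
      rw [h3, if_neg]
      rintro ⟨hp, hp'⟩
      obtain ⟨r, hr, hr'⟩ := hsort.surj hp
      exact hp' r hr hr'
  refine (Run.seq (hins.framed le_rfl ?_)).mono (T₁ := (N * (L * (replay.time + 12) + 50) + 20) +
    (N * (L * (replay.time + 12) + 50) + 20)) (by unfold sortTime; omega) (fun _ h => h)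
  intro s' hf h
  exact hext s' (key_eq hf rfl rfl rfl) (by rw [hf.1 treeSize rfl, hsize])
    (by rw [hf.1 itemCount rfl, hcount]) h

end RealRAM

/-! ### A tree for maximum suffix sums -/

namespace RealRAM

/-- A node of the suffix sum tree: the sum of the leaves below it, the maximum of the sums of
nonempty suffixes of these leaves, and the label of the leaf where a maximal suffix starts. -/
def suffixNode (s : State) (i : ℕ) : ℝ × ℝ × ℕ :=
  (s.real sumArr i, s.real sufArr i, s.nat argBest i)

open Classical in
/-- The parent of two nodes of the suffix sum tree. -/
noncomputable def joinSuffix (a b : ℝ × ℝ × ℕ) : ℝ × ℝ × ℕ :=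
  (a.1 + b.1, if b.2.1 ≤ a.2.1 + b.1 then (a.2.1 + b.1, a.2.2) else b.2)

/-- Recompute the node `cursor` of the suffix sum tree. -/
def rejoin : Program :=
  .seq
    (.ite (.realLe (.get sufArr (2 * .var cursor + 1))
        (.get sufArr (2 * .var cursor) + .get sumArr (2 * .var cursor + 1)))
      (.seq (.setReal sufArr (.var cursor)
          (.get sufArr (2 * .var cursor) + .get sumArr (2 * .var cursor + 1)))
        (.setNat argBest (.var cursor) (.get argBest (2 * .var cursor))))
      (.seq (.setReal sufArr (.var cursor) (.get sufArr (2 * .var cursor + 1)))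
        (.setNat argBest (.var cursor) (.get argBest (2 * .var cursor + 1)))))
    (.setReal sumArr (.var cursor)
      (.get sumArr (2 * .var cursor) + .get sumArr (2 * .var cursor + 1)))

/-- Give the leaf number `p` of the suffix sum tree the value `x` and its own number as label. -/
def setLeaf (p : NatExpr) (x : RealExpr) : Program :=
  .seq (.setNat cursor 0 (.var treeSize + p))
    (.seq (.setReal sumArr (.var cursor) x)
      (.seq (.setReal sufArr (.var cursor) x)
        (.seq (.setNat argBest (.var cursor) (.var cursor - .var treeSize))
          (walkUp rejoin))))

/-- The memory holds a suffix sum tree with `2 ^ L` leaves, the values `d` and the labels `g`. -/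
structure SuffixTree (W L : ℕ) (s : State) (d : ℕ → ℝ) (g : ℕ → ℕ) : Prop where
  size : s.nat treeSize 0 = 2 ^ L
  ok : TreeOK L joinSuffix (suffixNode s)
  leaf : ∀ p, suffixNode s (2 ^ L + p) = (d p, d p, g p)
  lt : ∀ i, s.nat argBest i < W

theorem SuffixTree.root {W L : ℕ} {s : State} {d : ℕ → ℝ} {g : ℕ → ℕ}
    (h : SuffixTree W L s d g) :
    (∀ p < 2 ^ L, ∑ r ∈ Finset.Ico p (2 ^ L), d r ≤ s.real sufArr 1) ∧
      ∃ p < 2 ^ L, ∑ r ∈ Finset.Ico p (2 ^ L), d r = s.real sufArr 1 ∧ s.nat argBest 1 = g p := by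
  have := h.ok.root (fun a lo hi => a.1 = ∑ r ∈ Finset.Ico lo hi, d r ∧
    (∀ p, lo ≤ p → p < hi → ∑ r ∈ Finset.Ico p hi, d r ≤ a.2.1) ∧
    ∃ p, lo ≤ p ∧ p < hi ∧ ∑ r ∈ Finset.Ico p hi, d r = a.2.1 ∧ a.2.2 = g p) ?_ ?_
  · obtain ⟨-, h2, p, -, h3, h4⟩ := this
    exact ⟨fun p hp => h2 p (Nat.zero_le _) hp, p, h3, h4⟩
  · intro p hp
    rw [h.leaf]
    refine ⟨by simp, fun q h1 h2 => ?_, p, le_rfl, by omega, by simp, rfl⟩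
    obtain rfl : q = p := by omega
    simp
  · rintro a b lo mid hi hlm hmh ⟨ha1, ha2, p, hp1, hp2, hp3, hp4⟩
      ⟨hb1, hb2, q, hq1, hq2, hq3, hq4⟩
    have hsplit : ∀ p, p < mid → ∑ r ∈ Finset.Ico p hi, d r =
        ∑ r ∈ Finset.Ico p mid, d r + b.1 := by
      intro p hp
      rw [hb1, Finset.sum_Ico_consecutive _ hp.le hmh.le]
    refine ⟨by simp only [joinSuffix]; rw [ha1, hsplit lo hlm], ?_, ?_⟩
    · intro p h1 h2
      have hmax : (joinSuffix a b).2.1 = max (a.2.1 + b.1) b.2.1 := by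
        simp only [joinSuffix]
        split_ifs with hc
        exacts [(max_eq_left hc).symm, (max_eq_right (not_le.1 hc).le).symm]
      rw [hmax]
      by_cases hp : p < mid
      · rw [hsplit p hp]
        exact le_max_of_le_left (by linarith [ha2 p h1 hp])
      · exact le_max_of_le_right (hb2 p (by omega) h2)
    · simp only [joinSuffix]
      split_ifs with hc
      · exact ⟨p, hp1, by omega, by rw [hsplit p hp2, hp3], hp4⟩
      · exact ⟨q, by omega, hq2, hq3, hq4⟩

theorem setLeaf_run {W L p : ℕ} {s : State} {d : ℕ → ℝ} {g : ℕ → ℕ} {pe : NatExpr}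
    {xe : RealExpr} {x : ℝ} (h : SuffixTree W L s d g) (hW : 2 ^ (L + 1) ≤ W) (hp : p < 2 ^ L)
    (hpe : pe.eval s = p) (hxe : ∀ s', s'.real bigVal = s.real bigVal → xe.eval s' = x) :
    Run W (setLeaf pe xe) s (L * (rejoin.time + 12) + pe.cost + 2 * xe.cost + 40) fun s' =>
      SuffixTree W L s' (Function.update d p x) (Function.update g p p) := by
  have e : 2 ^ (L + 1) = 2 * 2 ^ L := by ring
  have h1 : Run W (.setNat cursor 0 (.var treeSize + pe)) s (pe.cost + 8) fun s' =>
      s' = s.putNat cursor 0 (2 ^ L + p) :=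
    Run.of_safe (by simp [Program.Safe, h.size, hpe]; omega)
      (by simp only [Program.time, NatExpr.cost]; show 1 + (2 + pe.cost + 1) + 1 ≤ _; omega)
      (by simp [Program.eff, h.size, hpe])
  have h2 : ∀ s' : State, s'.nat cursor 0 = 2 ^ L + p → s'.real bigVal = s.real bigVal →
      Run W (.setReal sumArr (.var cursor) xe) s' (xe.cost + 8)
      fun s'' => s'' = s'.putReal sumArr (2 ^ L + p) x := by
    intro s' hs' hb
    refine Run.of_safe (by simp [Program.Safe]) ?_ (by simp [Program.eff, hs', hxe _ hb])
    show 2 + xe.cost + 1 ≤ _; omega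
  have h3 : ∀ s' : State, s'.nat cursor 0 = 2 ^ L + p → s'.real bigVal = s.real bigVal →
      Run W (.setReal sufArr (.var cursor) xe) s' (xe.cost + 8)
      fun s'' => s'' = s'.putReal sufArr (2 ^ L + p) x := by
    intro s' hs' hb
    refine Run.of_safe (by simp [Program.Safe]) ?_ (by simp [Program.eff, hs', hxe _ hb])
    show 2 + xe.cost + 1 ≤ _; omega
  refine (Run.seq (h1.mono le_rfl (T₂ := pe.cost + 8) (Q' := fun s'' => Run W _ s''
    ((xe.cost + 8) + ((xe.cost + 8) + (8 + (L * (rejoin.time + 12) + 5)))) _) ?_)).mono (by omega)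
    (fun _ h => h)
  rintro s' rfl
  refine Run.seq ((h2 _ (by simp) (by simp)).mono le_rfl ?_)
  rintro s' rfl
  refine Run.seq ((h3 _ (by simp) (by simp)).mono le_rfl ?_)
  rintro s' rfl
  refine Run.seq ((Run.of_safe (Q := fun s' => s' = (((s.putNat cursor 0 (2 ^ L + p)).putReal
    sumArr (2 ^ L + p) x).putReal sufArr (2 ^ L + p) x).putNat argBest (2 ^ L + p) p)
    ?_ (Nat.le_refl 8) ?_).mono le_rfl ?_)
  · simp [Program.Safe, h.size]; omega
  · simp [Program.eff, h.size]
  rintro s' rfl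
  generalize hs₁ : (((s.putNat cursor 0 (2 ^ L + p)).putReal
    sumArr (2 ^ L + p) x).putReal sufArr (2 ^ L + p) x).putNat argBest (2 ^ L + p) p = s₁
  have hcur : s₁.nat cursor 0 = 2 ^ L + p := by simp [← hs₁]
  have hnode : suffixNode s₁ = Function.update (suffixNode s) (2 ^ L + p) (x, x, p) := by
    funext i
    by_cases hi : i = 2 ^ L + p
    · subst hi; simp [← hs₁, suffixNode]
    · simp [← hs₁, suffixNode, hi]
  have hsize₁ : s₁.nat treeSize 0 = 2 ^ L := by simp [← hs₁, h.size]
  have hlt₁ : ∀ i, s₁.nat argBest i < W := by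
    intro i
    by_cases hi : i = 2 ^ L + p
    · subst hi; simp [← hs₁]; omega
    · simpa [← hs₁, hi] using h.lt i
  refine (walkUp_run suffixNode joinSuffix
    (fun s => s.nat treeSize 0 = 2 ^ L ∧ ∀ i, s.nat argBest i < W) hW (c := rejoin.time)
    ?_ ?_ ?_ ⟨hsize₁, hlt₁⟩ hp hcur ?_).mono le_rfl ?_
  · rintro s y ⟨g1, g2⟩
    exact ⟨by simpa using g1, by simpa using g2⟩
  · intro s y
    funext i
    simp [suffixNode]
  · rintro s i ⟨g1, g2⟩ hi1 hi2 hc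
    refine Run.of_safe ?_ le_rfl ?_
    · simp [rejoin, Program.Safe, Program.eff, g2]
    · simp only [rejoin, Program.eff, Test.holds_realLe, RealExpr.eval_get, RealExpr.eval_add,
        NatExpr.eval_get, NatExpr.eval_mul, NatExpr.eval_ofNat, NatExpr.eval_add,
        NatExpr.eval_zero, NatExpr.eval_one, hc]
      have hlt : ∀ x < W, ∀ j, Function.update (s.nat argBest) i x j < W := by
        intro x hx j
        by_cases hj : j = i
        · subst hj; simpa using hx
        · simpa [hj] using g2 j
      split_ifs with hif
      · refine ⟨⟨by simpa using g1, ?_⟩, by simpa using hc, ?_⟩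
        · simpa [hc] using hlt _ (g2 _)
        · funext j
          by_cases hj : j = i
          · subst hj
            simp [suffixNode, joinSuffix, hif, hc]
          · simp [suffixNode, hj, hc]
      · refine ⟨⟨by simpa using g1, ?_⟩, by simpa using hc, ?_⟩
        · simpa [hc] using hlt _ (g2 _)
        · funext j
          by_cases hj : j = i
          · subst hj
            simp [suffixNode, joinSuffix, hif, hc]
          · simp [suffixNode, hj, hc]
  · intro i hi1 hi2 hi3
    rw [hnode, Function.update_of_ne (by omega), Function.update_of_ne (by omega),
      Function.update_of_ne (by omega)]
    exact h.ok i hi1 hi2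
  · rintro s' ⟨⟨g1, g2⟩, g3, g4⟩
    refine ⟨g1, g3, fun q => ?_, g2⟩
    rw [g4 _ (by omega), hnode]
    by_cases hq : q = p
    · subst hq; simp
    · simp [hq, h.leaf]

end RealRAM

/-! ### Sequences of paired ends -/

namespace RealRAM

/-- A sequence of `N` items, each of which has a cell and belongs to a line; `mate` matches the
items, and two items belong to the same line and cell only if they are mates. -/
structure Paired (N : ℕ) (cell : ℕ → ℝ) (line mate : ℕ → ℕ) : Prop where
  mono : ∀ r r', r < r' → r' < N → cell r ≤ cell r'
  lt : ∀ r < N, mate r < N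
  ne : ∀ r < N, mate r ≠ r
  invol : ∀ r < N, mate (mate r) = r
  cell_mate : ∀ r < N, cell (mate r) = cell r
  line_mate : ∀ r < N, line (mate r) = line r
  eq_or : ∀ r < N, ∀ r' < N, line r = line r' → cell r = cell r' → r' = r ∨ r' = mate r

/-- The items of the interval `[p, q]` whose mates do not belong to this interval. -/
def singles (mate : ℕ → ℕ) (p q : ℕ) : Finset ℕ :=
  (Finset.Icc p q).filter fun r => ¬ (p ≤ mate r ∧ mate r ≤ q)

/-- The leaves of the suffix sum tree after `q` items have been processed. -/
noncomputable def scanLeaf (big : ℝ) (cell : ℕ → ℝ) (mate : ℕ → ℕ) (q r : ℕ) : ℝ :=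
  open Classical in
  if r < q then
    if r + 1 < q ∧ cell r < cell (r + 1) then -big
    else if r < mate r ∧ mate r < q then -1 else 1
  else 0

section
variable {N : ℕ} {cell : ℕ → ℝ} {line mate : ℕ → ℕ} {big : ℝ}

theorem Paired.cell_eq (h : Paired N cell line mate) {p r q : ℕ} (h1 : p ≤ r) (h2 : r ≤ q)
    (hq : q < N) (hc : cell p = cell q) : cell r = cell q := by
  rcases h1.lt_or_eq with h1 | rfl
  · rcases h2.lt_or_eq with h2 | rfl
    · exact le_antisymm (h.mono _ _ h2 hq) (hc ▸ h.mono _ _ h1 (by omega))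
    · rfl
  · exact hc

theorem scanLeaf_of_le {q r : ℕ} (hr : q ≤ r) : scanLeaf big cell mate q r = 0 := by
  simp [scanLeaf, not_lt.2 hr]

/-- Matched items of an interval cancel: an opening item carries `-1` and its closing mate `1`. -/
theorem Paired.sum_scanLeaf (h : Paired N cell line mate) {p q : ℕ} (hq : q < N)
    (hc : cell p = cell q) :
    ∑ r ∈ Finset.Icc p q, scanLeaf big cell mate (q + 1) r = (singles mate p q).card := by
  have hval : ∀ r ∈ Finset.Icc p q, scanLeaf big cell mate (q + 1) r =
      if r < mate r ∧ mate r < q + 1 then -1 else 1 := by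
    intro r hr
    rw [Finset.mem_Icc] at hr
    unfold scanLeaf
    rw [if_pos (by omega), if_neg]
    rintro ⟨h1, h2⟩
    rw [h.cell_eq hr.1 hr.2 hq hc, h.cell_eq (r := r + 1) (by omega) (by omega) hq hc] at h2
    exact lt_irrefl _ h2
  rw [Finset.sum_congr rfl hval, singles, Finset.card_filter, Nat.cast_sum, ← sub_eq_zero,
    ← Finset.sum_sub_distrib]
  refine Finset.sum_involution (fun r _ => if p ≤ mate r ∧ mate r ≤ q then mate r else r)
    ?_ ?_ ?_ ?_
  · intro r hr
    rw [Finset.mem_Icc] at hr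
    have hi := h.invol r (by omega)
    have hn := h.ne r (by omega)
    by_cases h1 : p ≤ mate r ∧ mate r ≤ q
    · simp only [h1, and_self, if_true, hi, hr, not_true_eq_false, if_false]
      by_cases h2 : r < mate r
      · simp [h2, show mate r < q + 1 by omega, show ¬ mate r < r by omega]
      · simp [h2, show r < q + 1 by omega, show mate r < r by omega]
    · simp only [h1, if_false, not_false_eq_true, if_true]
      rw [if_neg (by omega)]
      simp
  · intro r hr hne
    rw [Finset.mem_Icc] at hr
    by_cases h1 : p ≤ mate r ∧ mate r ≤ q
    · simpa only [h1, and_self, if_true, ne_eq] using h.ne r (by omega)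
    · exfalso
      apply hne
      simp only [h1, not_false_eq_true, if_true]
      rw [if_neg (by omega)]
      simp
  · intro r hr
    rw [Finset.mem_Icc] at hr
    split_ifs with h1
    · exact Finset.mem_Icc.2 h1
    · exact Finset.mem_Icc.2 hr
  · intro r hr
    rw [Finset.mem_Icc] at hr
    by_cases h1 : p ≤ mate r ∧ mate r ≤ q
    · simp [h1, h.invol r (by omega), hr]
    · simp [h1]

theorem scanLeaf_le_one (hbig : 0 ≤ big) (q r : ℕ) : scanLeaf big cell mate q r ≤ 1 := by
  unfold scanLeaf
  split_ifs <;> linarith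

/-- An interval that meets several cells has a nonpositive sum. -/
theorem Paired.sum_scanLeaf_nonpos (h : Paired N cell line mate) (hbig : (N : ℝ) ≤ big) {p q : ℕ}
    (hpq : p ≤ q) (hq : q < N) (hc : cell p ≠ cell q) :
    ∑ r ∈ Finset.Icc p q, scanLeaf big cell mate (q + 1) r ≤ 0 := by
  have hb0 : (0 : ℝ) ≤ big := (Nat.cast_nonneg N).trans hbig
  obtain ⟨r, hr1, hr2, hr3⟩ : ∃ r, p ≤ r ∧ r < q ∧ cell r < cell (r + 1) := by
    by_contra hcon
    push Not at hcon
    have : ∀ i, p + i ≤ q → cell (p + i) = cell p := by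
      intro i
      induction i with
      | zero => simp
      | succ i ih =>
        intro hi
        rw [← ih (by omega)]
        exact le_antisymm (hcon (p + i) (by omega) (by omega))
          (h.mono _ _ (by omega) (by omega))
    have := this (q - p) (by omega)
    rw [Nat.add_sub_cancel' hpq] at this
    exact hc this.symm
  have hmem : r ∈ Finset.Icc p q := Finset.mem_Icc.2 ⟨hr1, hr2.le⟩
  rw [← Finset.add_sum_erase _ _ hmem]
  have h1 : scanLeaf big cell mate (q + 1) r = -big := by
    unfold scanLeaf
    rw [if_pos (by omega), if_pos ⟨by omega, hr3⟩]
  have h2 : ∑ x ∈ (Finset.Icc p q).erase r, scanLeaf big cell mate (q + 1) x ≤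
      ((Finset.Icc p q).erase r).card • (1 : ℝ) :=
    Finset.sum_le_card_nsmul _ _ _ fun x _ => scanLeaf_le_one hb0 _ _
  rw [Finset.card_erase_of_mem hmem, Nat.card_Icc, nsmul_eq_mul, mul_one] at h2
  have h3 : ((q + 1 - p - 1 : ℕ) : ℝ) ≤ N := by exact_mod_cast (by omega : q + 1 - p - 1 ≤ N)
  rw [h1]
  linarith

theorem sum_Ico_scanLeaf {p q S : ℕ} (hq : q < N) (hN : N ≤ S) :
    ∑ r ∈ Finset.Ico p S, scanLeaf big cell mate (q + 1) r =
      ∑ r ∈ Finset.Icc p q, scanLeaf big cell mate (q + 1) r := by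
  symm
  refine Finset.sum_subset (fun r hr => ?_) (fun r hr hr' => scanLeaf_of_le ?_)
  · rw [Finset.mem_Icc] at hr
    exact Finset.mem_Ico.2 ⟨hr.1, by omega⟩
  · rw [Finset.mem_Ico] at hr
    rw [Finset.mem_Icc] at hr'
    omega

/-- The effect of one item on the leaves of the suffix sum tree. -/
theorem Paired.scanLeaf_succ (h : Paired N cell line mate) {q : ℕ} (hq : q < N) :
    scanLeaf big cell mate (q + 1) =
      (open Classical in
      let d₁ := if 1 ≤ q ∧ cell (q - 1) < cell q then
        Function.update (scanLeaf big cell mate q) (q - 1) (-big) else scanLeaf big cell mate q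
      let d₂ := Function.update d₁ q 1
      if mate q < q then Function.update d₂ (mate q) (-1) else d₂) := by
  funext r
  have hmn := h.ne q hq
  have hmi := h.invol q hq
  rcases lt_trichotomy r q with hr | rfl | hr
  · by_cases hrm : r = mate q
    · have hcell : cell r = cell (r + 1) := by
        have h1 : cell r = cell q := by rw [hrm]; exact h.cell_mate q hq
        rw [h1, h.cell_eq (p := r) (r := r + 1) (q := q) (by omega) (by omega) hq h1]
      simp only [← hrm, hr, if_true, Function.update_self]
      unfold scanLeaf
      rw [if_pos (by omega), if_neg (by simp [hcell]), if_pos]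
      rw [hrm, hmi]; omega
    · have hmr : mate r ≠ q := by
        intro hcon
        apply hrm
        rw [← hcon, h.invol r (by omega)]
      have h1 : ∀ x : ℕ → ℝ, (if mate q < q then Function.update (Function.update x q 1) (mate q)
          (-1) else Function.update x q 1) r = x r := by
        intro x
        split_ifs
        · rw [Function.update_of_ne hrm, Function.update_of_ne (by omega)]
        · rw [Function.update_of_ne (by omega)]
      have hm : mate r < q + 1 ↔ mate r < q := by omega
      simp only [h1]
      by_cases hrq : r + 1 = q
      · have hq1 : q - 1 = r := by omega
        have hq2 : 1 ≤ q := by omega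
        by_cases hcell : cell r < cell q
        · simp only [hq1, hq2, hcell, and_self, if_true, Function.update_self]
          unfold scanLeaf
          rw [if_pos (by omega), if_pos ⟨by omega, hrq ▸ hcell⟩]
        · simp only [hq1, hcell, and_false, if_false]
          unfold scanLeaf
          simp only [hrq, hcell, and_false, if_false, hm, hr, show r < q + 1 by omega, if_true]
      · have h2 : (if 1 ≤ q ∧ cell (q - 1) < cell q then
            Function.update (scanLeaf big cell mate q) (q - 1) (-big) else
            scanLeaf big cell mate q) r = scanLeaf big cell mate q r := by
          split_ifs
          · rw [Function.update_of_ne (by omega)]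
          · rfl
        simp only [h2]
        unfold scanLeaf
        have h3 : r + 1 < q + 1 ↔ r + 1 < q := by omega
        simp only [hr, show r < q + 1 by omega, if_true, hm, h3]
  · have h1 : ∀ x : ℕ → ℝ, (if mate r < r then Function.update (Function.update x r 1) (mate r)
        (-1) else Function.update x r 1) r = 1 := by
      intro x
      split_ifs
      · rw [Function.update_of_ne (by omega), Function.update_self]
      · rw [Function.update_self]
    simp only [h1]
    unfold scanLeaf
    rw [if_pos (by omega), if_neg (by omega), if_neg (by omega)]
  · have h1 : ∀ x : ℕ → ℝ, (if mate q < q then Function.update (Function.update x q 1) (mate q)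
        (-1) else Function.update x q 1) r = x r := by
      intro x
      split_ifs
      · rw [Function.update_of_ne (by omega), Function.update_of_ne (by omega)]
      · rw [Function.update_of_ne (by omega)]
    simp only [h1]
    rw [scanLeaf_of_le (by omega)]
    split_ifs
    · rw [Function.update_of_ne (by omega), scanLeaf_of_le (by omega)]
    · rw [scanLeaf_of_le (by omega)]

theorem Paired.card_singles_self (h : Paired N cell line mate) {q : ℕ} (hq : q < N) :
    (singles mate q q).card = 1 := by
  have := h.ne q hq
  rw [singles, Finset.Icc_self, Finset.filter_singleton, if_pos (by omega), Finset.card_singleton]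

/-- The maximum suffix sum after item `q` is the largest number of single items of an interval
that ends at `q` and lies in one cell. -/
theorem Paired.root_spec (h : Paired N cell line mate) (hbig : (N : ℝ) ≤ big) {W L q : ℕ}
    {s : State} {g : ℕ → ℕ} (hq : q < N) (hN : N ≤ 2 ^ L)
    (hs : SuffixTree W L s (scanLeaf big cell mate (q + 1)) g) (hg : ∀ r ≤ q, g r = r) :
    (∀ p ≤ q, cell p = cell q → ((singles mate p q).card : ℝ) ≤ s.real sufArr 1) ∧
      s.nat argBest 1 ≤ q ∧ cell (s.nat argBest 1) = cell q ∧
      s.real sufArr 1 = (singles mate (s.nat argBest 1) q).card := by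
  obtain ⟨h1, p, hp, h2, h3⟩ := hs.root
  have h4 : ∀ p ≤ q, cell p = cell q → ((singles mate p q).card : ℝ) ≤ s.real sufArr 1 := by
    intro p hp hc
    rw [← h.sum_scanLeaf (big := big) hq hc, ← sum_Ico_scanLeaf hq hN]
    exact h1 p (by omega)
  have h5 := h4 q le_rfl rfl
  rw [h.card_singles_self hq, ← h2, sum_Ico_scanLeaf hq hN, Nat.cast_one] at h5
  have hpq : p ≤ q := by
    by_contra hcon
    rw [Finset.Icc_eq_empty hcon, Finset.sum_empty] at h5
    linarith
  have hc : cell p = cell q := by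
    by_contra hcon
    linarith [h.sum_scanLeaf_nonpos hbig hpq hq hcon]
  rw [hg p hpq] at h3
  refine ⟨h4, by omega, by rw [h3, hc], ?_⟩
  rw [← h2, h3, sum_Ico_scanLeaf hq hN, h.sum_scanLeaf hq hc]

end

end RealRAM

/-! ### Scanning the sorted ends -/

namespace RealRAM

/-- Process the items in the order `orderArr`. The leaf of an item gets the value `1`, which drops
to `-1` when a later mate of the item is processed; when a new cell starts, the last leaf of the
old one gets the value `-bigVal`, so that no good suffix starts in the old cell. The best interval
so far is stored in `bestP` and `bestQ`. -/
def scanItems : Program :=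
  forLoop loopI (.var itemCount)
    (.seq (.setNat tmpA 0 (.get orderArr (.var loopI)))
    (.seq (.setNat tmpB 0 (.get endLine (.var tmpA)))
    (.seq (.ite (.and (.natLe 1 (.var loopI))
        (.realLt (.get keyA (.get orderArr (.var loopI - 1))) (.get keyA (.var tmpA))))
      (setLeaf (.var loopI - 1) (0 - .var bigVal)) .skip)
    (.seq (setLeaf (.var loopI) 1)
    (.seq (.ite (.natLe (.get openAt (.var tmpB)) 0)
      (.setNat openAt (.var tmpB) (.var loopI + 1))
      (.seq (setLeaf (.get openAt (.var tmpB) - 1) (0 - 1)) (.setNat openAt (.var tmpB) 0)))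
    (.ite (.realLt (.var bestVal) (.get sufArr 1))
      (.seq (.setReal bestVal 0 (.get sufArr 1))
        (.seq (.setNat bestP 0 (.get argBest 1)) (.setNat bestQ 0 (.var loopI))))
      .skip))))))

/-- The interval `[p, q]` lies in one cell and has `v` single items, the maximum number. -/
def IsBestInterval (N : ℕ) (cell : ℕ → ℝ) (mate : ℕ → ℕ) (v : ℝ) (p q : ℕ) : Prop :=
  (∀ p' q', p' ≤ q' → q' < N → cell p' = cell q' → ((singles mate p' q').card : ℝ) ≤ v) ∧
    (N ≠ 0 → p ≤ q ∧ q < N ∧ cell p = cell q ∧ v = (singles mate p q).card)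

/-- For every line, `openAt` holds the item of the line that waits for its mate. -/
def OpenItems (line mate : ℕ → ℕ) (q : ℕ) (o : ℕ → ℕ) : Prop :=
  ∀ j, (o j = 0 ∧ ∀ r < q, line r = j → mate r < q) ∨
    ∃ a < q, o j = a + 1 ∧ line a = j ∧ q ≤ mate a

theorem Paired.openItems_open {N q : ℕ} {cell : ℕ → ℝ} {line mate o : ℕ → ℕ}
    (h : Paired N cell line mate) (hq : q < N) (ho : OpenItems line mate q o)
    (h0 : o (line q) = 0) :
    q < mate q ∧ OpenItems line mate (q + 1) (Function.update o (line q) (q + 1)) := by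
  have hmq : q < mate q := by
    rcases ho (line q) with ⟨-, h1⟩ | ⟨a, -, h1, -⟩
    · by_contra hcon
      have h2 := h.ne q hq
      have h3 := h1 (mate q) (by omega) (h.line_mate q hq)
      rw [h.invol q hq] at h3
      omega
    · omega
  refine ⟨hmq, fun j => ?_⟩
  by_cases hj : j = line q
  · subst hj
    exact .inr ⟨q, by omega, by simp, rfl, hmq⟩
  · rw [Function.update_of_ne hj]
    rcases ho j with ⟨h1, h2⟩ | ⟨a, h1, h2, h3, h4⟩
    · refine .inl ⟨h1, fun r hr hrj => ?_⟩
      have : r ≠ q := by rintro rfl; exact hj hrj.symm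
      have := h2 r (by omega) hrj
      omega
    · refine .inr ⟨a, by omega, h2, h3, ?_⟩
      have : mate a ≠ q := by
        intro hcon
        apply hj
        rw [← h3, ← h.line_mate a (by omega), hcon]
      omega

theorem Paired.openItems_close {N q a : ℕ} {cell : ℕ → ℝ} {line mate o : ℕ → ℕ}
    (h : Paired N cell line mate) (hq : q < N) (ho : OpenItems line mate q o)
    (h0 : o (line q) = a + 1) :
    mate q = a ∧ a < q ∧ OpenItems line mate (q + 1) (Function.update o (line q) 0) := by
  have hcell : ∀ r < q, q ≤ mate r → r < N → cell r = cell q := by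
    intro r hr hr' hrN
    refine le_antisymm (h.mono _ _ hr hq) ?_
    rcases hr'.lt_or_eq with h1 | h1
    · rw [← h.cell_mate r hrN]; exact h.mono _ _ h1 (h.lt r hrN)
    · rw [h1, h.cell_mate r hrN]
  obtain ⟨b, hb1, hb2, hb3, hb4⟩ : ∃ b < q, o (line q) = b + 1 ∧ line b = line q ∧ q ≤ mate b := by
    rcases ho (line q) with ⟨h1, -⟩ | h1
    · omega
    · exact h1
  obtain rfl : a = b := by omega
  have hma : q = mate a := by
    rcases h.eq_or a (by omega) q hq hb3 (hcell a hb1 hb4 (by omega)) with h1 | h1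
    · omega
    · exact h1
  have hmq : mate q = a := by rw [hma, h.invol a (by omega)]
  refine ⟨hmq, hb1, fun j => ?_⟩
  by_cases hj : j = line q
  · subst hj
    refine .inl ⟨by simp, fun r hr hrj => ?_⟩
    by_contra hcon
    have hrq : r ≠ q := by rintro rfl; omega
    rcases h.eq_or q hq r (by omega) hrj.symm (hcell r (by omega) (by omega) (by omega)).symm with
      h1 | h1
    · exact hrq h1
    · rw [h1, h.invol q hq] at hcon
      omega
  · rw [Function.update_of_ne hj]
    rcases ho j with ⟨h1, h2⟩ | ⟨b, h1, h2, h3, h4⟩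
    · refine .inl ⟨h1, fun r hr hrj => ?_⟩
      have : r ≠ q := by rintro rfl; exact hj hrj.symm
      have := h2 r (by omega) hrj
      omega
    · refine .inr ⟨b, by omega, h2, h3, ?_⟩
      have : mate b ≠ q := by
        intro hcon
        apply hj
        rw [← h3, ← h.line_mate b (by omega), hcon]
      omega

/-- A bound for the number of steps of `scanItems`. -/
def scanTime (N L : ℕ) : ℕ := N * (3 * (L * (rejoin.time + 12)) + 400) + 20

theorem scanItems_run {W L N : ℕ} {s : State} {mate : ℕ → ℕ} (hW : 2 ^ (L + 1) ≤ W)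
    (hN : N ≤ 2 ^ L) (hcount : s.nat itemCount 0 = N) (hsize : s.nat treeSize 0 = 2 ^ L)
    (hbig : (N : ℝ) ≤ s.real bigVal 0)
    (hp : Paired N (fun r => s.real keyA (s.nat orderArr r))
      (fun r => s.nat endLine (s.nat orderArr r)) mate)
    (hordW : ∀ r < N, s.nat orderArr r < W)
    (hlineW : ∀ r < N, s.nat endLine (s.nat orderArr r) < W)
    (hopen : ∀ j, s.nat openAt j = 0) (hsum : ∀ i, s.real sumArr i = 0)
    (hsuf : ∀ i, s.real sufArr i = 0) (harg : ∀ i, s.nat argBest i = 0)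
    (hbest : s.real bestVal 0 = 0) :
    Run W scanItems s (scanTime N L) fun s' =>
      IsBestInterval N (fun r => s.real keyA (s.nat orderArr r)) mate (s'.real bestVal 0)
        (s'.nat bestP 0) (s'.nat bestQ 0) ∧
      (N = 0 → s'.nat bestP 0 = s.nat bestP 0 ∧ s'.nat bestQ 0 = s.nat bestQ 0) := by
  have e : 2 ^ (L + 1) = 2 * 2 ^ L := by ring
  have hL := Nat.one_le_two_pow (n := L)
  set cell : ℕ → ℝ := fun r => s.real keyA (s.nat orderArr r) with hcelldef
  set line : ℕ → ℕ := fun r => s.nat endLine (s.nat orderArr r) with hlinedef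
  set big := s.real bigVal 0 with hbigdef
  refine Run.forLoop (c := 3 * (L * (rejoin.time + 12)) + 380) (n := N) (fun q s' =>
    (∃ g, SuffixTree W L s' (scanLeaf big cell mate q) g ∧ ∀ r < q, g r = r) ∧
    OpenItems line mate q (s'.nat openAt) ∧
    IsBestInterval q cell mate (s'.real bestVal 0) (s'.nat bestP 0) (s'.nat bestQ 0) ∧
    (q = 0 → s'.real bestVal 0 = 0 ∧ s'.nat bestP 0 = s.nat bestP 0 ∧
      s'.nat bestQ 0 = s.nat bestQ 0)) (by omega) rfl ?_ ?_ ?_ ?_ ?_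
  · intro s' hf
    simp [hf.1 itemCount rfl, hcount]
  · refine ⟨⟨fun _ => 0, ⟨by simpa using hsize, fun i h1 h2 => ?_, fun p => ?_, fun i => ?_⟩, ?_⟩,
      ?_, ?_, ?_⟩
    · simp [suffixNode, joinSuffix, hsum, hsuf, harg]
    · simp [suffixNode, hsum, hsuf, harg, scanLeaf]
    · simp [harg]; omega
    · intro r hr; omega
    · intro j; left; simp [hopen]
    · refine ⟨fun p q _ hq => by omega, fun h => absurd rfl h⟩
    · simp [hbest]
  · rintro q hq s₁ hf hv ⟨⟨g, hg, hgr⟩, hopn, hbst, hbst0⟩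
    have horder : s₁.nat orderArr = s.nat orderArr := hf.1 orderArr rfl
    have hline : s₁.nat endLine = s.nat endLine := hf.1 endLine rfl
    have hkey : s₁.real keyA = s.real keyA := hf.2 keyA rfl
    have hbigv : s₁.real bigVal 0 = big := by rw [hf.2 bigVal rfl]
    have ht1 : Run W (.setNat tmpA 0 (.get orderArr (.var loopI))) s₁ 10 fun s' =>
        s' = s₁.putNat tmpA 0 (s.nat orderArr q) :=
      Run.of_safe (by simp [Program.Safe, hv, horder, hordW q hq]) (by decide)
        (by simp [Program.eff, hv, horder])
    refine (Run.seq (ht1.mono le_rfl (T₂ := 10) (Q' := fun s'' => Run W _ s''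
      (10 + (((60 + (L * (rejoin.time + 12) + 60))) + ((L * (rejoin.time + 12) + 60) +
        ((20 + (L * (rejoin.time + 12) + 80)) + 60)))) _) ?_)).mono (by omega) (fun _ h => h)
    rintro s' rfl
    have ht2 : Run W (.setNat tmpB 0 (.get endLine (.var tmpA)))
        (s₁.putNat tmpA 0 (s.nat orderArr q)) 10 fun s' =>
        s' = (s₁.putNat tmpA 0 (s.nat orderArr q)).putNat tmpB 0 (line q) :=
      Run.of_safe (by simp [Program.Safe, hline]; exact hlineW q hq) (by decide)
        (by simp [Program.eff, hline, hlinedef])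
    refine Run.seq (ht2.mono le_rfl ?_)
    rintro s' rfl
    generalize hs₂ : (s₁.putNat tmpA 0 (s.nat orderArr q)).putNat tmpB 0 (line q) = s₂
    have hA₂ : s₂.nat tmpA 0 = s.nat orderArr q := by simp [← hs₂]
    have hB₂ : s₂.nat tmpB 0 = line q := by simp [← hs₂]
    have hn₂ : ∀ a, a ≠ tmpA → a ≠ tmpB → s₂.nat a = s₁.nat a := by
      intro a h1 h2; simp [← hs₂, h1, h2]
    have hr₂ : s₂.real = s₁.real := by simp [← hs₂]
    have htree₂ : SuffixTree W L s₂ (scanLeaf big cell mate q) g := by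
      have hnode : suffixNode s₂ = suffixNode s₁ := by
        funext i
        simp only [suffixNode, hr₂, hn₂ argBest (by decide) (by decide)]
      refine ⟨?_, hnode ▸ hg.ok, fun p => hnode ▸ hg.leaf p, fun i => ?_⟩
      · rw [hn₂ treeSize (by decide) (by decide)]; exact hg.size
      · rw [hn₂ argBest (by decide) (by decide)]; exact hg.lt i
    clear hs₂
    -- The last leaf of the previous cell.
    have ht3 : Run W (.ite (.and (.natLe 1 (.var loopI))
        (.realLt (.get keyA (.get orderArr (.var loopI - 1))) (.get keyA (.var tmpA))))
        (setLeaf (.var loopI - 1) (0 - .var bigVal)) .skip) s₂ (60 + (L * (rejoin.time + 12) + 60))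
        fun s' => Frame (setLeaf (.var loopI - 1) (0 - .var bigVal)) s₂ s' ∧
          ∃ g, SuffixTree W L s' (open Classical in if 1 ≤ q ∧ cell (q - 1) < cell q then
            Function.update (scanLeaf big cell mate q) (q - 1) (-big)
            else scanLeaf big cell mate q) g ∧ ∀ r < q, g r = r := by
      have hi₂ : s₂.nat loopI 0 = q := by rw [hn₂ loopI (by decide) (by decide), hv]
      have hcond : (Test.and (.natLe 1 (.var loopI)) (.realLt (.get keyA (.get orderArr
          (.var loopI - 1))) (.get keyA (.var tmpA)))).Holds s₂ ↔
          1 ≤ q ∧ cell (q - 1) < cell q := by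
        simp only [Test.holds_and, Test.holds_natLe, Test.holds_not, Test.holds_realLe,
          NatExpr.eval_get, NatExpr.eval_one, NatExpr.eval_zero, NatExpr.eval_sub,
          RealExpr.eval_get, hi₂, hA₂, hr₂, hkey, hn₂ orderArr (by decide) (by decide), horder,
          not_le, hcelldef]
      refine (Run.ite (T := L * (rejoin.time + 12) + 60) (fun hc => ?_) (fun hc => ?_)).mono
        (by simp only [Test.cost, NatExpr.cost, RealExpr.cost]
            show 1 + 2 + 1 + ((2 + 1 + 1 + 1) + 1 + (2 + 1) + 1 + 1) + 1 + 1 + _ ≤ _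
            omega) (fun _ h => h)
      · rw [hcond] at hc
        refine (setLeaf_run (p := q - 1) (x := -big) htree₂ hW (by omega) (by simp [hi₂])
          ?_).framed ?_ ?_
        · intro s' hs'
          simp [hs', hr₂, hbigv]
        · show L * (rejoin.time + 12) + 4 + 2 * 4 + 40 ≤ _
          omega
        · intro s' hfr h
          refine ⟨hfr, _, by rw [if_pos hc]; exact h, fun r hr => ?_⟩
          by_cases hr' : r = q - 1
          · subst hr'; simp
          · simp [hr', hgr r hr]
      · rw [hcond] at hc
        refine Run.of_safe (by simp [Program.Safe]) (by simp only [Program.time]; omega) ?_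
        exact ⟨Frame.refl _ _, g, by rw [if_neg hc]; exact htree₂, hgr⟩
    refine Run.seq (ht3.mono le_rfl ?_)
    rintro s₃ ⟨hf₃, g₃, htree₃, hg₃⟩
    have hi₃ : s₃.nat loopI 0 = q := by
      rw [hf₃.1 loopI rfl, hn₂ loopI (by decide) (by decide), hv]
    refine Run.seq ((setLeaf_run (p := q) (x := 1) htree₃ hW (by omega) (by simp [hi₃])
      (by intro s' _; simp)).framed (T₂ := L * (rejoin.time + 12) + 60)
        (by show L * (rejoin.time + 12) + 2 + 2 * 1 + 40 ≤ _; omega) ?_)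
    intro s₄ hf₄ htree₄
    have hg₄ : ∀ r < q + 1, Function.update g₃ q q r = r := by
      intro r hr
      by_cases hr' : r = q
      · subst hr'; simp
      · simp [hr', hg₃ r (by omega)]
    have hi₄ : s₄.nat loopI 0 = q := by rw [hf₄.1 loopI rfl, hi₃]
    have hB₄ : s₄.nat tmpB 0 = line q := by rw [hf₄.1 tmpB rfl, hf₃.1 tmpB rfl, hB₂]
    have hopen₄ : s₄.nat openAt = s₁.nat openAt := by
      rw [hf₄.1 openAt rfl, hf₃.1 openAt rfl, hn₂ openAt (by decide) (by decide)]
    have hstep := hp.scanLeaf_succ (big := big) hq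
    -- The item opens or closes a pair.
    have ht5 : Run W (.ite (.natLe (.get openAt (.var tmpB)) 0)
        (.setNat openAt (.var tmpB) (.var loopI + 1))
        (.seq (setLeaf (.get openAt (.var tmpB) - 1) (0 - 1)) (.setNat openAt (.var tmpB) 0))) s₄
        (20 + (L * (rejoin.time + 12) + 80)) fun s' =>
          Frame (.seq (.setNat openAt 0 0) (setLeaf (.get openAt (.var tmpB) - 1) (0 - 1))) s₄ s' ∧
          OpenItems line mate (q + 1) (s'.nat openAt) ∧
          ∃ g, SuffixTree W L s' (scanLeaf big cell mate (q + 1)) g ∧ ∀ r < q + 1, g r = r := by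
      have hput : ∀ {s' : State} {d : ℕ → ℝ} {g : ℕ → ℕ} (j x : ℕ), SuffixTree W L s' d g →
          SuffixTree W L (s'.putNat openAt j x) d g := by
        intro s' d g j x h
        have hnode : suffixNode (s'.putNat openAt j x) = suffixNode s' := by
          funext i; simp [suffixNode]
        exact ⟨by simpa using h.size, hnode ▸ h.ok, fun p => hnode ▸ h.leaf p,
          fun i => by simpa using h.lt i⟩
      have hfput : ∀ {s' : State} (j x : ℕ),
          Frame (.seq (.setNat openAt 0 0) (setLeaf (.get openAt (.var tmpB) - 1) (0 - 1))) s₄ s' →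
          Frame (.seq (.setNat openAt 0 0) (setLeaf (.get openAt (.var tmpB) - 1) (0 - 1))) s₄
            (s'.putNat openAt j x) := by
        intro s' j x h
        refine ⟨fun a ha => ?_, fun a ha => h.2 a ha⟩
        have : a ≠ openAt := by rintro rfl; simp [Program.writesNat] at ha
        simp [this, h.1 a ha]
      refine (Run.ite (T := L * (rejoin.time + 12) + 80) (fun hc => ?_) (fun hc => ?_)).mono
        (by show 3 + 1 + 1 + 1 + _ ≤ _; omega) (fun _ h => h)
      · simp [hB₄, hopen₄] at hc
        obtain ⟨h1, h2⟩ := hp.openItems_open hq hopn hc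
        refine Run.of_safe (by simp [Program.Safe, hi₄]; omega)
          (by show 2 + 4 + 1 ≤ _; omega) ?_
        simp only [Program.eff, NatExpr.eval_get, NatExpr.eval_add, NatExpr.eval_zero,
          NatExpr.eval_one, hB₄, hi₄]
        refine ⟨hfput _ _ (Frame.refl _ _), by simpa [hopen₄] using h2, _, hput _ _ ?_, hg₄⟩
        rw [hstep]
        simpa only [if_neg (show ¬ mate q < q by omega)] using htree₄
      · simp [hB₄, hopen₄] at hc
        obtain ⟨a, ha⟩ := Nat.exists_eq_succ_of_ne_zero hc
        obtain ⟨h1, h2, h3⟩ := hp.openItems_close hq hopn ha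
        refine (Run.seq (T₂ := 10) ((setLeaf_run (p := a) (x := -1) htree₄ hW (by omega)
          (by simp [hB₄, hopen₄, ha]) (by intro s' _; simp)).framed
          (T₂ := L * (rejoin.time + 12) + 60)
          (by show L * (rejoin.time + 12) + 5 + 2 * 3 + 40 ≤ _; omega) ?_)).mono (by omega)
          (fun _ h => h)
        intro s₅ hf₅ htree₅
        have hB₅ : s₅.nat tmpB 0 = line q := by rw [hf₅.1 tmpB rfl, hB₄]
        refine Run.of_safe (by simp [Program.Safe]; omega) (by decide) ?_
        simp only [Program.eff, NatExpr.eval_get, NatExpr.eval_zero, hB₅]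
        refine ⟨hfput _ _ (hf₅.mono ?_ ?_), ?_, Function.update (Function.update g₃ q q) a a,
          hput _ _ ?_, ?_⟩
        · simp +contextual [Program.writesNat]
        · simp +contextual [Program.writesReal]
        · simpa [hf₅.1 openAt rfl, hopen₄] using h3
        · rw [hstep]
          simpa only [h1, if_pos h2] using htree₅
        · intro r hr
          by_cases hr' : r = a
          · subst hr'; simp
          · rw [Function.update_of_ne hr', hg₄ r hr]
    refine Run.seq (ht5.mono le_rfl ?_)
    rintro s₅ ⟨hf₅, hopn₅, g₅, htree₅, hg₅⟩
    have hi₅ : s₅.nat loopI 0 = q := by rw [hf₅.1 loopI rfl, hi₄]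
    have hP₅ : s₅.nat bestP = s₁.nat bestP := by
      rw [hf₅.1 bestP rfl, hf₄.1 bestP rfl, hf₃.1 bestP rfl, hn₂ bestP (by decide) (by decide)]
    have hQ₅ : s₅.nat bestQ = s₁.nat bestQ := by
      rw [hf₅.1 bestQ rfl, hf₄.1 bestQ rfl, hf₃.1 bestQ rfl, hn₂ bestQ (by decide) (by decide)]
    have hV₅ : s₅.real bestVal = s₁.real bestVal := by
      rw [hf₅.2 bestVal rfl, hf₄.2 bestVal rfl, hf₃.2 bestVal rfl, hr₂]
    obtain ⟨hr1, hr2, hr3, hr4⟩ := hp.root_spec hbig hq hN htree₅ (fun r hr => hg₅ r (by omega))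
    have htree : ∀ s' : State, suffixNode s' = suffixNode s₅ → s'.nat treeSize = s₅.nat treeSize →
        s'.nat argBest = s₅.nat argBest →
        SuffixTree W L s' (scanLeaf big cell mate (q + 1)) g₅ := by
      intro s' h1 h2 h3
      exact ⟨h2 ▸ htree₅.size, h1 ▸ htree₅.ok, fun p => h1 ▸ htree₅.leaf p,
        fun i => h3 ▸ htree₅.lt i⟩
    refine (Run.ite (T := 40) (fun hc => ?_) (fun hc => ?_)).mono
      (by show 2 + 2 + 1 + 1 + 1 + _ ≤ _; omega) (fun _ h => h)
    · simp [hV₅] at hc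
      refine Run.of_safe ?_ (by decide) ?_
      · simp [Program.Safe, Program.eff, htree₅.lt, hi₅]
        omega
      · refine ⟨⟨g₅, htree _ ?_ ?_ ?_, hg₅⟩, ?_, ?_, by omega⟩
        · funext i; simp [Program.eff, suffixNode]
        · simp [Program.eff]
        · simp [Program.eff]
        · simpa [Program.eff] using hopn₅
        · simp only [Program.eff, NatExpr.eval_get, RealExpr.eval_get, NatExpr.eval_zero,
            NatExpr.eval_one]
          simp [hi₅]
          refine ⟨fun p' q' h1 h2 h3 => ?_, fun _ => ⟨hr2, by omega, hr3, hr4⟩⟩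
          rcases Nat.lt_succ_iff_lt_or_eq.1 h2 with h4 | rfl
          · exact (hbst.1 p' q' h1 h4 h3).trans hc.le
          · exact hr1 p' h1 h3
    · simp [hV₅] at hc
      have hq0 : q ≠ 0 := by
        rintro rfl
        have := hr1 0 le_rfl rfl
        rw [hp.card_singles_self hq, Nat.cast_one] at this
        linarith [(hbst0 rfl).1]
      refine Run.of_safe (by simp [Program.Safe]) (by decide) ?_
      refine ⟨⟨g₅, htree _ ?_ ?_ ?_, hg₅⟩, ?_, ?_, by omega⟩
      · funext i; simp [Program.eff, suffixNode]
      · simp [Program.eff]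
      · simp [Program.eff]
      · simpa [Program.eff] using hopn₅
      · simp [Program.eff, hP₅, hQ₅, hV₅]
        refine ⟨fun p' q' h1 h2 h3 => ?_, fun _ => ?_⟩
        · rcases Nat.lt_succ_iff_lt_or_eq.1 h2 with h4 | rfl
          · exact hbst.1 p' q' h1 h4 h3
          · exact (hr1 p' h1 h3).trans hc
        · obtain ⟨h1, h2, h3⟩ := hbst.2 hq0
          exact ⟨h1, by omega, h3⟩
  · simp only [NatExpr.cost]
    have : N * (3 * (L * (rejoin.time + 12)) + 380 + (1 + 1) + 15) ≤
        N * (3 * (L * (rejoin.time + 12)) + 400) := Nat.mul_le_mul_left _ (by omega)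
    rw [add_assoc]
    exact Nat.add_le_add this (by norm_num)
  · rintro s' - ⟨-, -, h1, h2⟩
    exact ⟨h1, fun h => (h2 h).2⟩

end RealRAM

/-! ### Points in convex position -/

namespace Bowtie

/-- A finite family of points `(x i, y i)`, each with a support line of slope `g i` that has all
points of the family above it, or, if `up i`, below it. -/
structure Supported {ι : Type*} (s : Set ι) (x y g : ι → ℝ) (up : ι → Prop) : Prop where
  lower : ∀ a ∈ s, ¬ up a → ∀ b ∈ s, y a + g a * (x b - x a) ≤ y b
  upper : ∀ a ∈ s, up a → ∀ b ∈ s, y b ≤ y a + g a * (x b - x a)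

/-- The counterclockwise order: the lower chain from left to right, then the upper chain from right
to left. -/
def Ccw {ι : Type*} (x : ι → ℝ) (up : ι → Prop) (a b : ι) : Prop :=
  (¬ up a ∧ ¬ up b ∧ x a ≤ x b) ∨ (¬ up a ∧ up b) ∨ (up a ∧ up b ∧ x b ≤ x a)

/-- The orientation of the triangle `a b c`. -/
def orient {ι : Type*} (x y : ι → ℝ) (a b c : ι) : ℝ :=
  (x b - x a) * (y c - y a) - (y b - y a) * (x c - x a)

section
variable {ι : Type*} {s : Set ι} {x y g : ι → ℝ} {up : ι → Prop} {a b c d : ι}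

theorem orient_nonneg_of_support {xa ya xb yb xc yc t : ℝ} (h1 : xa ≤ xb) (h2 : xb ≤ xc)
    (ha : yb + t * (xa - xb) ≤ ya) (hc : yb + t * (xc - xb) ≤ yc) :
    0 ≤ (xb - xa) * (yc - ya) - (yb - ya) * (xc - xa) := by
  have e : (xb - xa) * (yc - ya) - (yb - ya) * (xc - xa) =
      (xb - xa) * (yc - (yb + t * (xc - xb))) + (xc - xb) * (ya - (yb + t * (xa - xb))) := by ring
  rw [e]
  have := mul_nonneg (sub_nonneg.2 h1) (sub_nonneg.2 hc)
  have := mul_nonneg (sub_nonneg.2 h2) (sub_nonneg.2 ha)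
  linarith

theorem orient_nonpos_of_support {xa ya xb yb xc yc t : ℝ} (h1 : xa ≤ xb) (h2 : xb ≤ xc)
    (ha : ya ≤ yb + t * (xa - xb)) (hc : yc ≤ yb + t * (xc - xb)) :
    (xb - xa) * (yc - ya) - (yb - ya) * (xc - xa) ≤ 0 := by
  have e : (xb - xa) * (yc - ya) - (yb - ya) * (xc - xa) =
      -((xb - xa) * ((yb + t * (xc - xb)) - yc) + (xc - xb) * ((yb + t * (xa - xb)) - ya)) := by
    ring
  rw [e]
  have := mul_nonneg (sub_nonneg.2 h1) (sub_nonneg.2 hc)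
  have := mul_nonneg (sub_nonneg.2 h2) (sub_nonneg.2 ha)
  linarith

/-- Points in convex position, taken in counterclockwise order, turn left. -/
theorem Supported.orient_nonneg (h : Supported s x y g up) (ha : a ∈ s) (hb : b ∈ s) (hc : c ∈ s)
    (hab : Ccw x up a b) (hbc : Ccw x up b c) : 0 ≤ orient x y a b c := by
  unfold orient
  by_cases ua : up a
  · have ub : up b := by rcases hab with h | h | h <;> tauto
    have uc : up c := by rcases hbc with h | h | h <;> tauto
    have h1 : x b ≤ x a := by rcases hab with h | h | h <;> tauto
    have h2 : x c ≤ x b := by rcases hbc with h | h | h <;> tauto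
    have := orient_nonpos_of_support h2 h1 (h.upper b hb ub c hc) (h.upper b hb ub a ha)
    linarith
  · by_cases uc : up c
    · -- One or two of the points lie on the upper chain: rotate the triangle until the middle
      -- point in the order of abscissae has the support line that decides.
      by_cases ub : up b
      · have h2 : x c ≤ x b := by rcases hbc with h | h | h <;> tauto
        rcases le_total (x a) (x c) with h3 | h3
        · have := orient_nonpos_of_support h3 h2 (h.upper c hc uc a ha) (h.upper c hc uc b hb)
          linarith
        · rcases le_total (x a) (x b) with h4 | h4
          · have := orient_nonneg_of_support h3 h4 (h.lower a ha ua c hc) (h.lower a ha ua b hb)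
            linarith
          · have := orient_nonpos_of_support h2 h4 (h.upper b hb ub c hc) (h.upper b hb ub a ha)
            linarith
      · have h1 : x a ≤ x b := by rcases hab with h | h | h <;> tauto
        rcases le_total (x c) (x a) with h3 | h3
        · have := orient_nonneg_of_support h3 h1 (h.lower a ha ua c hc) (h.lower a ha ua b hb)
          linarith
        · rcases le_total (x c) (x b) with h4 | h4
          · have := orient_nonpos_of_support h3 h4 (h.upper c hc uc a ha) (h.upper c hc uc b hb)
            linarith
          · have := orient_nonneg_of_support h1 h4 (h.lower b hb ub a ha) (h.lower b hb ub c hc)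
            linarith
    · have ub : ¬ up b := by rcases hbc with h | h | h <;> tauto
      have h1 : x a ≤ x b := by rcases hab with h | h | h <;> tauto
      have h2 : x b ≤ x c := by rcases hbc with h | h | h <;> tauto
      have := orient_nonneg_of_support h1 h2 (h.lower b hb ub a ha) (h.lower b hb ub c hc)
      linarith

theorem Ccw.trans (hab : Ccw x up a b) (hbc : Ccw x up b c) : Ccw x up a c := by
  rcases hab with ⟨h1, h2, h3⟩ | ⟨h1, h2⟩ | ⟨h1, h2, h3⟩ <;>
    rcases hbc with ⟨h4, h5, h6⟩ | ⟨h4, h5⟩ | ⟨h4, h5, h6⟩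
  · exact .inl ⟨h1, h5, h3.trans h6⟩
  · exact .inr (.inl ⟨h1, h5⟩)
  · exact absurd h4 h2
  · exact absurd h2 h4
  · exact absurd h2 h4
  · exact .inr (.inl ⟨h1, h5⟩)
  · exact absurd h2 h4
  · exact absurd h2 h4
  · exact .inr (.inr ⟨h1, h5, h6.trans h3⟩)

/-- A line does not separate the points of convex position alternately. -/
theorem Supported.not_alternating (h : Supported s x y g up) (ha : a ∈ s) (hb : b ∈ s)
    (hc : c ∈ s) (hd : d ∈ s) (hab : Ccw x up a b) (hbc : Ccw x up b c) (hcd : Ccw x up c d)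
    (α β γ : ℝ) (fa : 0 < α * x a + β * y a + γ) (fb : α * x b + β * y b + γ < 0)
    (fc : 0 < α * x c + β * y c + γ) (fd : α * x d + β * y d + γ < 0) : False := by
  have o1 := h.orient_nonneg ha hb hc hab hbc
  have o2 := h.orient_nonneg ha hb hd hab (hbc.trans hcd)
  have o3 := h.orient_nonneg ha hc hd (hab.trans hbc) hcd
  have o4 := h.orient_nonneg hb hc hd hbc hcd
  -- Four points of the plane are affinely dependent, with the orientations as coefficients.
  have dep : orient x y b c d * (α * x a + β * y a + γ) +
      orient x y a b d * (α * x c + β * y c + γ) =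
      orient x y a c d * (α * x b + β * y b + γ) +
      orient x y a b c * (α * x d + β * y d + γ) := by
    unfold orient; ring
  have z1 : orient x y b c d = 0 := by
    by_contra hne
    have h1 := mul_pos (lt_of_le_of_ne o4 (Ne.symm hne)) fa
    have h2 := mul_nonneg o2 fc.le
    have h3 := mul_nonneg o3 (neg_nonneg.2 fb.le)
    have h4 := mul_nonneg o1 (neg_nonneg.2 fd.le)
    linarith
  have z2 : orient x y a b d = 0 := by
    by_contra hne
    have h1 := mul_nonneg o4 fa.le
    have h2 := mul_pos (lt_of_le_of_ne o2 (Ne.symm hne)) fc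
    have h3 := mul_nonneg o3 (neg_nonneg.2 fb.le)
    have h4 := mul_nonneg o1 (neg_nonneg.2 fd.le)
    linarith
  have z4 : orient x y a b c = 0 := by
    by_contra hne
    have h1 := mul_nonneg o4 fa.le
    have h2 := mul_nonneg o2 fc.le
    have h3 := mul_nonneg o3 (neg_nonneg.2 fb.le)
    have h4 := mul_pos (lt_of_le_of_ne o1 (Ne.symm hne)) (neg_pos.2 fd)
    linarith
  -- The points are collinear, and the order of the abscissae on a chain decides.
  have same_lower : ∀ p ∈ s, ∀ q ∈ s, ¬ up p → ¬ up q → x p = x q → y p = y q := by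
    intro p hp q hq up' uq' hx
    have h1 := h.lower p hp up' q hq
    have h2 := h.lower q hq uq' p hp
    rw [hx] at h1 h2
    simp only [sub_self, mul_zero, add_zero] at h1 h2
    exact le_antisymm h1 h2
  have same_upper : ∀ p ∈ s, ∀ q ∈ s, up p → up q → x p = x q → y p = y q := by
    intro p hp q hq up' uq' hx
    have h1 := h.upper p hp up' q hq
    have h2 := h.upper q hq uq' p hp
    rw [hx] at h1 h2
    simp only [sub_self, mul_zero, add_zero] at h1 h2
    exact le_antisymm h2 h1
  by_cases uc : up c
  · by_cases ub : up b
    · have ud : up d := by rcases hcd with h | h | h <;> tauto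
      have h1 : x c ≤ x b := by rcases hbc with h | h | h <;> tauto
      have h2 : x d ≤ x c := by rcases hcd with h | h | h <;> tauto
      have e : (x b - x d) * (α * x c + β * y c + γ) = (x b - x c) * (α * x d + β * y d + γ) +
          (x c - x d) * (α * x b + β * y b + γ) := by
        unfold orient at z1; linear_combination β * z1
      have hbd : x b = x d := by
        by_contra hne
        have h3 : 0 < x b - x d := lt_of_le_of_ne (by linarith) (fun h => hne (by linarith))
        have := mul_pos h3 fc
        have := mul_nonneg (sub_nonneg.2 h1) (neg_nonneg.2 fd.le)
        have := mul_nonneg (sub_nonneg.2 h2) (neg_nonneg.2 fb.le)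
        linarith
      have hbc' : x b = x c := by linarith
      rw [hbc', same_upper b hb c hc ub uc hbc'] at fb
      linarith
    · have ua : ¬ up a := by rcases hab with h | h | h <;> tauto
      have ud : up d := by rcases hcd with h | h | h <;> tauto
      have h1 : x a ≤ x b := by rcases hab with h | h | h <;> tauto
      have h2 : x d ≤ x c := by rcases hcd with h | h | h <;> tauto
      have e : (x b - x a) * ((α * x c + β * y c + γ) - (α * x d + β * y d + γ)) =
          ((α * x b + β * y b + γ) - (α * x a + β * y a + γ)) * (x c - x d) := by
        unfold orient at z2 z4; linear_combination β * z4 - β * z2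
      have hab' : x a = x b := by
        by_contra hne
        have h3 : 0 < x b - x a := lt_of_le_of_ne (by linarith) (fun h => hne (by linarith))
        have := mul_pos h3 (show 0 < (α * x c + β * y c + γ) - (α * x d + β * y d + γ) by linarith)
        have := mul_nonneg (show 0 ≤ (α * x a + β * y a + γ) - (α * x b + β * y b + γ) by linarith)
          (sub_nonneg.2 h2)
        linarith
      rw [hab', same_lower a ha b hb ua ub hab'] at fa
      linarith
  · have ub : ¬ up b := by rcases hbc with h | h | h <;> tauto
    have ua : ¬ up a := by rcases hab with h | h | h <;> tauto
    have h1 : x a ≤ x b := by rcases hab with h | h | h <;> tauto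
    have h2 : x b ≤ x c := by rcases hbc with h | h | h <;> tauto
    have e : (x c - x a) * (α * x b + β * y b + γ) = (x c - x b) * (α * x a + β * y a + γ) +
        (x b - x a) * (α * x c + β * y c + γ) := by
      unfold orient at z4; linear_combination (-β) * z4
    have hac : x a = x c := by
      by_contra hne
      have h3 : 0 < x c - x a := lt_of_le_of_ne (by linarith) (fun h => hne (by linarith))
      have := mul_pos h3 (neg_pos.2 fb)
      have := mul_nonneg (sub_nonneg.2 h2) fa.le
      have := mul_nonneg (sub_nonneg.2 h1) fc.le
      linarith
    have hab' : x a = x b := by linarith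
    rw [hab', same_lower a ha b hb ua ub hab'] at fa
    linarith

end

end Bowtie

/-! ### Ends of blue lines in the cells of the red arrangement -/

namespace Bowtie

/-- The ordinate at `x` of the line number `l`, where the line number `i` is `y = A i * x + b i`. -/
def ln (A b : ℕ → ℝ) (l : ℕ) (x : ℝ) : ℝ := A l * x + b l

/-- The abscissa of the intersection point of the lines number `i` and `l`. -/
noncomputable def cross (A b : ℕ → ℝ) (i l : ℕ) : ℝ := (b l - b i) / (A i - A l)

/-- The first `M` lines have distinct slopes, and no three of them have a common point. -/
structure GenPos (A b : ℕ → ℝ) (M : ℕ) : Prop where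
  slope : ∀ i < M, ∀ j < M, i ≠ j → A i ≠ A j
  triple : ∀ i < M, ∀ j < M, ∀ l < M, i ≠ j → j ≠ l → i ≠ l → ∀ x : ℝ,
    ln A b i x = ln A b j x → ln A b i x ≠ ln A b l x

/-- An end of the intersection of a blue line `j` with a cell of the red arrangement. The side `τ`
is `0` for a left end and `1` for a right end. The end lies on the red line number `o - 1`, or at
infinity if `o = 0`. -/
structure End where
  o : ℕ
  τ : ℕ
  j : ℕ

/-- There is such an end if the first `m` lines are blue and the next `k` lines are red. -/
structure End.Valid (m k : ℕ) (E : End) : Prop where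
  o : E.o ≤ k
  τ : E.τ = 0 ∨ E.τ = 1
  j : E.j < m

section
variable (A b : ℕ → ℝ) (m k : ℕ)

/-- The abscissa of an end that is not at infinity. -/
noncomputable def End.pos (E : End) : ℝ := cross A b (m + (E.o - 1)) E.j

/-- The line `l` meets the line of the end on the left side of the interior of the cell. -/
def End.Passed (E : End) (l : ℕ) : Prop :=
  if E.o = 0 then E.τ = 1
  else if E.τ = 0 then cross A b l E.j ≤ E.pos A b m else cross A b l E.j < E.pos A b m

/-- Near the end, the line `l` runs below the line of the end. -/
def End.Under (E : End) (l : ℕ) : Prop :=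
  (E.Passed A b m l ∧ A l < A E.j) ∨ (¬ E.Passed A b m l ∧ A E.j < A l)

open Classical in
/-- The cell of an end, given by the set of red lines below it. -/
noncomputable def End.cell (E : End) : Finset ℕ :=
  (Finset.range k).filter fun i => E.Under A b m (m + i)

/-- The end lies on the upper chain of the boundary of its cell. Ends at infinity count as members
of the lower chain. -/
def End.Upper (E : End) : Prop := E.o ≠ 0 ∧ ¬ E.Under A b m (m + (E.o - 1))

open Classical in
/-- In counterclockwise order, the ends of a cell are the left ends at infinity, the ends on the
lower chain, the right ends at infinity and the ends on the upper chain. -/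
noncomputable def End.zone (E : End) : ℝ :=
  if E.o = 0 then (if E.τ = 0 then 0 else 2) else if E.Upper A b m then 3 else 1

open Classical in
/-- The sort key within a zone. -/
noncomputable def End.rank (E : End) : ℝ :=
  if E.o = 0 then A E.j else if E.Upper A b m then 0 - E.pos A b m else E.pos A b m

variable (K T : ℝ)

/-- The abscissa of an end, if the ends at infinity are moved to the two lines `y = -K * x - T` and
`y = K * x - T`. -/
noncomputable def End.px (E : End) : ℝ :=
  if E.o = 0 then
    if E.τ = 0 then -((T + b E.j) / (A E.j + K)) else (T + b E.j) / (K - A E.j)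
  else E.pos A b m

/-- The ordinate that belongs to `End.px`. -/
noncomputable def End.py (E : End) : ℝ := ln A b E.j (E.px A b m K T)

/-- The slope of the red line or the artificial line that carries an end. -/
noncomputable def End.support (E : End) : ℝ :=
  if E.o = 0 then if E.τ = 0 then -K else K else A (m + (E.o - 1))

/-- The artificial lines `y = -K * x - T` and `y = K * x - T` are far away: all intersection points
have abscissas in `[-C, C]` and lie above both of them, and they meet the blue lines outside
of `[-C, C]`. -/
structure Far (C : ℝ) : Prop where
  nonneg : 0 ≤ C
  slope : ∀ l < m + k, |A l| < K
  west : ∀ j < m, -((T + b j) / (A j + K)) < -C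
  east : ∀ j < m, C < (T + b j) / (K - A j)
  cross : ∀ i < m + k, ∀ l < m + k, |cross A b i l| ≤ C
  above : ∀ i < m + k, ∀ l < m + k, K * |Bowtie.cross A b i l| - ln A b l (Bowtie.cross A b i l) ≤ T
end

variable {A b : ℕ → ℝ} {m k : ℕ} {K T C : ℝ} {E E' : End}

theorem ln_sub_ln {i l : ℕ} (h : A i ≠ A l) (x : ℝ) :
    ln A b i x - ln A b l x = (A i - A l) * (x - cross A b i l) := by
  have : A i - A l ≠ 0 := sub_ne_zero.2 h
  unfold ln cross
  field_simp
  ring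

theorem exists_abs_le (M : ℕ) (f : ℕ → ℕ → ℝ) : ∃ C, 0 ≤ C ∧ ∀ i < M, ∀ l < M, |f i l| ≤ C := by
  refine ⟨∑ i ∈ Finset.range M, ∑ l ∈ Finset.range M, |f i l|,
    Finset.sum_nonneg fun _ _ => Finset.sum_nonneg fun _ _ => abs_nonneg _, fun i hi l hl => ?_⟩
  refine le_trans ?_ (Finset.single_le_sum (f := fun i => ∑ l ∈ Finset.range M, |f i l|)
    (fun _ _ => Finset.sum_nonneg fun _ _ => abs_nonneg _) (Finset.mem_range.2 hi))
  exact Finset.single_le_sum (f := fun l => |f i l|) (fun _ _ => abs_nonneg _)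
    (Finset.mem_range.2 hl)

/-- The artificial lines can be chosen arbitrarily far away. -/
theorem exists_far (A b : ℕ → ℝ) (m k : ℕ) (C₀ : ℝ) : ∃ K T C, C₀ ≤ C ∧ Far A b m k K T C := by
  obtain ⟨K₀, hK₀, hK⟩ := exists_abs_le (m + k) fun i _ => A i
  obtain ⟨B, hB, hb⟩ := exists_abs_le (m + k) fun i _ => b i
  obtain ⟨C₁, hC₁, hc⟩ := exists_abs_le (m + k) fun i l => cross A b i l
  obtain ⟨D, hD, hd⟩ := exists_abs_le (m + k) fun i l =>
    (K₀ + 1) * |cross A b i l| - ln A b l (cross A b i l)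
  have hC : 0 ≤ |C₀| + C₁ := by positivity
  refine ⟨K₀ + 1, D + B + 2 * (K₀ + 1) * (|C₀| + C₁ + 1), |C₀| + C₁,
    by linarith [le_abs_self C₀], hC, ?_, ?_, ?_, ?_, ?_⟩
  · intro l hl
    linarith [hK l hl l hl]
  · intro j hj
    have h1 := abs_le.1 (hK j (by omega) j (by omega))
    have h2 := abs_le.1 (hb j (by omega) j (by omega))
    rw [neg_lt_neg_iff, lt_div_iff₀ (by linarith)]
    have h3 : (|C₀| + C₁) * (A j + (K₀ + 1)) ≤ (|C₀| + C₁) * (2 * (K₀ + 1)) :=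
      mul_le_mul_of_nonneg_left (by linarith) hC
    nlinarith
  · intro j hj
    have h1 := abs_le.1 (hK j (by omega) j (by omega))
    have h2 := abs_le.1 (hb j (by omega) j (by omega))
    rw [lt_div_iff₀ (by linarith)]
    have h3 : (|C₀| + C₁) * ((K₀ + 1) - A j) ≤ (|C₀| + C₁) * (2 * (K₀ + 1)) :=
      mul_le_mul_of_nonneg_left (by linarith) hC
    nlinarith
  · intro i hi l hl
    linarith [hc i hi l hl, abs_nonneg C₀]
  · intro i hi l hl
    have h1 := (abs_le.1 (hd i hi l hl)).2
    have h2 : 0 ≤ 2 * (K₀ + 1) * (|C₀| + C₁ + 1) := by positivity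
    linarith

theorem End.Valid.red (hE : E.Valid m k) (h0 : E.o ≠ 0) : m + (E.o - 1) < m + k := by
  have := hE.o; omega

theorem End.passed_spec (hF : Far A b m k K T C) (hE : E.Valid m k) {l : ℕ} (hl : l < m + k) :
    (E.Passed A b m l → cross A b l E.j ≤ E.px A b m K T) ∧
      (¬ E.Passed A b m l → E.px A b m K T ≤ cross A b l E.j) := by
  have hj := hE.j
  have hc := abs_le.1 (hF.cross l hl E.j (by omega))
  unfold End.Passed End.px
  by_cases h0 : E.o = 0
  · simp only [h0, if_true]
    rcases hE.τ with h | h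
    · simp only [h, zero_ne_one, false_imp_iff, true_and, not_false_eq_true, forall_const, if_true]
      linarith [hF.west E.j hj]
    · simp only [h, not_true_eq_false, false_imp_iff, and_true, one_ne_zero, forall_const, if_false]
      linarith [hF.east E.j hj]
  · simp only [h0, if_false]
    split_ifs
    · exact ⟨fun h => h, fun h => (not_le.1 h).le⟩
    · exact ⟨fun h => h.le, fun h => not_lt.1 h⟩

/-- An end lies strictly on one side of each line that does not carry it. -/
theorem End.passed_spec_strict (hG : GenPos A b (m + k)) (hF : Far A b m k K T C)
    (hE : E.Valid m k) {l : ℕ} (hl : l < m + k) (hlj : l ≠ E.j)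
    (hlo : E.o ≠ 0 → l ≠ m + (E.o - 1)) :
    (E.Passed A b m l → cross A b l E.j < E.px A b m K T) ∧
      (¬ E.Passed A b m l → E.px A b m K T < cross A b l E.j) := by
  have hj := hE.j
  have hne : cross A b l E.j ≠ E.px A b m K T := by
    unfold End.px
    by_cases h0 : E.o = 0
    · have hc := abs_le.1 (hF.cross l hl E.j (by omega))
      simp only [h0, if_true]
      split_ifs
      · intro h; linarith [hF.west E.j hj]
      · intro h; linarith [hF.east E.j hj]
    · simp only [h0, if_false]
      intro h
      have hr := hE.red h0
      have h1 := ln_sub_ln (b := b) (hG.slope l hl E.j (by omega) hlj) (E.pos A b m)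
      have h2 := ln_sub_ln (b := b) (hG.slope _ hr E.j (by omega) (by omega)) (E.pos A b m)
      rw [h, sub_self, mul_zero] at h1
      rw [show cross A b (m + (E.o - 1)) E.j = E.pos A b m from rfl, sub_self, mul_zero] at h2
      exact hG.triple E.j (by omega) l hl _ hr hlj.symm (hlo h0) (by omega) (E.pos A b m)
        (by linarith) (by linarith)
  obtain ⟨h1, h2⟩ := E.passed_spec hF hE hl
  exact ⟨fun h => lt_of_le_of_ne (h1 h) hne, fun h => lt_of_le_of_ne (h2 h) hne.symm⟩

/-- An end lies in the closure of its cell. -/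
theorem End.under_spec (hG : GenPos A b (m + k)) (hF : Far A b m k K T C) (hE : E.Valid m k)
    {l : ℕ} (hl : l < m + k) (hlj : l ≠ E.j) :
    (E.Under A b m l → ln A b l (E.px A b m K T) ≤ E.py A b m K T) ∧
      (¬ E.Under A b m l → E.py A b m K T ≤ ln A b l (E.px A b m K T)) := by
  have hj := hE.j
  have hA := hG.slope l hl E.j (by omega) hlj
  have hs := ln_sub_ln (b := b) hA (E.px A b m K T)
  obtain ⟨h1, h2⟩ := E.passed_spec hF hE hl
  unfold End.Under End.py
  by_cases hp : E.Passed A b m l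
  · have h3 := sub_nonneg.2 (h1 hp)
    simp only [hp, true_and, not_true_eq_false, false_and, or_false, not_lt]
    refine ⟨fun h => ?_, fun h => ?_⟩
    · have := mul_nonneg (sub_nonneg.2 h.le) h3; linarith
    · have := mul_nonneg (sub_nonneg.2 h) h3; linarith
  · have h3 := sub_nonneg.2 (h2 hp)
    simp only [hp, false_and, not_false_eq_true, true_and, false_or, not_lt]
    refine ⟨fun h => ?_, fun h => ?_⟩
    · have := mul_nonneg (sub_nonneg.2 h.le) h3; linarith
    · have := mul_nonneg (sub_nonneg.2 h) h3; linarith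

theorem End.mem_cell {i : ℕ} (hi : i < k) : i ∈ E.cell A b m k ↔ E.Under A b m (m + i) := by
  simp [End.cell, hi]

theorem Far.pos_add (hF : Far A b m k K T C) {j : ℕ} (hj : j < m) : 0 < A j + K := by
  linarith [(abs_lt.1 (hF.slope j (by omega))).1]

theorem Far.pos_sub (hF : Far A b m k K T C) {j : ℕ} (hj : j < m) : 0 < K - A j := by
  linarith [(abs_lt.1 (hF.slope j (by omega))).2]

theorem End.py_west (hF : Far A b m k K T C) (hE : E.Valid m k) (h0 : E.o = 0) (hτ : E.τ = 0) :
    E.py A b m K T = -K * E.px A b m K T - T := by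
  have := hF.pos_add hE.j
  simp only [End.py, End.px, h0, hτ, if_true, ln]
  field_simp
  ring

theorem End.py_east (hF : Far A b m k K T C) (hE : E.Valid m k) (h0 : E.o = 0) (hτ : E.τ = 1) :
    E.py A b m K T = K * E.px A b m K T - T := by
  have := hF.pos_sub hE.j
  simp only [End.py, End.px, h0, hτ, if_true, one_ne_zero, if_false, ln]
  field_simp
  ring

theorem End.px_west (hF : Far A b m k K T C) (hE : E.Valid m k) (h0 : E.o = 0) (hτ : E.τ = 0) :
    E.px A b m K T < -C := by
  simpa only [End.px, h0, hτ, if_true] using hF.west E.j hE.j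

theorem End.px_east (hF : Far A b m k K T C) (hE : E.Valid m k) (h0 : E.o = 0) (hτ : E.τ = 1) :
    C < E.px A b m K T := by
  simpa only [End.px, h0, hτ, if_true, one_ne_zero, if_false] using hF.east E.j hE.j

theorem End.px_red (h0 : E.o ≠ 0) : E.px A b m K T = E.pos A b m := by
  simp only [End.px, h0, if_false]

theorem End.abs_px_red (hF : Far A b m k K T C) (hE : E.Valid m k) (h0 : E.o ≠ 0) :
    |E.px A b m K T| ≤ C := by
  have := hE.j
  rw [End.px_red h0]
  exact hF.cross _ (hE.red h0) _ (by omega)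

theorem Far.pos_K (hF : Far A b m k K T C) (hE : E.Valid m k) : 0 < K := by
  have := hE.j
  exact lt_of_le_of_lt (abs_nonneg _) (hF.slope E.j (by omega))

/-- All ends lie above the two artificial lines. -/
theorem End.above (hF : Far A b m k K T C) (hE : E.Valid m k) :
    -K * E.px A b m K T - T ≤ E.py A b m K T ∧ K * E.px A b m K T - T ≤ E.py A b m K T := by
  have hj := hE.j
  have hK := hF.pos_K hE
  have hC := hF.nonneg
  by_cases h0 : E.o = 0
  · rcases hE.τ with hτ | hτ
    · have h1 := E.py_west hF hE h0 hτ
      have h2 := E.px_west hF hE h0 hτ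
      have := mul_pos hK (show 0 < -E.px A b m K T by linarith)
      constructor <;> linarith
    · have h1 := E.py_east hF hE h0 hτ
      have h2 := E.px_east hF hE h0 hτ
      have := mul_pos hK (show 0 < E.px A b m K T by linarith)
      constructor <;> linarith
  · have h1 := hF.above _ (hE.red h0) E.j (by omega)
    have h2 : cross A b (m + (E.o - 1)) E.j = E.px A b m K T := (E.px_red h0).symm
    rw [h2] at h1
    have h3 := mul_le_mul_of_nonneg_left (le_abs_self (E.px A b m K T)) hK.le
    have h4 := mul_le_mul_of_nonneg_left (neg_abs_le (E.px A b m K T)) hK.le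
    unfold End.py
    constructor <;> linarith

/-- A line through the point `E` in terms of slope and abscissa. -/
theorem End.py_red (hG : GenPos A b (m + k)) (hE : E.Valid m k) (h0 : E.o ≠ 0) (x : ℝ) :
    E.py A b m K T + A (m + (E.o - 1)) * (x - E.px A b m K T) = ln A b (m + (E.o - 1)) x := by
  have hj := hE.j
  have := ln_sub_ln (b := b) (hG.slope _ (hE.red h0) E.j (by omega) (by omega)) (E.px A b m K T)
  rw [show cross A b (m + (E.o - 1)) E.j = E.px A b m K T from (E.px_red h0).symm, sub_self,
    mul_zero] at this
  unfold End.py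
  unfold ln at *
  linarith

/-- The ends of a cell are in convex position. -/
theorem End.supported (hG : GenPos A b (m + k)) (hF : Far A b m k K T C) (S : Finset ℕ) :
    Supported {E : End | E.Valid m k ∧ E.cell A b m k = S} (End.px A b m K T) (End.py A b m K T)
      (End.support A m K) (End.Upper A b m) := by
  constructor
  · rintro E ⟨hE, hES⟩ hu E' ⟨hE', hES'⟩
    by_cases h0 : E.o = 0
    · have h1 := E'.above hF hE'
      rcases hE.τ with hτ | hτ
      · simp only [End.support, h0, hτ, if_true, E.py_west hF hE h0 hτ]
        linarith
      · simp only [End.support, h0, hτ, if_true, one_ne_zero, if_false, E.py_east hF hE h0 hτ]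
        linarith
    · have hr := hE.red h0
      have hj' := hE'.j
      simp only [End.support, h0, if_false]
      rw [E.py_red hG hE h0]
      refine (E'.under_spec hG hF hE' hr (by omega)).1 ?_
      have hin : E.Under A b m (m + (E.o - 1)) := by
        by_contra hcon
        exact hu ⟨h0, hcon⟩
      rw [← End.mem_cell (k := k) (by omega)] at hin ⊢
      rwa [hES', ← hES]
  · rintro E ⟨hE, hES⟩ ⟨h0, hu⟩ E' ⟨hE', hES'⟩
    have hr := hE.red h0
    have hj' := hE'.j
    simp only [End.support, h0, if_false]
    rw [E.py_red hG hE h0]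
    refine (E'.under_spec hG hF hE' hr (by omega)).2 ?_
    rw [← End.mem_cell (k := k) (by omega)] at hu ⊢
    rwa [hES', ← hES]

theorem End.px_west_mono (hG : GenPos A b (m + k)) (hF : Far A b m k K T C) (hE : E.Valid m k)
    (hE' : E'.Valid m k) (h0 : E.o = 0) (hτ : E.τ = 0) (h0' : E'.o = 0) (hτ' : E'.τ = 0)
    (hA : A E.j ≤ A E'.j) : E.px A b m K T ≤ E'.px A b m K T := by
  have hj := hE.j
  have hj' := hE'.j
  by_cases hjj : E.j = E'.j
  · simp [End.px, h0, hτ, h0', hτ', hjj]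
  have hne := hG.slope E.j (by omega) E'.j (by omega) hjj
  have h1 := E.px_west hF hE h0 hτ
  have h2 := E.py_west hF hE h0 hτ
  have h3 := E'.py_west hF hE' h0' hτ'
  have h4 := ln_sub_ln (b := b) hne (E.px A b m K T)
  have h5 := abs_le.1 (hF.cross E.j (by omega) E'.j (by omega))
  have h6 := mul_nonneg (sub_nonneg.2 hA)
    (show 0 ≤ cross A b E.j E'.j - E.px A b m K T by linarith)
  have h7 := hF.pos_add hE'.j
  unfold End.py at h2 h3
  by_contra hcon
  have h8 := mul_pos h7 (sub_pos.2 (not_le.1 hcon))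
  unfold ln at *
  linarith

theorem End.px_east_mono (hG : GenPos A b (m + k)) (hF : Far A b m k K T C) (hE : E.Valid m k)
    (hE' : E'.Valid m k) (h0 : E.o = 0) (hτ : E.τ = 1) (h0' : E'.o = 0) (hτ' : E'.τ = 1)
    (hA : A E.j ≤ A E'.j) : E.px A b m K T ≤ E'.px A b m K T := by
  have hj := hE.j
  have hj' := hE'.j
  by_cases hjj : E.j = E'.j
  · simp [End.px, h0, hτ, h0', hτ', hjj]
  have hne := hG.slope E.j (by omega) E'.j (by omega) hjj
  have h1 := E.px_east hF hE h0 hτ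
  have h2 := E.py_east hF hE h0 hτ
  have h3 := E'.py_east hF hE' h0' hτ'
  have h4 := ln_sub_ln (b := b) hne (E.px A b m K T)
  have h5 := abs_le.1 (hF.cross E.j (by omega) E'.j (by omega))
  have h6 := mul_nonneg (sub_nonneg.2 hA)
    (show 0 ≤ E.px A b m K T - cross A b E.j E'.j by linarith)
  have h7 := hF.pos_sub hE'.j
  unfold End.py at h2 h3
  by_contra hcon
  have h8 := mul_pos h7 (sub_pos.2 (not_le.1 hcon))
  unfold ln at *
  linarith

/-- The lexicographic order of zone and rank is the counterclockwise order of the ends. -/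
theorem End.ccw (hG : GenPos A b (m + k)) (hF : Far A b m k K T C) (hE : E.Valid m k)
    (hE' : E'.Valid m k) (h : E.zone A b m < E'.zone A b m ∨
      (E.zone A b m ≤ E'.zone A b m ∧ E.rank A b m ≤ E'.rank A b m)) :
    Ccw (End.px A b m K T) (End.Upper A b m) E E' := by
  have hC := hF.nonneg
  have hzone : ∀ {E : End}, E.Valid m k → (E.o = 0 ∧ E.τ = 0 ∧ ¬ E.Upper A b m ∧
      E.zone A b m = 0 ∧ E.rank A b m = A E.j) ∨
      (E.o ≠ 0 ∧ ¬ E.Upper A b m ∧ E.zone A b m = 1 ∧ E.rank A b m = E.px A b m K T) ∨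
      (E.o = 0 ∧ E.τ = 1 ∧ ¬ E.Upper A b m ∧ E.zone A b m = 2 ∧ E.rank A b m = A E.j) ∨
      (E.o ≠ 0 ∧ E.Upper A b m ∧ E.zone A b m = 3 ∧ E.rank A b m = 0 - E.px A b m K T) := by
    intro E hE
    unfold End.zone End.rank
    by_cases h0 : E.o = 0
    · have hu : ¬ E.Upper A b m := fun h => h.1 h0
      rcases hE.τ with hτ | hτ
      · left; simp [h0, hτ, hu]
      · right; right; left; simp [h0, hτ, hu]
    · by_cases hu : E.Upper A b m
      · right; right; right; simp [h0, hu, End.px_red h0]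
      · right; left; simp [h0, hu, End.px_red h0]
  rcases hzone hE with ⟨a1, a2, a3, a4, a5⟩ | ⟨a1, a3, a4, a5⟩ | ⟨a1, a2, a3, a4, a5⟩ |
    ⟨a1, a3, a4, a5⟩ <;>
  rcases hzone hE' with ⟨b1, b2, b3, b4, b5⟩ | ⟨b1, b3, b4, b5⟩ | ⟨b1, b2, b3, b4, b5⟩ |
    ⟨b1, b3, b4, b5⟩ <;>
  rw [a4, a5, b4, b5] at h <;> norm_num at h
  · exact .inl ⟨a3, b3, End.px_west_mono hG hF hE hE' a1 a2 b1 b2 h⟩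
  · exact .inl ⟨a3, b3, by
      linarith [E.px_west hF hE a1 a2, (abs_le.1 (E'.abs_px_red hF hE' b1)).1]⟩
  · exact .inl ⟨a3, b3, by linarith [E.px_west hF hE a1 a2, E'.px_east hF hE' b1 b2]⟩
  · exact .inr (.inl ⟨a3, b3⟩)
  · exact .inl ⟨a3, b3, h⟩
  · exact .inl ⟨a3, b3, by
      linarith [E'.px_east hF hE' b1 b2, (abs_le.1 (E.abs_px_red hF hE a1)).2]⟩
  · exact .inr (.inl ⟨a3, b3⟩)
  · exact .inl ⟨a3, b3, End.px_east_mono hG hF hE hE' a1 a2 b1 b2 h⟩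
  · exact .inr (.inl ⟨a3, b3⟩)
  · exact .inr (.inr ⟨a3, b3, h⟩)

/-- The red lines that two ends of the same line and cell have passed are the same. -/
theorem End.passed_iff (hG : GenPos A b (m + k)) (hE : E.Valid m k)
    (hj : E.j = E'.j) (hc : E.cell A b m k = E'.cell A b m k) {i : ℕ} (hi : i < k) :
    E.Passed A b m (m + i) ↔ E'.Passed A b m (m + i) := by
  have hm := Finset.ext_iff.1 hc i
  rw [End.mem_cell hi, End.mem_cell hi] at hm
  have hj' := hE.j
  unfold End.Under at hm
  rw [← hj] at hm
  rcases lt_or_gt_of_ne (hG.slope (m + i) (by omega) E.j (by omega) (by omega)) with h | h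
  · have := not_lt.2 h.le
    tauto
  · have := not_lt.2 h.le
    tauto

/-- Ends of the same line, side and cell coincide. -/
theorem End.eq_of_cell_eq (hG : GenPos A b (m + k)) (hE : E.Valid m k) (hE' : E'.Valid m k)
    (hj : E.j = E'.j) (hτ : E.τ = E'.τ) (hc : E.cell A b m k = E'.cell A b m k) : E = E' := by
  have hpos : E.o ≠ 0 → E'.o ≠ 0 → E.pos A b m = E'.pos A b m → E.o = E'.o := by
    intro h0 h0' hp
    by_contra hne
    have hr := hE.red h0
    have hr' := hE'.red h0'
    have hj1 := hE'.j
    have h1 := ln_sub_ln (b := b) (hG.slope _ hr E'.j (by omega) (by omega)) (E.pos A b m)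
    have h2 := ln_sub_ln (b := b) (hG.slope _ hr' E'.j (by omega) (by omega)) (E.pos A b m)
    rw [← hj, show cross A b (m + (E.o - 1)) E.j = E.pos A b m from rfl, sub_self, mul_zero] at h1
    rw [show cross A b (m + (E'.o - 1)) E'.j = E.pos A b m from hp.symm, sub_self, mul_zero] at h2
    rw [hj] at h1
    exact hG.triple E'.j (by omega) _ hr _ hr' (by omega) (by omega) (by omega) (E.pos A b m)
      (by linarith) (by linarith)
  -- Otherwise the red line that carries one of the ends separates their cells.
  have main : E.o = E'.o := by
    have e1 : cross A b (m + (E'.o - 1)) E.j = E'.pos A b m := by rw [hj]; rfl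
    have e2 : cross A b (m + (E.o - 1)) E'.j = E.pos A b m := by rw [← hj]; rfl
    have e3 : cross A b (m + (E.o - 1)) E.j = E.pos A b m := rfl
    have e4 : cross A b (m + (E'.o - 1)) E'.j = E'.pos A b m := rfl
    have h1 : E.o ≠ 0 → _ := fun h0 =>
      End.passed_iff hG hE hj hc (i := E.o - 1) (by have := hE.o; omega)
    have h2 : E'.o ≠ 0 → _ := fun h0 =>
      End.passed_iff hG hE hj hc (i := E'.o - 1) (by have := hE'.o; omega)
    unfold End.Passed at h1 h2
    rw [e2, e3, ← hτ] at h1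
    rw [e1, e4, ← hτ] at h2
    by_cases h0 : E.o = 0 <;> by_cases h0' : E'.o = 0
    · rw [h0, h0']
    · exfalso
      rcases hE.τ with h | h <;> simp [h0, h0', h] at h2
    · exfalso
      rcases hE.τ with h | h <;> simp [h0, h0', h] at h1
    · refine hpos h0 h0' ?_
      rcases hE.τ with h | h
      · simp only [h0, h0', h, ne_eq, not_false_eq_true, if_false, if_true, le_refl, true_iff,
          iff_true, forall_const] at h1 h2
        exact le_antisymm h1 h2
      · simp only [h0, h0', h, ne_eq, not_false_eq_true, if_false, lt_self_iff_false, false_iff,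
          iff_false, forall_const, one_ne_zero, not_lt] at h1 h2
        exact le_antisymm h2 h1
  cases E; cases E'
  simp_all

end Bowtie

/-! ### The two ends of a blue line in a cell -/

namespace Bowtie

open Filter Topology

section
variable (A b : ℕ → ℝ) (m k : ℕ)

/-- The abscissa `x` belongs to the open edge of the arrangement of all lines that starts at the
end `E` and runs along its line into the cell. -/
def End.Inner (E : End) (x : ℝ) : Prop :=
  ∀ l < m + k, l ≠ E.j → cross A b l E.j ≠ x ∧ (E.Passed A b m l ↔ cross A b l E.j < x)
end

variable {A b : ℕ → ℝ} {m k : ℕ} {K T C : ℝ} {E E' : End}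

theorem End.under_spec_inner {l : ℕ} {x : ℝ} (hA : A l ≠ A E.j) (h1 : cross A b l E.j ≠ x)
    (h2 : E.Passed A b m l ↔ cross A b l E.j < x) :
    (E.Under A b m l → ln A b l x < ln A b E.j x) ∧
      (¬ E.Under A b m l → ln A b E.j x < ln A b l x) := by
  have hs := ln_sub_ln (b := b) hA x
  unfold End.Under
  rw [h2]
  rcases lt_or_gt_of_ne h1 with h | h <;> rcases lt_or_gt_of_ne hA with h' | h' <;>
    have := mul_pos (sub_pos.2 h') (sub_pos.2 h) <;>
    have h3 := not_lt.2 h.le <;> have h4 := not_lt.2 h'.le <;>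
    constructor <;> intro h5 <;> first | linarith | (exfalso; tauto)

theorem End.Inner.under (hG : GenPos A b (m + k)) {x : ℝ} (hx : E.Inner A b m k x)
    (hj : E.j < m + k) {l : ℕ} (hl : l < m + k) (hlj : l ≠ E.j) :
    (E.Under A b m l → ln A b l x < ln A b E.j x) ∧
      (¬ E.Under A b m l → ln A b E.j x < ln A b l x) :=
  End.under_spec_inner (hG.slope l hl E.j hj hlj) (hx l hl hlj).1 (hx l hl hlj).2

/-- Every end has an edge. -/
theorem End.exists_inner (A b : ℕ → ℝ) (m k : ℕ) (E : End) : ∃ x, E.Inner A b m k x := by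
  have key : ∀ F : Filter ℝ, F.NeBot → (∀ l, ∀ᶠ x in F, cross A b l E.j ≠ x ∧
      (E.Passed A b m l ↔ cross A b l E.j < x)) → ∃ x, E.Inner A b m k x := by
    intro F hF h
    have h1 : ∀ᶠ x in F, ∀ l ∈ Finset.range (m + k), cross A b l E.j ≠ x ∧
        (E.Passed A b m l ↔ cross A b l E.j < x) :=
      (eventually_all_finset _).2 fun l _ => h l
    obtain ⟨x, hx⟩ := h1.exists
    exact ⟨x, fun l hl _ => hx l (Finset.mem_range.2 hl)⟩
  by_cases h0 : E.o = 0
  · by_cases hτ : E.τ = 1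
    · refine key atTop inferInstance fun l => ?_
      filter_upwards [eventually_gt_atTop (cross A b l E.j)] with x hx
      simp [End.Passed, h0, hτ, hx, hx.ne]
    · refine key atBot inferInstance fun l => ?_
      filter_upwards [eventually_lt_atBot (cross A b l E.j)] with x hx
      simp [End.Passed, h0, hτ, hx.le, hx.ne']
  · by_cases hτ : E.τ = 0
    · refine key (𝓝[>] (E.pos A b m)) inferInstance fun l => ?_
      rcases le_or_gt (cross A b l E.j) (E.pos A b m) with h | h
      · filter_upwards [self_mem_nhdsWithin] with x hx
        have := h.trans_lt (Set.mem_Ioi.1 hx)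
        simp [End.Passed, h0, hτ, h, this, this.ne]
      · filter_upwards [nhdsWithin_le_nhds (eventually_lt_nhds h)] with x hx
        simp [End.Passed, h0, hτ, not_le.2 h, not_lt.2 hx.le, hx.ne']
    · refine key (𝓝[<] (E.pos A b m)) inferInstance fun l => ?_
      rcases lt_or_ge (cross A b l E.j) (E.pos A b m) with h | h
      · filter_upwards [nhdsWithin_le_nhds (eventually_gt_nhds h)] with x hx
        simp [End.Passed, h0, hτ, h, hx, hx.ne]
      · filter_upwards [self_mem_nhdsWithin] with x hx
        have := (Set.mem_Iio.1 hx).trans_le h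
        simp [End.Passed, h0, hτ, not_lt.2 h, not_lt.2 this.le, this.ne']

/-- The ends of the intersection of the line `j` with the cell of its point with abscissa `x`. -/
theorem exists_end {j : ℕ} (hj : j < m) {x : ℝ} (hx : ∀ i < k, cross A b (m + i) j ≠ x) (τ : ℕ)
    (hτ : τ = 0 ∨ τ = 1) : ∃ E : End, E.Valid m k ∧ E.j = j ∧ E.τ = τ ∧
      (∀ i < k, E.Passed A b m (m + i) ↔ cross A b (m + i) j < x) ∧
      (E.o ≠ 0 → τ = 0 → E.pos A b m < x) ∧ (E.o ≠ 0 → τ = 1 → x < E.pos A b m) := by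
  rcases hτ with rfl | rfl
  · by_cases hne : ((Finset.range k).filter fun i => cross A b (m + i) j < x).Nonempty
    · obtain ⟨i, hi, hmax⟩ := Finset.exists_max_image _ (fun i => cross A b (m + i) j) hne
      simp only [Finset.mem_filter, Finset.mem_range] at hi hmax
      refine ⟨⟨i + 1, 0, j⟩, ⟨by simp; omega, .inl rfl, hj⟩, rfl, rfl, fun i' hi' => ?_, ?_, ?_⟩
      · simp only [End.Passed, End.pos, Nat.add_sub_cancel, Nat.add_eq_zero_iff, one_ne_zero,
          and_false, if_false, if_true]
        exact ⟨fun h => h.trans_lt hi.2, fun h => hmax i' ⟨hi', h⟩⟩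
      · intro _ _; simpa [End.pos] using hi.2
      · simp
    · refine ⟨⟨0, 0, j⟩, ⟨by simp, .inl rfl, hj⟩, rfl, rfl, fun i' hi' => ?_, ?_, ?_⟩
      · simp only [End.Passed, if_true, zero_ne_one, false_iff]
        intro h
        exact hne ⟨i', by simp [hi', h]⟩
      · simp
      · simp
  · by_cases hne : ((Finset.range k).filter fun i => x < cross A b (m + i) j).Nonempty
    · obtain ⟨i, hi, hmin⟩ := Finset.exists_min_image _ (fun i => cross A b (m + i) j) hne
      simp only [Finset.mem_filter, Finset.mem_range] at hi hmin
      refine ⟨⟨i + 1, 1, j⟩, ⟨by simp; omega, .inr rfl, hj⟩, rfl, rfl, fun i' hi' => ?_, ?_, ?_⟩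
      · simp only [End.Passed, End.pos, Nat.add_sub_cancel, Nat.add_eq_zero_iff, one_ne_zero,
          and_false, if_false]
        refine ⟨fun h => lt_of_le_of_ne (not_lt.1 fun h' => ?_) (hx i' hi'), fun h => h.trans hi.2⟩
        exact absurd (hmin i' ⟨hi', h'⟩) (not_le.2 h)
      · simp
      · intro _ _; simpa [End.pos] using hi.2
    · refine ⟨⟨0, 1, j⟩, ⟨by simp, .inr rfl, hj⟩, rfl, rfl, fun i' hi' => ?_, ?_, ?_⟩
      · simp only [End.Passed, if_true, true_iff]
        exact lt_of_le_of_ne (not_lt.1 fun h' => hne ⟨i', by simp [hi', h']⟩) (hx i' hi')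
      · simp
      · simp

/-- The other end of the line of `E` in the cell of `E`. -/
theorem End.exists_mate (A b : ℕ → ℝ) (hE : E.Valid m k) : ∃ E' : End, E'.Valid m k ∧
    E'.j = E.j ∧ E'.τ ≠ E.τ ∧ E'.cell A b m k = E.cell A b m k := by
  obtain ⟨x, hx⟩ := E.exists_inner A b m k
  have hj := hE.j
  obtain ⟨E', h1, h2, h3, h4, -⟩ := exists_end (A := A) (b := b) (k := k) hj
    (fun i hi => (hx (m + i) (by omega) (by omega)).1) (1 - E.τ)
    (by rcases hE.τ with h | h <;> simp [h])
  refine ⟨E', h1, h2, by rcases hE.τ with h | h <;> omega, ?_⟩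
  ext i
  by_cases hi : i < k
  · rw [End.mem_cell hi, End.mem_cell hi, End.Under, End.Under, h4 i hi,
      (hx (m + i) (by omega) (by omega)).2, h2]
  · simp [End.cell, hi]

/-- The left end of a line in a cell is to the left of the right end. -/
theorem End.px_lt (hG : GenPos A b (m + k)) (hF : Far A b m k K T C) (hE : E.Valid m k)
    (hE' : E'.Valid m k) (hj : E.j = E'.j) (hτ : E.τ = 0) (hτ' : E'.τ = 1)
    (hc : E.cell A b m k = E'.cell A b m k) : E.px A b m K T < E'.px A b m K T := by
  have hC := hF.nonneg
  by_cases h0 : E.o = 0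
  · have h1 := End.px_west hF hE h0 hτ
    by_cases h0' : E'.o = 0
    · have := End.px_east hF hE' h0' hτ'
      linarith
    · have := abs_le.1 (End.abs_px_red hF hE' h0')
      linarith
  · by_cases h0' : E'.o = 0
    · have h1 := End.px_east hF hE' h0' hτ'
      have := abs_le.1 (End.abs_px_red hF hE h0)
      linarith
    · have h1 := End.passed_iff hG hE hj hc (i := E.o - 1) (by have := hE.o; omega)
      have e2 : cross A b (m + (E.o - 1)) E'.j = E.pos A b m := by rw [← hj]; rfl
      simp only [End.Passed, h0, hτ, if_false, if_true, h0', hτ', one_ne_zero, e2,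
        show cross A b (m + (E.o - 1)) E.j = E.pos A b m from rfl, le_refl, true_iff] at h1
      rwa [End.px_red h0, End.px_red h0']

end Bowtie

/-! ### The circular order of the ends of a cell -/

namespace Bowtie

/-- The number that represents a set of red lines. -/
noncomputable def cellCode (S : Finset ℕ) : ℝ := ∑ i ∈ S, 2 ^ i

theorem cellCode_injective : Function.Injective cellCode := by
  intro S S' h
  have h' : ((∑ i ∈ S, 2 ^ i : ℕ) : ℝ) = ((∑ i ∈ S', 2 ^ i : ℕ) : ℝ) := by
    push_cast; exact h
  exact Finset.geomSum_injective le_rfl (Nat.cast_injective h')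

/-- The sequence `e 0, …, e (N - 1)` lists all ends, cell by cell, and the ends of a cell in
counterclockwise order. -/
structure EndOrder (A b : ℕ → ℝ) (m k N : ℕ) (e : ℕ → End) : Prop where
  valid : ∀ r < N, (e r).Valid m k
  inj : ∀ r < N, ∀ r' < N, e r = e r' → r = r'
  surj : ∀ E : End, E.Valid m k → ∃ r < N, e r = E
  mono : ∀ r r', r < r' → r' < N →
    cellCode ((e r).cell A b m k) ≤ cellCode ((e r').cell A b m k)
  ccw : ∀ r r', r < r' → r' < N → (e r).cell A b m k = (e r').cell A b m k →
    (e r).zone A b m < (e r').zone A b m ∨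
      ((e r).zone A b m ≤ (e r').zone A b m ∧ (e r).rank A b m ≤ (e r').rank A b m)

variable {A b : ℕ → ℝ} {m k N : ℕ} {e : ℕ → End} {mate : ℕ → ℕ}

/-- Every end is matched with the other end of its line in its cell. -/
theorem EndOrder.exists_mate (hG : GenPos A b (m + k)) (he : EndOrder A b m k N e) :
    ∃ mate, RealRAM.Paired N (fun r => cellCode ((e r).cell A b m k)) (fun r => (e r).j) mate := by
  have h1 : ∀ r, ∃ r', r < N → r' < N ∧ (e r').j = (e r).j ∧ (e r').τ ≠ (e r).τ ∧
      (e r').cell A b m k = (e r).cell A b m k := by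
    intro r
    by_cases hr : r < N
    · obtain ⟨E, hE, h1, h2, h3⟩ := End.exists_mate A b (he.valid r hr)
      obtain ⟨r', hr', rfl⟩ := he.surj E hE
      exact ⟨r', fun _ => ⟨hr', h1, h2, h3⟩⟩
    · exact ⟨0, fun h => absurd h hr⟩
  choose mate hm using h1
  have eq_or : ∀ r < N, ∀ r' < N, (e r).j = (e r').j →
      (e r).cell A b m k = (e r').cell A b m k → r' = r ∨ r' = mate r := by
    intro r hr r' hr' hj hc
    obtain ⟨g1, g2, g3, g4⟩ := hm r hr
    by_cases hτ : (e r').τ = (e r).τ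
    · exact .inl (he.inj _ hr' _ hr
        (End.eq_of_cell_eq hG (he.valid _ hr') (he.valid _ hr) hj.symm hτ hc.symm))
    · refine .inr (he.inj _ hr' _ g1
        (End.eq_of_cell_eq hG (he.valid _ hr') (he.valid _ g1) (by rw [g2, hj]) ?_
          (by rw [g4, hc])))
      rcases (he.valid r hr).τ with h | h <;> rcases (he.valid r' hr').τ with h' | h' <;>
        rcases (he.valid _ g1).τ with h'' | h'' <;> omega
  refine ⟨mate, he.mono, fun r hr => (hm r hr).1, fun r hr h => ?_, fun r hr => ?_,
    fun r hr => ?_, fun r hr => (hm r hr).2.1, fun r hr r' hr' hj hc =>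
      eq_or r hr r' hr' hj (cellCode_injective hc)⟩
  · have := (hm r hr).2.2.1
    rw [h] at this
    exact this rfl
  · obtain ⟨g1, g2, g3, g4⟩ := hm r hr
    rcases eq_or (mate r) g1 r hr g2 g4 with h | h
    · rw [← h] at g3
      exact absurd rfl g3
    · exact h.symm
  · exact congrArg cellCode (hm r hr).2.2.2

theorem EndOrder.ccw_of_lt {K T C : ℝ} (hG : GenPos A b (m + k)) (hF : Far A b m k K T C)
    (he : EndOrder A b m k N e) {r r' : ℕ} (hr : r ≤ r') (hr' : r' < N)
    (hc : (e r).cell A b m k = (e r').cell A b m k) :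
    Ccw (End.px A b m K T) (End.Upper A b m) (e r) (e r') := by
  rcases hr.lt_or_eq with h | rfl
  · exact End.ccw hG hF (he.valid r (h.trans hr')) (he.valid r' hr') (he.ccw r r' h hr' hc)
  · exact End.ccw hG hF (he.valid r hr') (he.valid r hr') (.inr ⟨le_rfl, le_rfl⟩)

theorem orient_line {A b : ℕ → ℝ} {l : ℕ} {xa xb : ℝ} {ι : Type*} {x y : ι → ℝ} {a c z : ι}
    (ha : x a = xa) (hb : x c = xb) (hya : y a = ln A b l xa) (hyb : y c = ln A b l xb) :
    orient x y a c z = (xb - xa) * (y z - ln A b l (x z)) := by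
  unfold orient
  rw [ha, hb, hya, hyb]
  unfold ln
  ring

/-- If exactly one end of a line `l` in a cell lies between the ends `p` and `q` of other lines,
then `l` separates `p` and `q`. -/
theorem EndOrder.separated (hG : GenPos A b (m + k)) (he : EndOrder A b m k N e)
    (hp : RealRAM.Paired N (fun r => cellCode ((e r).cell A b m k)) (fun r => (e r).j) mate)
    {p q r : ℕ} (hq : q < N) (hc : (e p).cell A b m k = (e q).cell A b m k)
    (hr : r ∈ RealRAM.singles mate p q) (h1 : (e r).j ≠ (e p).j) (h2 : (e r).j ≠ (e q).j) :
    ¬ ((e p).Under A b m (e r).j ↔ (e q).Under A b m (e r).j) := by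
  obtain ⟨K, T, C, -, hF⟩ := exists_far A b m k 0
  simp only [RealRAM.singles, Finset.mem_filter, Finset.mem_Icc] at hr
  obtain ⟨⟨hpr, hrq⟩, hm⟩ := hr
  have hrN : r < N := by omega
  have hpN : p < N := by omega
  have hmN := hp.lt r hrN
  have hcr : (e r).cell A b m k = (e q).cell A b m k :=
    cellCode_injective (hp.cell_eq hpr hrq hq (congrArg cellCode hc))
  have hcm : (e (mate r)).cell A b m k = (e r).cell A b m k :=
    cellCode_injective (hp.cell_mate r hrN)
  have hjm : (e (mate r)).j = (e r).j := hp.line_mate r hrN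
  have hjr := (he.valid r hrN).j
  have hS := End.supported hG hF ((e q).cell A b m k)
  have mem : ∀ i < N, (e i).cell A b m k = (e q).cell A b m k →
      e i ∈ {E : End | E.Valid m k ∧ E.cell A b m k = (e q).cell A b m k} :=
    fun i hi h => ⟨he.valid i hi, h⟩
  have hτ : (e (mate r)).τ ≠ (e r).τ := by
    intro h
    exact hp.ne r hrN (he.inj _ hmN _ hrN
      (End.eq_of_cell_eq hG (he.valid _ hmN) (he.valid _ hrN) hjm h hcm))
  have hx : (e (mate r)).px A b m K T ≠ (e r).px A b m K T := by
    rcases (he.valid r hrN).τ with h | h <;> rcases (he.valid _ hmN).τ with h' | h'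
    · omega
    · exact (End.px_lt hG hF (he.valid _ hrN) (he.valid _ hmN) hjm.symm h h' hcm.symm).ne'
    · exact (End.px_lt hG hF (he.valid _ hmN) (he.valid _ hrN) hjm h' h hcm).ne
    · omega
  -- The orientations of the triangles with the line as one side have opposite signs.
  have hprod : ((e p).py A b m K T - ln A b (e r).j ((e p).px A b m K T)) *
      ((e q).py A b m K T - ln A b (e r).j ((e q).px A b m K T)) ≤ 0 := by
    have o : ∀ z : End, orient (End.px A b m K T) (End.py A b m K T) (e (mate r)) (e r) z =
        ((e r).px A b m K T - (e (mate r)).px A b m K T) *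
          (z.py A b m K T - ln A b (e r).j (z.px A b m K T)) := fun z =>
      orient_line rfl rfl (by rw [End.py, hjm]) rfl
    have hop := o (e p)
    have hoq := o (e q)
    have hsq := sq_pos_of_ne_zero (sub_ne_zero.2 hx.symm)
    have hmul : orient (End.px A b m K T) (End.py A b m K T) (e (mate r)) (e r) (e p) *
        orient (End.px A b m K T) (End.py A b m K T) (e (mate r)) (e r) (e q) ≤ 0 := by
      by_cases hlt : mate r < p
      · have c1 := he.ccw_of_lt hG hF hlt.le hpN (by rw [hcm, hcr, hc])
        have c2 := he.ccw_of_lt hG hF hpr hrN (by rw [hc, hcr])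
        have c3 := he.ccw_of_lt hG hF hrq hq hcr
        have g1 := hS.orient_nonneg (mem _ hmN (hcm.trans hcr)) (mem _ hpN hc) (mem _ hrN hcr) c1 c2
        have g2 := hS.orient_nonneg (mem _ hmN (hcm.trans hcr)) (mem _ hrN hcr) (mem _ hq rfl)
          (c1.trans c2) c3
        refine mul_nonpos_of_nonpos_of_nonneg ?_ g2
        unfold orient at *
        linarith
      · have hgt : q < mate r := by omega
        have c1 := he.ccw_of_lt hG hF hpr hrN (by rw [hc, hcr])
        have c2 := he.ccw_of_lt hG hF hrq hq hcr
        have c3 := he.ccw_of_lt hG hF hgt.le hmN (by rw [hcm, hcr])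
        have g1 := hS.orient_nonneg (mem _ hpN hc) (mem _ hrN hcr) (mem _ hmN (hcm.trans hcr))
          c1 (c2.trans c3)
        have g2 := hS.orient_nonneg (mem _ hrN hcr) (mem _ hq rfl) (mem _ hmN (hcm.trans hcr))
          c2 c3
        refine mul_nonpos_of_nonpos_of_nonneg ?_ ?_ <;>
        · unfold orient at *
          linarith
    rw [hop, hoq] at hmul
    by_contra hcon
    have := mul_pos hsq (not_le.1 hcon)
    linarith
  have strict : ∀ i < N, (e r).j ≠ (e i).j →
      ((e i).Under A b m (e r).j → ln A b (e r).j ((e i).px A b m K T) < (e i).py A b m K T) ∧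
      (¬ (e i).Under A b m (e r).j → (e i).py A b m K T < ln A b (e r).j ((e i).px A b m K T)) := by
    intro i hi hne
    have hv := he.valid i hi
    have hji := hv.j
    have h3 := End.under_spec hG hF hv (l := (e r).j) (by omega) hne
    have h4 := End.passed_spec_strict hG hF hv (l := (e r).j) (by omega) hne (by omega)
    have h5 : (e i).py A b m K T ≠ ln A b (e r).j ((e i).px A b m K T) := by
      intro h
      have hA := hG.slope (e r).j (by omega) (e i).j (by omega) hne
      have h6 := ln_sub_ln (b := b) hA ((e i).px A b m K T)
      rw [← h, End.py, sub_self, eq_comm, mul_eq_zero] at h6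
      have h7 := h6.resolve_left (sub_ne_zero.2 hA)
      by_cases h8 : (e i).Passed A b m (e r).j
      · have := h4.1 h8; linarith
      · have := h4.2 h8; linarith
    exact ⟨fun h => lt_of_le_of_ne (h3.1 h) h5.symm, fun h => lt_of_le_of_ne (h3.2 h) h5⟩
  intro hiff
  have s1 := strict p hpN h1
  have s2 := strict q hq h2
  by_cases hu : (e p).Under A b m (e r).j
  · have := mul_pos (sub_pos.2 (s1.1 hu)) (sub_pos.2 (s2.1 (hiff.1 hu)))
    linarith
  · have := mul_pos (sub_pos.2 (s1.2 hu)) (sub_pos.2 (s2.2 fun h => hu (hiff.2 h)))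
    linarith

end Bowtie

/-! ### Segments that cross no red line -/

namespace Bowtie

open Filter Topology

/-- The height of the point `u` above the line number `l`. -/
def height (A b : ℕ → ℝ) (l : ℕ) (u : ℝ × ℝ) : ℝ := u.2 - ln A b l u.1

open Classical in
/-- The blue lines that meet the closed segment with end points `u` and `v`. -/
noncomputable def crossed (A b : ℕ → ℝ) (m : ℕ) (u v : ℝ × ℝ) : Finset ℕ :=
  (Finset.range m).filter fun l => height A b l u * height A b l v ≤ 0

variable {A b : ℕ → ℝ} {m k N : ℕ} {e : ℕ → End} {mate : ℕ → ℕ} {E E' : End}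

/-- Two points next to ends of the same cell are not separated by a red line. -/
theorem End.Inner.height_mul_nonneg (hG : GenPos A b (m + k)) {x y : ℝ}
    (hx : E.Inner A b m k x) (hy : E'.Inner A b m k y) (hj : E.j < m + k) (hj' : E'.j < m + k)
    (hc : E.cell A b m k = E'.cell A b m k) {i : ℕ} (hi : i < k) :
    0 ≤ height A b (m + i) (x, ln A b E.j x) * height A b (m + i) (y, ln A b E'.j y) := by
  unfold height
  by_cases h1 : m + i = E.j
  · simp [h1]
  by_cases h2 : m + i = E'.j
  · simp [h2]
  have s1 := hx.under hG hj (l := m + i) (by omega) h1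
  have s2 := hy.under hG hj' (l := m + i) (by omega) h2
  have hiff := Finset.ext_iff.1 hc i
  rw [End.mem_cell hi, End.mem_cell hi] at hiff
  by_cases hu : E.Under A b m (m + i)
  · exact (mul_pos (sub_pos.2 (s1.1 hu)) (sub_pos.2 (s2.1 (hiff.1 hu)))).le
  · exact (mul_pos_of_neg_of_neg (sub_neg.2 (s1.2 hu))
      (sub_neg.2 (s2.2 fun h => hu (hiff.2 h)))).le

/-- The lines of the single items between two ends of a cell meet the segment that joins two points
next to these ends. -/
theorem EndOrder.card_singles_le (hG : GenPos A b (m + k)) (he : EndOrder A b m k N e)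
    (hp : RealRAM.Paired N (fun r => cellCode ((e r).cell A b m k)) (fun r => (e r).j) mate)
    {p q : ℕ} (hpq : p ≤ q) (hq : q < N) (hc : (e p).cell A b m k = (e q).cell A b m k)
    {x y : ℝ} (hx : (e p).Inner A b m k x) (hy : (e q).Inner A b m k y) :
    (RealRAM.singles mate p q).card ≤
      (crossed A b m (x, ln A b (e p).j x) (y, ln A b (e q).j y)).card := by
  have hjp := (he.valid p (by omega)).j
  have hjq := (he.valid q hq).j
  refine Finset.card_le_card_of_injOn (fun r => (e r).j) (fun r hr => ?_) (fun r hr r' hr' h => ?_)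
  · have hr' := hr
    simp only [RealRAM.singles, Finset.coe_filter, Finset.mem_Icc, Set.mem_ofPred_eq] at hr'
    have hjr := (he.valid r (by omega)).j
    simp only [crossed, Finset.coe_filter, Finset.mem_range, Set.mem_ofPred_eq]
    refine ⟨hjr, ?_⟩
    unfold height
    by_cases h1 : (e r).j = (e p).j
    · simp [h1]
    by_cases h2 : (e r).j = (e q).j
    · simp [h2]
    have h3 := he.separated hG hp hq hc hr h1 h2
    have s1 := hx.under hG (by omega) (l := (e r).j) (by omega) h1
    have s2 := hy.under hG (by omega) (l := (e r).j) (by omega) h2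
    by_cases hu : (e p).Under A b m (e r).j
    · exact (mul_neg_of_pos_of_neg (sub_pos.2 (s1.1 hu))
        (sub_neg.2 (s2.2 fun h => h3 ⟨fun _ => h, fun _ => hu⟩))).le
    · have hu' : (e q).Under A b m (e r).j := by
        by_contra hcon
        exact h3 ⟨fun h => absurd h hu, fun h => absurd h hcon⟩
      exact (mul_neg_of_neg_of_pos (sub_neg.2 (s1.2 hu)) (sub_pos.2 (s2.1 hu'))).le
  · simp only [RealRAM.singles, Finset.coe_filter, Finset.mem_Icc, Set.mem_ofPred_eq] at hr hr'
    have c1 := hp.cell_eq hr.1.1 hr.1.2 hq (congrArg cellCode hc)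
    have c2 := hp.cell_eq hr'.1.1 hr'.1.2 hq (congrArg cellCode hc)
    rcases hp.eq_or r (by omega) r' (by omega) h (c1.trans c2.symm) with h' | h'
    · exact h'.symm
    · rw [h'] at hr'
      exact absurd hr'.1 hr.2

/-- As at most two lines pass through a point, it can be moved with prescribed speeds away from
them. -/
theorem GenPos.exists_dir {M : ℕ} (hG : GenPos A b M) (u : ℝ × ℝ) (t : ℕ → ℝ) :
    ∃ d : ℝ × ℝ, ∀ l < M, height A b l u = 0 → d.2 - A l * d.1 = t l := by
  unfold height
  by_cases h1 : ∃ i < M, u.2 - ln A b i u.1 = 0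
  · obtain ⟨i, hi, hiu⟩ := h1
    by_cases h2 : ∃ j < M, i ≠ j ∧ u.2 - ln A b j u.1 = 0
    · obtain ⟨j, hj, hij, hju⟩ := h2
      have hA := sub_ne_zero.2 (hG.slope i hi j hj hij).symm
      refine ⟨((t i - t j) / (A j - A i), t i + A i * ((t i - t j) / (A j - A i))), ?_⟩
      intro l hl hlu
      by_cases hil : i = l
      · subst hil; ring
      by_cases hjl : j = l
      · subst hjl; field_simp; ring
      exact absurd (by linarith) (hG.triple i hi j hj l hl hij hjl hil u.1 (by linarith))
    · refine ⟨(0, t i), fun l hl hlu => ?_⟩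
      have : i = l := by
        by_contra hne
        exact h2 ⟨l, hl, hne, hlu⟩
      simp [this]
  · exact ⟨0, fun l hl hlu => absurd ⟨l, hl, hlu⟩ h1⟩

/-- The sign of the height of a point that is moved a little. -/
theorem eventually_height {l : ℕ} {u d : ℝ × ℝ} {t : ℝ} (ht : t ≠ 0)
    (hd : height A b l u = 0 → d.2 - A l * d.1 = t) :
    ∀ᶠ ε in 𝓝[>] (0 : ℝ),
      0 < height A b l (u + ε • d) * (if height A b l u = 0 then t else height A b l u) := by
  have e : ∀ ε : ℝ, height A b l (u + ε • d) = height A b l u + ε * (d.2 - A l * d.1) := by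
    intro ε
    simp only [height, ln, Prod.fst_add, Prod.snd_add, Prod.smul_fst, Prod.smul_snd, smul_eq_mul]
    ring
  split_ifs with h
  · filter_upwards [self_mem_nhdsWithin] with ε hε
    rw [e, h, hd h, zero_add, mul_assoc]
    exact mul_pos hε (mul_self_pos.2 ht)
  · have hcont : Continuous fun ε : ℝ => height A b l (u + ε • d) * height A b l u := by
      simp only [e]; fun_prop
    refine nhdsWithin_le_nhds (hcont.continuousAt.eventually_const_lt ?_)
    simpa using mul_self_pos.2 h

/-- Two points can be moved a little so that no line passes through them, with prescribed relative
position to the lines that pass through one of them. -/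
theorem GenPos.exists_strict {M : ℕ} (hG : GenPos A b M) {u v : ℝ × ℝ} (huv : u.1 < v.1)
    {σ : ℕ → ℝ} (hσ : ∀ l < M, σ l * σ l = 1)
    (h : ∀ l < M, 0 ≤ σ l * (height A b l u * height A b l v)) :
    ∃ u' v' : ℝ × ℝ, u'.1 < v'.1 ∧
      ∀ l < M, 0 < σ l * (height A b l u' * height A b l v') := by
  have hσ0 : ∀ l < M, σ l ≠ 0 := fun l hl h0 => by simpa [h0] using hσ l hl
  obtain ⟨d, hd⟩ := hG.exists_dir u
    fun l => if height A b l v = 0 then 1 else σ l * height A b l v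
  obtain ⟨d', hd'⟩ := hG.exists_dir v
    fun l => if height A b l u = 0 then σ l else σ l * height A b l u
  have h1 : ∀ l ∈ Finset.range M, ∀ᶠ ε in 𝓝[>] (0 : ℝ),
      0 < σ l * (height A b l (u + ε • d) * height A b l (v + ε • d')) := by
    intro l hl
    rw [Finset.mem_range] at hl
    have h0 := hσ0 l hl
    filter_upwards [eventually_height (b := b) (u := u)
        (t := if height A b l v = 0 then 1 else σ l * height A b l v) (by
          split_ifs with h2
          · exact one_ne_zero
          · exact mul_ne_zero h0 h2) (hd l hl),
      eventually_height (b := b) (u := v)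
        (t := if height A b l u = 0 then σ l else σ l * height A b l u) (by
          split_ifs with h2
          · exact h0
          · exact mul_ne_zero h0 h2) (hd' l hl)] with ε g1 g2
    have g3 := mul_pos g1 g2
    set X := height A b l (u + ε • d)
    set Y := height A b l (v + ε • d')
    set p := height A b l u
    set q := height A b l v
    have hs := hσ l hl
    have hpos : ∀ w : ℝ, 0 < σ l * (X * Y) * w → 0 ≤ w → 0 < σ l * (X * Y) := fun w h1 h2 =>
      lt_of_mul_lt_mul_right (by rwa [zero_mul]) h2
    by_cases hp : p = 0 <;> by_cases hq : q = 0 <;> simp only [hp, hq, if_true, if_false] at g3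
    · linarith
    · refine hpos (q * q) ?_ (mul_self_nonneg q)
      linarith
    · refine hpos (p * p) ?_ (mul_self_nonneg p)
      linarith
    · have h2 : 0 < σ l * (p * q) :=
        lt_of_le_of_ne (h l hl) (mul_ne_zero h0 (mul_ne_zero hp hq)).symm
      refine hpos (σ l * (p * q)) ?_ h2.le
      have : σ l * (X * Y) * (σ l * (p * q)) = (σ l * σ l) * (X * p * (Y * q)) := by ring
      rw [this, hs, one_mul]
      exact g3
  have h2 : ∀ᶠ ε in 𝓝[>] (0 : ℝ), (u + ε • d).1 < (v + ε • d').1 := by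
    have hc : ContinuousAt (fun ε : ℝ => (v + ε • d').1 - (u + ε • d).1) 0 := by
      simp only [Prod.fst_add, Prod.smul_fst, smul_eq_mul]
      fun_prop
    filter_upwards [nhdsWithin_le_nhds (hc.eventually_const_lt (u := 0) (by simpa using huv))]
      with ε hε
    linarith
  obtain ⟨ε, h3, h4⟩ := (((eventually_all_finset _).2 h1).and h2).exists
  exact ⟨_, _, h4, fun l hl => h3 l (Finset.mem_range.2 hl)⟩

/-- A segment that crosses no red line crosses at most as many blue lines as there are single items
in some interval of ends of a cell. The interval consists of the ends of the cell of the segment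
that lie on one side of the line through the segment. -/
theorem EndOrder.card_crossed_le (hG : GenPos A b (m + k)) (he : EndOrder A b m k N e)
    (hp : RealRAM.Paired N (fun r => cellCode ((e r).cell A b m k)) (fun r => (e r).j) mate)
    {u v : ℝ × ℝ} (huv : u.1 < v.1)
    (hred : ∀ i < k, 0 ≤ height A b (m + i) u * height A b (m + i) v) :
    crossed A b m u v = ∅ ∨ ∃ p q, p ≤ q ∧ q < N ∧ (e p).cell A b m k = (e q).cell A b m k ∧
      (crossed A b m u v).card ≤ (RealRAM.singles mate p q).card := by
  classical
  -- Move the two points so that no line passes through them.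
  obtain ⟨u', v', huv', hσ⟩ := hG.exists_strict huv
    (σ := fun l => if l < m ∧ height A b l u * height A b l v ≤ 0 then -1 else 1)
    (fun l _ => by split_ifs <;> norm_num) (fun l hl => by
      split_ifs with h
      · linarith
      · by_cases hlm : l < m
        · linarith [not_le.1 fun h' => h ⟨hlm, h'⟩]
        · have := hred (l - m) (by omega)
          rw [Nat.add_sub_cancel' (not_lt.1 hlm)] at this
          linarith)
  have hred' : ∀ i < k, 0 < height A b (m + i) u' * height A b (m + i) v' := by
    intro i hi
    have := hσ (m + i) (by omega)
    rwa [if_neg (by omega), one_mul] at this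
  have hblue' : ∀ l ∈ crossed A b m u v, l < m ∧ height A b l u' * height A b l v' < 0 := by
    intro l hl
    simp only [crossed, Finset.mem_filter, Finset.mem_range] at hl
    have := hσ l (by omega)
    rw [if_pos hl] at this
    exact ⟨hl.1, by linarith⟩
  clear hσ
  obtain ⟨K, T, C, hC, hF⟩ := exists_far A b m k (|u'.1| + |v'.1|)
  have hu1 := abs_le.1 (show |u'.1| ≤ C by linarith [abs_nonneg v'.1])
  have hv1 := abs_le.1 (show |v'.1| ≤ C by linarith [abs_nonneg u'.1])
  -- Shift the line through the two points so that it avoids all ends.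
  obtain ⟨α, β, hα, hβu, hβv⟩ : ∃ α β : ℝ,
      (∀ r < N, (e r).py A b m K T - (α * (e r).px A b m K T + β) ≠ 0) ∧
      (∀ i < k, 0 < (α * u'.1 + β - ln A b (m + i) u'.1) * (α * v'.1 + β - ln A b (m + i) v'.1)) ∧
      (∀ l ∈ crossed A b m u v,
        (α * u'.1 + β - ln A b l u'.1) * (α * v'.1 + β - ln A b l v'.1) < 0) := by
    set α := (v'.2 - u'.2) / (v'.1 - u'.1) with hα
    set β := u'.2 - α * u'.1 with hβ
    have e1 : α * u'.1 + β = u'.2 := by rw [hβ]; ring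
    have e2 : α * v'.1 + β = v'.2 := by
      have : v'.1 - u'.1 ≠ 0 := (sub_pos.2 huv').ne'
      rw [hβ, hα]; field_simp; ring
    have c : ∀ l, Continuous fun δ : ℝ =>
        (α * u'.1 + (β + δ) - ln A b l u'.1) * (α * v'.1 + (β + δ) - ln A b l v'.1) :=
      fun l => by fun_prop
    have h1 : ∀ᶠ δ in 𝓝[>] (0 : ℝ), ∀ i ∈ Finset.range k,
        0 < (α * u'.1 + (β + δ) - ln A b (m + i) u'.1) *
          (α * v'.1 + (β + δ) - ln A b (m + i) v'.1) := by
      refine (eventually_all_finset _).2 fun i hi => nhdsWithin_le_nhds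
        ((c (m + i)).continuousAt.eventually_const_lt ?_)
      beta_reduce
      rw [add_zero, e1, e2]
      exact hred' i (Finset.mem_range.1 hi)
    have h2 : ∀ᶠ δ in 𝓝[>] (0 : ℝ), ∀ l ∈ crossed A b m u v,
        (α * u'.1 + (β + δ) - ln A b l u'.1) * (α * v'.1 + (β + δ) - ln A b l v'.1) < 0 := by
      refine (eventually_all_finset _).2 fun l hl => nhdsWithin_le_nhds
        ((c l).continuousAt.eventually_lt_const ?_)
      beta_reduce
      rw [add_zero, e1, e2]
      exact (hblue' l hl).2
    have h3 : ∀ᶠ δ in 𝓝[>] (0 : ℝ), ∀ r ∈ Finset.range N,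
        (e r).py A b m K T - (α * (e r).px A b m K T + (β + δ)) ≠ 0 := by
      refine (eventually_all_finset _).2 fun r _ => ?_
      rcases le_or_gt ((e r).py A b m K T - (α * (e r).px A b m K T + β)) 0 with h | h
      · filter_upwards [self_mem_nhdsWithin] with δ hδ
        have := Set.mem_Ioi.1 hδ
        intro h0
        linarith
      · filter_upwards [nhdsWithin_le_nhds (eventually_lt_nhds h)] with δ hδ
        intro h0
        linarith
    obtain ⟨δ, g1, g2, g3⟩ := (h1.and (h2.and h3)).exists
    exact ⟨α, β + δ, fun r hr => g3 r (Finset.mem_range.2 hr),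
      fun i hi => g1 i (Finset.mem_range.2 hi), g2⟩
  -- The cell of the segment contains both ends of every crossed line, on different sides.
  set S := (Finset.range k).filter fun i => ln A b (m + i) u'.1 < α * u'.1 + β with hS
  set g : ℕ → ℝ := fun r => (e r).py A b m K T - (α * (e r).px A b m K T + β) with hg
  have ends : ∀ l ∈ crossed A b m u v, ∃ r < N, ∃ r' < N, (e r).j = l ∧ (e r').j = l ∧
      (e r).cell A b m k = S ∧ (e r').cell A b m k = S ∧ g r * g r' < 0 := by
    intro l hl
    have hlm := (hblue' l hl).1
    have hneg := hβv l hl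
    have hAl : α - A l ≠ 0 := by
      intro h0
      have e1 : α * v'.1 + β - ln A b l v'.1 = α * u'.1 + β - ln A b l u'.1 := by
        unfold ln; linear_combination (v'.1 - u'.1) * h0
      rw [e1] at hneg
      exact absurd hneg (not_lt.2 (mul_self_nonneg _))
    -- The line meets the segment at the abscissa `z`.
    set z := (b l - β) / (α - A l) with hz
    have hφ : ∀ x, α * x + β - ln A b l x = (α - A l) * (x - z) := by
      intro x; rw [hz]; unfold ln; field_simp; ring
    have hzl : ln A b l z = α * z + β := by
      linarith [hφ z, mul_eq_zero_of_right (α - A l) (sub_self z)]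
    rw [hφ, hφ] at hneg
    have hneg' : (u'.1 - z) * (v'.1 - z) < 0 := by
      by_contra hcon
      have := mul_nonneg (mul_self_nonneg (α - A l)) (not_lt.1 hcon)
      linarith
    have hz1 : u'.1 < z ∧ z < v'.1 := by
      rcases mul_neg_iff.1 hneg' with h | h <;> constructor <;> linarith
    have hψ : ∀ i < k, (i ∈ S → ln A b (m + i) z < ln A b l z) ∧
        (i ∉ S → ln A b l z < ln A b (m + i) z) := by
      intro i hi
      have e1 : (α * z + β - ln A b (m + i) z) * (v'.1 - u'.1) =
          (α * u'.1 + β - ln A b (m + i) u'.1) * (v'.1 - z) +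
          (α * v'.1 + β - ln A b (m + i) v'.1) * (z - u'.1) := by
        unfold ln; ring
      have hpos := hβu i hi
      rw [hzl]
      simp only [hS, Finset.mem_filter, Finset.mem_range, hi, true_and, not_lt]
      refine ⟨fun h => ?_, fun h => ?_⟩
      · have h1 := sub_pos.2 h
        have h2 := (pos_iff_pos_of_mul_pos hpos).1 h1
        have h3 := mul_pos h1 (sub_pos.2 hz1.2)
        have h4 := mul_pos h2 (sub_pos.2 hz1.1)
        by_contra hcon
        have := mul_nonpos_of_nonpos_of_nonneg (sub_nonpos.2 (not_lt.1 hcon))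
          (sub_pos.2 huv').le
        linarith
      · have h1 : α * u'.1 + β - ln A b (m + i) u'.1 < 0 :=
          lt_of_le_of_ne (sub_nonpos.2 h) fun h0 => by simp [h0] at hpos
        have h2 := (neg_iff_neg_of_mul_pos hpos).1 h1
        have h3 := mul_neg_of_neg_of_pos h1 (sub_pos.2 hz1.2)
        have h4 := mul_neg_of_neg_of_pos h2 (sub_pos.2 hz1.1)
        by_contra hcon
        have := mul_nonneg (sub_nonneg.2 (not_lt.1 hcon)) (sub_pos.2 huv').le
        linarith
    have hcr : ∀ i < k, cross A b (m + i) l ≠ z := by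
      intro i hi h0
      have h1 := ln_sub_ln (b := b) (hG.slope (m + i) (by omega) l (by omega) (by omega)) z
      rw [h0, sub_self, mul_zero] at h1
      by_cases h2 : i ∈ S
      · have := (hψ i hi).1 h2; linarith
      · have := (hψ i hi).2 h2; linarith
    have hcell : ∀ E : End, E.j = l →
        (∀ i < k, E.Passed A b m (m + i) ↔ cross A b (m + i) l < z) → E.cell A b m k = S := by
      intro E hE hpass
      ext i
      by_cases hi : i < k
      · rw [End.mem_cell hi]
        have h1 := End.under_spec_inner (E := E) (b := b)
          (hE ▸ hG.slope (m + i) (by omega) l (by omega) (by omega)) (hE ▸ hcr i hi)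
          (hE ▸ hpass i hi)
        rw [hE] at h1
        constructor
        · intro h2
          by_contra h3
          exact lt_asymm (h1.1 h2) ((hψ i hi).2 h3)
        · intro h2
          by_contra h3
          exact lt_asymm (h1.2 h3) ((hψ i hi).1 h2)
      · simp [End.cell, hS, hi]
    obtain ⟨E, hE, hEj, hEτ, hEp, hEx, -⟩ := exists_end hlm hcr 0 (.inl rfl)
    obtain ⟨E', hE', hEj', hEτ', hEp', -, hEx'⟩ := exists_end hlm hcr 1 (.inr rfl)
    have hx : E.px A b m K T < z := by
      by_cases h0 : E.o = 0
      · linarith [End.px_west hF hE h0 hEτ]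
      · rw [End.px_red h0]; exact hEx h0 rfl
    have hx' : z < E'.px A b m K T := by
      by_cases h0 : E'.o = 0
      · linarith [End.px_east hF hE' h0 hEτ']
      · rw [End.px_red h0]; exact hEx' h0 rfl
    obtain ⟨r, hr, rfl⟩ := he.surj E hE
    obtain ⟨r', hr', rfl⟩ := he.surj E' hE'
    refine ⟨r, hr, r', hr', hEj, hEj', hcell _ hEj hEp, hcell _ hEj' hEp', ?_⟩
    have h1 := hφ ((e r).px A b m K T)
    have h2 := hφ ((e r').px A b m K T)
    simp only [hg, End.py, hEj, hEj']
    have h3 := mul_pos (mul_self_pos.2 hAl) (mul_pos (sub_pos.2 hx) (sub_pos.2 hx'))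
    have h4 : (ln A b l ((e r).px A b m K T) - (α * (e r).px A b m K T + β)) *
        (ln A b l ((e r').px A b m K T) - (α * (e r').px A b m K T + β)) =
        ((α - A l) * ((e r).px A b m K T - z)) * ((α - A l) * ((e r').px A b m K T - z)) := by
      rw [← h1, ← h2]; ring
    rw [h4]
    linarith
  rcases Finset.eq_empty_or_nonempty (crossed A b m u v) with h0 | ⟨l₀, hl₀⟩
  · exact .inl h0
  right
  obtain ⟨r₀, hr₀, r₁, hr₁, -, -, hc₀, hc₁, hg₀⟩ := ends l₀ hl₀
  -- The ends of the cell that lie on the other side than the first one form an interval.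
  have hPne : ((Finset.range N).filter fun r => (e r).cell A b m k = S).Nonempty :=
    ⟨r₀, by simp [hr₀, hc₀]⟩
  obtain ⟨p₀, hp₀, hmin₀⟩ := Finset.exists_min_image _ id hPne
  simp only [Finset.mem_filter, Finset.mem_range, id] at hp₀ hmin₀
  have hside : ∀ r r', g r * g r' < 0 → (g r * g p₀ < 0 ↔ ¬ g r' * g p₀ < 0) := by
    intro r r' h
    have hne := hα p₀ hp₀.1
    have hsq := mul_self_pos.2 hne
    have hprod : (g r * g p₀) * (g r' * g p₀) < 0 := by
      have : (g r * g p₀) * (g r' * g p₀) = (g r * g r') * (g p₀ * g p₀) := by ring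
      rw [this]
      exact mul_neg_of_neg_of_pos h hsq
    rcases mul_neg_iff.1 hprod with h1 | h1
    · simp [h1.2, h1.1.le]
    · simp [h1.1, h1.2.le]
  have hQne :
      ((Finset.range N).filter fun r => (e r).cell A b m k = S ∧ g r * g p₀ < 0).Nonempty := by
    by_cases h : g r₀ * g p₀ < 0
    · exact ⟨r₀, by simp [hr₀, hc₀, h]⟩
    · have : g r₁ * g p₀ < 0 := by
        by_contra h'
        exact h ((hside r₀ r₁ hg₀).2 h')
      exact ⟨r₁, by simp [hr₁, hc₁, this]⟩
  obtain ⟨p, hpQ, hpmin⟩ := Finset.exists_min_image _ id hQne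
  obtain ⟨q, hqQ, hqmax⟩ := Finset.exists_max_image _ id hQne
  simp only [Finset.mem_filter, Finset.mem_range, id] at hpQ hqQ hpmin hqmax
  have hpq : p ≤ q := hpmin q hqQ
  have hsup := End.supported hG hF S
  have between : ∀ r, p ≤ r → r ≤ q → g r * g p₀ < 0 := by
    intro r h1 h2
    have hrN : r < N := by omega
    have hcS : (e r).cell A b m k = S := by
      rw [← hqQ.2.1]
      exact cellCode_injective
        (hp.cell_eq h1 h2 hqQ.1 (congrArg cellCode (hpQ.2.1.trans hqQ.2.1.symm)))
    by_contra hcon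
    have hpos : 0 < g r * g p₀ :=
      lt_of_le_of_ne (not_lt.1 hcon) (mul_ne_zero (hα r hrN) (hα p₀ hp₀.1)).symm
    have hp0p : p₀ ≤ p := hmin₀ p ⟨hpQ.1, hpQ.2.1⟩
    have val : ∀ i, -α * g p₀ * (e i).px A b m K T + g p₀ * (e i).py A b m K T + -(β * g p₀) =
        g i * g p₀ := by
      intro i; simp only [hg]; ring
    -- Otherwise the line separates the ends `p₀, p, r, q` alternately.
    refine hsup.not_alternating ⟨he.valid p₀ hp₀.1, hp₀.2⟩ ⟨he.valid p hpQ.1, hpQ.2.1⟩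
      ⟨he.valid r hrN, hcS⟩ ⟨he.valid q hqQ.1, hqQ.2.1⟩
      (he.ccw_of_lt hG hF hp0p hpQ.1 (hp₀.2.trans hpQ.2.1.symm))
      (he.ccw_of_lt hG hF h1 hrN (hpQ.2.1.trans hcS.symm))
      (he.ccw_of_lt hG hF h2 hqQ.1 (hcS.trans hqQ.2.1.symm))
      (-α * g p₀) (g p₀) (-(β * g p₀)) ?_ ?_ ?_ ?_
    · rw [val]; exact mul_self_pos.2 (hα p₀ hp₀.1)
    · rw [val]; exact hpQ.2.2
    · rw [val]; exact hpos
    · rw [val]; exact hqQ.2.2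
  refine ⟨p, q, hpq, hqQ.1, hpQ.2.1.trans hqQ.2.1.symm, ?_⟩
  -- Every crossed line has exactly one end in this interval.
  refine Finset.card_le_card_of_surjOn (fun r => (e r).j) fun l hl => ?_
  obtain ⟨r, hr, r', hr', hj, hj', hc, hc', hgg⟩ := ends l hl
  have single : ∀ r < N, ∀ r' < N, (e r).j = l → (e r').j = l → (e r).cell A b m k = S →
      (e r').cell A b m k = S → g r * g r' < 0 → g r * g p₀ < 0 →
      l ∈ (fun r => (e r).j) '' (RealRAM.singles mate p q : Set ℕ) := by
    intro r hr r' hr' hj hj' hc hc' hgg hin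
    refine ⟨r, ?_, hj⟩
    simp only [RealRAM.singles, Finset.coe_filter, Finset.mem_Icc, Set.mem_ofPred_eq]
    refine ⟨⟨hpmin r ⟨hr, hc, hin⟩, hqmax r ⟨hr, hc, hin⟩⟩, fun hm => ?_⟩
    have hmate : r' = mate r := by
      rcases hp.eq_or r hr r' hr' (hj.trans hj'.symm) (congrArg cellCode (hc.trans hc'.symm)) with
        h | h
      · rw [h] at hgg
        exact absurd hgg (not_lt.2 (mul_self_nonneg _))
      · exact h
    rw [← hmate] at hm
    exact (hside r r' hgg).1 hin (between r' hm.1 hm.2)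
  by_cases hin : g r * g p₀ < 0
  · exact single r hr r' hr' hj hj' hc hc' hgg hin
  · refine single r' hr' r hr hj' hj hc' hc (by rwa [mul_comm]) ?_
    by_contra h
    exact hin ((hside r r' hgg).2 h)

end Bowtie

/-! ### Duality between points and lines -/

namespace Bowtie

/-- The position of a point relative to a line: positive above, negative below. -/
def Line.gap (ℓ : Line) (p : ℝ × ℝ) : ℝ := p.2 - (ℓ.slope * p.1 + ℓ.intercept)

theorem region_eq (ℓ₁ ℓ₂ : Line) : region ℓ₁ ℓ₂ = {p | ℓ₁.gap p * ℓ₂.gap p ≤ 0} := by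
  ext p
  simp only [region, west, east, Line.above, Line.below, Line.gap, Set.mem_union, Set.mem_inter_iff,
    Set.mem_ofPred_eq, mul_nonpos_iff, sub_nonneg, sub_nonpos]
  tauto

theorem Line.continuous_gap (ℓ : Line) : Continuous ℓ.gap := by
  unfold Line.gap; fun_prop

theorem interior_compl_region (ℓ₁ ℓ₂ : Line) :
    interior (region ℓ₁ ℓ₂)ᶜ = {p | 0 < ℓ₁.gap p * ℓ₂.gap p} := by
  have e : (region ℓ₁ ℓ₂)ᶜ = {p | 0 < ℓ₁.gap p * ℓ₂.gap p} := by
    ext p; simp [region_eq]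
  rw [e]
  exact (isOpen_lt continuous_const (ℓ₁.continuous_gap.mul ℓ₂.continuous_gap)).interior_eq

theorem interior_region (ℓ₁ ℓ₂ : Line) :
    interior (region ℓ₁ ℓ₂) = {p | ℓ₁.gap p * ℓ₂.gap p < 0} := by
  have key : ∀ ℓ ℓ' : Line, ∀ p ∈ interior {p | ℓ.gap p * ℓ'.gap p ≤ 0}, ℓ.gap p ≠ 0 := by
    intro ℓ ℓ' p hp h0
    -- Moved vertically to the right side, a point of `ℓ` leaves the region.
    obtain ⟨s, hs, hs'⟩ : ∃ s : ℝ, s ≠ 0 ∧ 0 ≤ s * ℓ'.gap p := by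
      by_cases h : ℓ'.gap p = 0
      · exact ⟨1, one_ne_zero, by simp [h]⟩
      · exact ⟨ℓ'.gap p, h, mul_self_nonneg _⟩
    have hc : Continuous fun ε : ℝ => p + ε • ((0 : ℝ), s) := by fun_prop
    have h1 : ∀ᶠ ε in nhds (0 : ℝ), p + ε • ((0 : ℝ), s) ∈ {p | ℓ.gap p * ℓ'.gap p ≤ 0} := by
      refine hc.continuousAt.eventually_mem (f := fun ε : ℝ => p + ε • ((0 : ℝ), s)) ?_
      simpa using mem_interior_iff_mem_nhds.1 hp
    obtain ⟨ε, h2, h3⟩ := ((h1.filter_mono nhdsWithin_le_nhds).and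
      (self_mem_nhdsWithin (s := Set.Ioi (0 : ℝ)))).exists
    have e : ∀ ℓ : Line, ℓ.gap (p + ε • ((0 : ℝ), s)) = ℓ.gap p + ε * s := by
      intro ℓ
      simp [Line.gap]
      ring
    rw [Set.mem_ofPred_eq, e, e, h0] at h2
    have h4 := mul_pos (mul_pos (Set.mem_Ioi.1 h3) (Set.mem_Ioi.1 h3)) (mul_self_pos.2 hs)
    have h5 := mul_nonneg (Set.mem_Ioi.1 h3).le hs'
    linarith
  apply Set.Subset.antisymm
  · intro p hp
    rw [region_eq] at hp
    have h1 := key ℓ₁ ℓ₂ p hp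
    have h2 := key ℓ₂ ℓ₁ p (by simpa only [mul_comm] using hp)
    have h3 := interior_subset hp
    rw [Set.mem_ofPred_eq] at h3 ⊢
    exact lt_of_le_of_ne h3 (mul_ne_zero h1 h2)
  · refine interior_maximal (fun p hp => ?_)
      (isOpen_lt (ℓ₁.continuous_gap.mul ℓ₂.continuous_gap) continuous_const)
    rw [Set.mem_ofPred_eq] at hp
    rw [region_eq, Set.mem_ofPred_eq]
    exact hp.le

/-- The dual point of a line. -/
def Line.dual (ℓ : Line) : ℝ × ℝ := (ℓ.slope, ℓ.intercept)

section
variable {m k : ℕ} (b : Fin m → ℝ × ℝ) (r : Fin k → ℝ × ℝ)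

/-- The slopes of the dual lines of the points: first the blue points, then the red points. -/
noncomputable def dualSlope (l : ℕ) : ℝ :=
  if l < m then 0 - toArray (fun i => (b i).1) l else 0 - toArray (fun i => (r i).1) (l - m)

/-- The intercepts of the dual lines of the points. -/
noncomputable def dualIntercept (l : ℕ) : ℝ :=
  if l < m then toArray (fun i => (b i).2) l else toArray (fun i => (r i).2) (l - m)
end

variable {m k : ℕ} {b : Fin m → ℝ × ℝ} {r : Fin k → ℝ × ℝ}

/-- The dual lines come from points. -/
theorem exists_index (b : Fin m → ℝ × ℝ) (r : Fin k → ℝ × ℝ) : ∃ f : ℕ → Fin m ⊕ Fin k → Prop,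
    (∀ l < m + k, ∃ i, f l i ∧ dualSlope b r l = 0 - (Sum.elim b r i).1 ∧
      dualIntercept b r l = (Sum.elim b r i).2) ∧
    ∀ l l' i, f l i → f l' i → l = l' := by
  refine ⟨fun l i => l = Sum.elim (fun i : Fin m => (i : ℕ)) (fun i : Fin k => m + (i : ℕ)) i,
    fun l hl => ?_,
    fun l l' i h h' => h.trans h'.symm⟩
  by_cases h : l < m
  · exact ⟨.inl ⟨l, h⟩, rfl, by simp [dualSlope, toArray, h], by simp [dualIntercept, toArray, h]⟩
  · have h1 : l - m < k := by omega
    exact ⟨.inr ⟨l - m, h1⟩, by simp; omega, by simp [dualSlope, toArray, h, h1],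
      by simp [dualIntercept, toArray, h, h1]⟩

theorem genPos_dual (h : GeneralPosition (Sum.elim b r)) :
    GenPos (dualSlope b r) (dualIntercept b r) (m + k) := by
  obtain ⟨f, hf, hinj⟩ := exists_index b r
  obtain ⟨h1, -, h3⟩ := h
  constructor
  · intro i hi j hj hij heq
    obtain ⟨i', hi1, hi2, -⟩ := hf i hi
    obtain ⟨j', hj1, hj2, -⟩ := hf j hj
    have : i' = j' := h1 (by simp only; linarith)
    exact hij (hinj _ _ _ hi1 (this ▸ hj1))
  · intro i hi j hj l hl hij hjl hil x e1 e2
    obtain ⟨i', hi1, hi2, hi3⟩ := hf i hi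
    obtain ⟨j', hj1, hj2, hj3⟩ := hf j hj
    obtain ⟨l', hl1, hl2, hl3⟩ := hf l hl
    refine h3 i' j' l' (fun h => hij (hinj _ _ _ hi1 (h ▸ hj1)))
      (fun h => hjl (hinj _ _ _ hj1 (h ▸ hl1))) (fun h => hil (hinj _ _ _ hi1 (h ▸ hl1))) ?_
    rw [collinear_iff_exists_forall_eq_smul_vadd]
    refine ⟨(0, ln (dualSlope b r) (dualIntercept b r) i x), (1, x), ?_⟩
    have key : ∀ l l', dualSlope b r l = 0 - (Sum.elim b r l').1 →
        dualIntercept b r l = (Sum.elim b r l').2 →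
        ln (dualSlope b r) (dualIntercept b r) i x = ln (dualSlope b r) (dualIntercept b r) l x →
        ∃ t : ℝ, Sum.elim b r l' =
          t • ((1 : ℝ), x) +ᵥ ((0 : ℝ), ln (dualSlope b r) (dualIntercept b r) i x) := by
      intro l l' g1 g2 g3
      refine ⟨(Sum.elim b r l').1, Prod.ext (by simp) ?_⟩
      rw [g3]
      simp [ln, g1, g2]
    simp only [Set.mem_insert_iff, Set.mem_singleton_iff, forall_eq_or_imp, forall_eq]
    exact ⟨key i i' hi2 hi3 rfl, key j j' hj2 hj3 e1, key l l' hl2 hl3 e2⟩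

theorem height_blue (ℓ : Line) (i : Fin m) :
    height (dualSlope b r) (dualIntercept b r) i ℓ.dual = -ℓ.gap (b i) := by
  simp [height, ln, Line.dual, Line.gap, dualSlope, dualIntercept, toArray]
  ring

theorem height_red (ℓ : Line) (i : Fin k) :
    height (dualSlope b r) (dualIntercept b r) (m + i) ℓ.dual = -ℓ.gap (r i) := by
  simp [height, ln, Line.dual, Line.gap, dualSlope, dualIntercept, toArray]
  ring

theorem isFeasible_iff {ℓ₁ ℓ₂ : Line} : IsFeasible (Set.range r) ℓ₁ ℓ₂ ↔
    ℓ₁.slope < ℓ₂.slope ∧ ∀ i < k,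
      0 ≤ height (dualSlope b r) (dualIntercept b r) (m + i) ℓ₁.dual *
        height (dualSlope b r) (dualIntercept b r) (m + i) ℓ₂.dual := by
  unfold IsFeasible redOutliers
  refine and_congr_right fun _ => ?_
  rw [interior_region, Set.eq_empty_iff_forall_notMem]
  constructor
  · intro h i hi
    have h1 := h (r ⟨i, hi⟩)
    have e := fun ℓ => height_red (b := b) (r := r) ℓ ⟨i, hi⟩
    simp only at e
    rw [e, e, neg_mul_neg]
    by_contra hcon
    exact h1 ⟨⟨_, rfl⟩, not_le.1 hcon⟩
  · rintro h - ⟨⟨i, rfl⟩, h1⟩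
    have h2 := h i i.2
    rw [height_red, height_red, neg_mul_neg] at h2
    exact absurd h1 (not_lt.2 h2)

/-- The blue points that are no outliers are dual to the blue lines that meet the segment between
the dual points of the two lines. -/
theorem ncard_blueOutliers (hb : Function.Injective b) (r : Fin k → ℝ × ℝ) (ℓ₁ ℓ₂ : Line) :
    (blueOutliers (Set.range b) ℓ₁ ℓ₂).ncard +
      (crossed (dualSlope b r) (dualIntercept b r) m ℓ₁.dual ℓ₂.dual).card = m := by
  classical
  have h1 : blueOutliers (Set.range b) ℓ₁ ℓ₂ =
      b '' ((Finset.univ.filter fun i => 0 < ℓ₁.gap (b i) * ℓ₂.gap (b i) : Finset (Fin m)) :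
        Set (Fin m)) := by
    ext p
    simp only [blueOutliers, interior_compl_region, Set.mem_inter_iff, Set.mem_range,
      Set.mem_ofPred_eq, Finset.coe_filter, Finset.mem_univ, true_and, Set.mem_image]
    constructor
    · rintro ⟨⟨i, rfl⟩, h⟩; exact ⟨i, h, rfl⟩
    · rintro ⟨i, h, rfl⟩; exact ⟨⟨i, rfl⟩, h⟩
  have h2 : crossed (dualSlope b r) (dualIntercept b r) m ℓ₁.dual ℓ₂.dual =
      (Finset.univ.filter fun i => ¬ 0 < ℓ₁.gap (b i) * ℓ₂.gap (b i)).map Fin.valEmbedding := by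
    ext l
    simp only [crossed, Finset.mem_filter, Finset.mem_range, Finset.mem_map, Finset.mem_univ,
      true_and, Fin.valEmbedding_apply, not_lt]
    constructor
    · rintro ⟨hl, h⟩
      have e := fun ℓ => height_blue (b := b) (r := r) ℓ ⟨l, hl⟩
      simp only at e
      rw [e, e, neg_mul_neg] at h
      exact ⟨⟨l, hl⟩, h, rfl⟩
    · rintro ⟨i, h, rfl⟩
      rw [height_blue, height_blue, neg_mul_neg]
      exact ⟨i.2, h⟩
  rw [h1, Set.ncard_image_of_injective _ hb, Set.ncard_coe_finset, h2, Finset.card_map,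
    Finset.card_filter_add_card_filter_not, Finset.card_univ, Fintype.card_fin]

theorem isOptimal_of_crossed (hb : Function.Injective b) {ℓ₁ ℓ₂ : Line}
    (hs : ℓ₁.slope < ℓ₂.slope)
    (hred : ∀ i < k, 0 ≤ height (dualSlope b r) (dualIntercept b r) (m + i) ℓ₁.dual *
        height (dualSlope b r) (dualIntercept b r) (m + i) ℓ₂.dual)
    (hmax : ∀ u v : ℝ × ℝ, u.1 < v.1 →
      (∀ i < k, 0 ≤ height (dualSlope b r) (dualIntercept b r) (m + i) u *
        height (dualSlope b r) (dualIntercept b r) (m + i) v) →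
      (crossed (dualSlope b r) (dualIntercept b r) m u v).card ≤
        (crossed (dualSlope b r) (dualIntercept b r) m ℓ₁.dual ℓ₂.dual).card) :
    IsOptimal (Set.range b) (Set.range r) ℓ₁ ℓ₂ := by
  refine ⟨isFeasible_iff.2 ⟨hs, hred⟩, fun ℓ₁' ℓ₂' h => ?_⟩
  obtain ⟨hs', hred'⟩ := (isFeasible_iff (b := b)).1 h
  have h1 := hmax ℓ₁'.dual ℓ₂'.dual hs' hred'
  have h2 := ncard_blueOutliers hb r ℓ₁ ℓ₂
  have h3 := ncard_blueOutliers hb r ℓ₁' ℓ₂'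
  omega

theorem crossed_comm (A b : ℕ → ℝ) (m : ℕ) (u v : ℝ × ℝ) :
    crossed A b m u v = crossed A b m v u := by
  unfold crossed
  simp only [mul_comm]

/-- The optimality criterion: two points next to the first and the last end of a best interval
are dual to the lines of an optimal double wedge. -/
theorem isOptimal_of_isBestInterval (hgen : GeneralPosition (Sum.elim b r)) (hmk : 0 < m + k)
    {N : ℕ} {e : ℕ → End}
    (he : EndOrder (dualSlope b r) (dualIntercept b r) m k N e) {mate : ℕ → ℕ}
    (hp : RealRAM.Paired N (fun i => cellCode ((e i).cell (dualSlope b r) (dualIntercept b r) m k))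
      (fun i => (e i).j) mate) {w : ℝ} {p q : ℕ}
    (hbest : RealRAM.IsBestInterval N
      (fun i => cellCode ((e i).cell (dualSlope b r) (dualIntercept b r) m k)) mate w p q)
    {E E' : End} (hE : N ≠ 0 → e p = E) (hE' : N ≠ 0 → e q = E')
    (h0 : N = 0 → E = ⟨0, 0, 0⟩ ∧ E' = ⟨0, 0, 0⟩) {x y : ℝ} (hxy : x ≠ y)
    (hx : E.Inner (dualSlope b r) (dualIntercept b r) m k x)
    (hy : E'.Inner (dualSlope b r) (dualIntercept b r) m k y) {ℓ₁ ℓ₂ : Line}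
    (h1 : ℓ₁.slope = min x y) (h2 : ℓ₂.slope = max x y)
    (h1' : ℓ₁.intercept = ln (dualSlope b r) (dualIntercept b r)
      (if x < y then E.j else E'.j) (min x y))
    (h2' : ℓ₂.intercept = ln (dualSlope b r) (dualIntercept b r)
      (if x < y then E'.j else E.j) (max x y)) :
    IsOptimal (Set.range b) (Set.range r) ℓ₁ ℓ₂ := by
  have hG := genPos_dual hgen
  have hb : Function.Injective b := fun i j h => by
    have := hgen.1 (a₁ := Sum.inl i) (a₂ := Sum.inl j) (by simp [h])
    simpa using this
  -- Without blue lines, there are no ends, and the first red line takes the place of their line.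
  have hEj : E.j < m + k ∧ E'.j < m + k ∧ E.cell (dualSlope b r) (dualIntercept b r) m k =
      E'.cell (dualSlope b r) (dualIntercept b r) m k := by
    by_cases hN : N = 0
    · obtain ⟨rfl, rfl⟩ := h0 hN
      exact ⟨hmk, hmk, rfl⟩
    · obtain ⟨g1, g2, g3, -⟩ := hbest.2 hN
      have := (he.valid p (by omega)).j
      have := (he.valid q (by omega)).j
      have := cellCode_injective g3
      simp only [← hE hN, ← hE' hN]
      exact ⟨by omega, by omega, this⟩
  -- A pair of points crosses at most as many blue lines as an interval has single items, hence as
  -- the best interval has, and all of these lines are crossed by the chosen pair.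
  have main : ∀ u v : ℝ × ℝ, u.1 < v.1 →
      (∀ i < k, 0 ≤ height (dualSlope b r) (dualIntercept b r) (m + i) u *
        height (dualSlope b r) (dualIntercept b r) (m + i) v) →
      (crossed (dualSlope b r) (dualIntercept b r) m u v).card ≤
        (crossed (dualSlope b r) (dualIntercept b r) m
          (x, ln (dualSlope b r) (dualIntercept b r) E.j x)
          (y, ln (dualSlope b r) (dualIntercept b r) E'.j y)).card := by
    intro u v huv hred
    rcases he.card_crossed_le hG hp huv hred with h | ⟨p', q', g1, g2, g3, g4⟩
    · simp [h]
    · have hN : N ≠ 0 := by omega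
      obtain ⟨f1, f2, f3, f4⟩ := hbest.2 hN
      have h5 := hbest.1 p' q' g1 g2 (congrArg cellCode g3)
      rw [f4, Nat.cast_le] at h5
      have h6 := he.card_singles_le hG hp f1 f2 (cellCode_injective f3)
        (x := x) (y := y) (by rwa [hE hN]) (by rwa [hE' hN])
      rw [hE hN, hE' hN] at h6
      omega
  have hredE := fun i (hi : i < k) => hx.height_mul_nonneg hG hy hEj.1 hEj.2.1 hEj.2.2 hi
  rcases lt_or_gt_of_ne hxy with h | h
  · have d1 : ℓ₁.dual = (x, ln (dualSlope b r) (dualIntercept b r) E.j x) := by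
      rw [Line.dual, h1, h1', if_pos h, min_eq_left h.le]
    have d2 : ℓ₂.dual = (y, ln (dualSlope b r) (dualIntercept b r) E'.j y) := by
      rw [Line.dual, h2, h2', if_pos h, max_eq_right h.le]
    refine isOptimal_of_crossed hb ?_ ?_ ?_
    · rw [h1, h2, min_eq_left h.le, max_eq_right h.le]; exact h
    · rw [d1, d2]; exact hredE
    · rw [d1, d2]; exact main
  · have d1 : ℓ₁.dual = (y, ln (dualSlope b r) (dualIntercept b r) E'.j y) := by
      rw [Line.dual, h1, h1', if_neg h.le.not_gt, min_eq_right h.le]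
    have d2 : ℓ₂.dual = (x, ln (dualSlope b r) (dualIntercept b r) E.j x) := by
      rw [Line.dual, h2, h2', if_neg h.le.not_gt, max_eq_left h.le]
    refine isOptimal_of_crossed hb ?_ ?_ ?_
    · rw [h1, h2, min_eq_right h.le, max_eq_left h.le]; exact h
    · rw [d1, d2]; intro i hi; rw [mul_comm]; exact hredE i hi
    · rw [d1, d2, crossed_comm]; exact main

end Bowtie

/-! ### Loading the dual lines -/

namespace RealRAM

open Bowtie

theorem Run.seqFramed {W : ℕ} {p q : Program} {s : State} {T T₁ T₂ : ℕ} {Q Q₁ : State → Prop}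
    (hp : Run W p s T₁ Q₁) (hq : ∀ s', Frame p s s' → Q₁ s' → Run W q s' T₂ Q)
    (hT : T₁ + T₂ ≤ T) : Run W (.seq p q) s T Q :=
  (Run.seq (hp.framed le_rfl hq)).mono hT fun _ h => h

/-- The remainder of a division. -/
def NatExpr.mod (e f : NatExpr) : NatExpr := e - f * (e / f)

@[simp] theorem NatExpr.eval_mod (s : State) (e f : NatExpr) :
    (e.mod f).eval s = e.eval s % f.eval s := (Nat.mod_eq_sub_mul_div).symm

/-- The number of blue points in the input. -/
abbrev blueCount : NatExpr := .get 0 0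

/-- The number of red points in the input. -/
abbrev redCount : NatExpr := .get 0 1

/-- The abscissa of the intersection point of the lines number `i` and `l`. -/
def crossExpr (i l : NatExpr) : RealExpr :=
  (.get iceptArr l - .get iceptArr i) / (.get slopeArr i - .get slopeArr l)

/-- The memory holds the `m` blue lines, followed by the `k` red lines. -/
structure Loaded (A b : ℕ → ℝ) (m k : ℕ) (s : State) : Prop where
  blue : s.nat 0 0 = m
  red : s.nat 0 1 = k
  slope : ∀ l < m + k, s.real slopeArr l = A l
  icept : ∀ l < m + k, s.real iceptArr l = b l

theorem Loaded.frame {A b : ℕ → ℝ} {m k : ℕ} {s s' : State} {p : Program}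
    (h : Loaded A b m k s) (hf : Frame p s s') (h0 : p.writesNat 0 = false)
    (h1 : p.writesReal slopeArr = false) (h2 : p.writesReal iceptArr = false) :
    Loaded A b m k s' := by
  refine ⟨?_, ?_, ?_, ?_⟩
  · rw [hf.1 _ h0]; exact h.blue
  · rw [hf.1 _ h0]; exact h.red
  · rw [hf.2 _ h1]; exact h.slope
  · rw [hf.2 _ h2]; exact h.icept

theorem Loaded.eval_crossExpr {A b : ℕ → ℝ} {m k : ℕ} {s : State} (h : Loaded A b m k s)
    {i l : NatExpr} (hi : i.eval s < m + k) (hl : l.eval s < m + k) :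
    (crossExpr i l).eval s = cross A b (i.eval s) (l.eval s) := by
  simp [crossExpr, cross, h.slope _ hi, h.slope _ hl, h.icept _ hi, h.icept _ hl]

/-- Store the dual lines of the points. -/
def loadLines : Program :=
  .seq (forLoop loopI blueCount
    (.seq (.setReal slopeArr (.var loopI) (0 - .get 0 (.var loopI)))
      (.setReal iceptArr (.var loopI) (.get 1 (.var loopI)))))
  (forLoop loopI redCount
    (.seq (.setReal slopeArr (blueCount + .var loopI) (0 - .get 2 (.var loopI)))
      (.setReal iceptArr (blueCount + .var loopI) (.get 3 (.var loopI)))))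

theorem loadLines_run {W m k : ℕ} (b : Fin m → ℝ × ℝ) (r : Fin k → ℝ × ℝ) (hm : m < W)
    (hk : k < W) :
    Run W loadLines (inputState b r) (50 * (m + k + 1))
      (Loaded (dualSlope b r) (dualIntercept b r) m k) := by
  unfold loadLines
  refine Run.seqFramed (T₁ := m * 35 + 20) (T₂ := k * 40 + 20) (Q₁ := fun s' => ∀ l < m,
    s'.real slopeArr l = dualSlope b r l ∧ s'.real iceptArr l = dualIntercept b r l)
    (Run.forLoop (c := 17) (n := m) (fun t s' => ∀ l < t,
      s'.real slopeArr l = dualSlope b r l ∧ s'.real iceptArr l = dualIntercept b r l)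
      hm rfl ?_ ?_ ?_ ?_ ?_) ?_ (by omega)
  · intro s' hf
    simp only [NatExpr.eval_get, NatExpr.eval_zero]
    rw [hf.1 0 rfl]; rfl
  · simp
  · intro t ht s' hf hv hI
    refine Run.of_safe (by simp [Program.Safe]) (by decide) ?_
    have e0 : s'.real 0 t = toArray (fun i => (b i).1) t := by rw [hf.2 0 rfl]; rfl
    have e1 : s'.real 1 t = toArray (fun i => (b i).2) t := by rw [hf.2 1 rfl]; rfl
    intro l hl
    by_cases hlt : l = t
    · subst hlt
      simp [Program.eff, hv, e0, e1, dualSlope, dualIntercept, ht]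
    · simpa [Program.eff, hv, hlt] using hI l (by omega)
  · simp only [NatExpr.cost]; omega
  · exact fun s' _ h => h
  · intro s₁ hf₁ h₁
    refine Run.forLoop (c := 21) (n := k) (fun t s' => ∀ l < m + t,
      s'.real slopeArr l = dualSlope b r l ∧ s'.real iceptArr l = dualIntercept b r l)
      hk rfl ?_ ?_ ?_ ?_ ?_
    · intro s' hf
      simp only [NatExpr.eval_get, NatExpr.eval_one]
      rw [hf.1 0 rfl, hf₁.1 0 rfl]; rfl
    · simpa using h₁
    · intro t ht s' hf hv hI
      refine Run.of_safe (by simp [Program.Safe]) (by decide) ?_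
      have e0 : s'.real 2 t = toArray (fun i => (r i).1) t := by rw [hf.2 2 rfl, hf₁.2 2 rfl]; rfl
      have e1 : s'.real 3 t = toArray (fun i => (r i).2) t := by rw [hf.2 3 rfl, hf₁.2 3 rfl]; rfl
      have em : s'.nat 0 0 = m := by rw [hf.1 0 rfl, hf₁.1 0 rfl]; rfl
      intro l hl
      by_cases hlt : l = m + t
      · subst hlt
        simp [Program.eff, hv, em, e0, e1, dualSlope, dualIntercept]
      · simpa [Program.eff, hv, em, hlt] using hI l (by omega)
    · simp only [NatExpr.cost]; omega
    · intro s' hf h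
      refine ⟨?_, ?_, fun l hl => (h l hl).1, fun l hl => (h l hl).2⟩ <;>
      · rw [hf.1 0 rfl, hf₁.1 0 rfl]; rfl

/-- Store the powers of two. -/
def fillPowers : Program :=
  .seq (.setReal powArr 0 1) (forLoop loopI redCount
    (.setReal powArr (.var loopI + 1) (.get powArr (.var loopI) + .get powArr (.var loopI))))

theorem fillPowers_run {W k : ℕ} {s : State} (hk : k < W) (hred : s.nat 0 1 = k) :
    Run W fillPowers s (50 * (k + 1)) fun s' => ∀ i ≤ k, s'.real powArr i = 2 ^ i := by
  unfold fillPowers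
  refine Run.seqFramed (T₁ := 3) (T₂ := k * 40 + 20) (Q₁ := fun s' => s' = s.putReal powArr 0 1)
    (Run.of_safe (by simp [Program.Safe]) (by decide) (by simp [Program.eff])) ?_ (by omega)
  rintro s₁ - rfl
  refine Run.forLoop (c := 12) (n := k) (fun t s' => ∀ i ≤ t, s'.real powArr i = 2 ^ i)
    hk rfl ?_ ?_ ?_ ?_ ?_
  · intro s' hf
    simp only [NatExpr.eval_get, NatExpr.eval_one]
    rw [hf.1 0 rfl]; exact hred
  · simp
  · intro t ht s' hf hv hI
    refine Run.of_safe (by simp [Program.Safe]) (by decide) ?_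
    intro i hi
    by_cases hit : i = t + 1
    · subst hit
      simp [Program.eff, hv, hI t le_rfl, pow_succ]
      ring
    · simpa [Program.eff, hv, hit] using hI i (by omega)
  · simp only [NatExpr.cost]; omega
  · exact fun s' _ h => h

/-- Double the tree size, and a real number that is to bound all sums, until the tree has a leaf for
each end. -/
def sizeTree : Program :=
  .seq (.setNat treeSize 0 1) (.seq (.setReal bigVal 0 1)
    (.loop (.natLe (.var treeSize + 1) (2 * blueCount * (redCount + 1)))
      (.seq (.setNat treeSize 0 (2 * .var treeSize)) (.setReal bigVal 0 (2 * .var bigVal)))))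

theorem sizeTree_run {W m k : ℕ} {s : State} (hW : 2 ^ Nat.clog 2 (2 * m * (k + 1)) < W)
    (hW' : 1 < W) (hblue : s.nat 0 0 = m) (hred : s.nat 0 1 = k) :
    Run W sizeTree s (50 * (Nat.clog 2 (2 * m * (k + 1)) + 1)) fun s' =>
      s'.nat treeSize 0 = 2 ^ Nat.clog 2 (2 * m * (k + 1)) ∧
      s'.real bigVal 0 = 2 ^ Nat.clog 2 (2 * m * (k + 1)) := by
  set N := 2 * m * (k + 1) with hN
  set L := Nat.clog 2 N with hL
  unfold sizeTree
  refine Run.seqFramed (T₁ := 3) (T₂ := 3 + (L * 35 + 20))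
    (Q₁ := fun s' => s' = s.putNat treeSize 0 1)
    (Run.of_safe (by simp [Program.Safe]; omega) (by decide) (by simp [Program.eff])) ?_ (by omega)
  rintro s₁ - rfl
  refine Run.seqFramed (T₁ := 3) (T₂ := L * 35 + 20)
    (Q₁ := fun s' => s' = (s.putNat treeSize 0 1).putReal bigVal 0 1)
    (Run.of_safe (by simp [Program.Safe]) (by decide) (by simp [Program.eff])) ?_ (by omega)
  rintro s₁ - rfl
  refine (Run.loop (c := 12) (n := L) (fun r s' => r ≤ L ∧ s'.nat treeSize 0 = 2 ^ (L - r) ∧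
    s'.real bigVal 0 = 2 ^ (L - r) ∧ s'.nat 0 = s.nat 0) ?_ ?_ ?_ ?_).mono ?_ (fun _ h => h)
  · rintro s' ⟨-, h1, -, h2⟩
    simp only [Test.holds_natLe, NatExpr.eval_add, NatExpr.eval_get, NatExpr.eval_zero,
      NatExpr.eval_one, NatExpr.eval_mul, NatExpr.eval_ofNat, h1, h2, hblue, hred, ← hN]
    have : N ≤ 2 ^ L := Nat.le_pow_clog (by norm_num) _
    simpa using Nat.lt_succ_of_le this
  · rintro r s' ⟨h1, h2, h3, h4⟩ hb
    have e : 2 ^ (L - r) = 2 * 2 ^ (L - (r + 1)) := by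
      rw [← pow_succ']; congr 1; omega
    have hle : 2 ^ (L - r) ≤ 2 ^ L := Nat.pow_le_pow_right (by norm_num) (by omega)
    refine Run.of_safe ?_ (by decide) ?_
    · simp [Program.Safe, h2]; omega
    · refine ⟨by omega, by simp [Program.eff, h2, e], ?_, by simp [Program.eff, h4]⟩
      simp only [Program.eff, State.real_putReal, if_true, RealExpr.eval_mul, RealExpr.eval_ofNat,
        RealExpr.eval_get, NatExpr.eval_zero, State.real_putNat, h3, Function.update_self]
      rw [← pow_succ']; congr 1; omega
  · rintro r s' ⟨h1, h2, h3, h4⟩ hb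
    simp only [Test.holds_natLe, NatExpr.eval_add, NatExpr.eval_get, NatExpr.eval_zero,
      NatExpr.eval_one, NatExpr.eval_mul, NatExpr.eval_ofNat, h2, h4, hblue, hred, ← hN] at hb
    have : L ≤ L - r := Nat.clog_le_of_le_pow (by omega)
    rw [h2, h3, show L - r = L by omega]
    exact ⟨rfl, rfl⟩
  · simp
  · have : (Test.natLe (.var treeSize + 1) (2 * blueCount * (redCount + 1))).cost = 14 := rfl
    rw [this]
    omega

end RealRAM

/-! ### Sweeping over the vertices -/

namespace RealRAM

open Bowtie

/-- The code of the cell of a point of the blue line `j` if `P` is the set of the red lines that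
meet this line on the left of the point. -/
noncomputable def sideCode (A : ℕ → ℝ) (m k j : ℕ) (P : ℕ → Prop) : ℝ :=
  open Classical in
  cellCode ((Finset.range k).filter fun i =>
    (P i ∧ A (m + i) < A j) ∨ (¬ P i ∧ A j < A (m + i)))

theorem sideCode_congr {A : ℕ → ℝ} {m k j : ℕ} {P P' : ℕ → Prop} (h : ∀ i < k, P i ↔ P' i) :
    sideCode A m k j P = sideCode A m k j P' := by
  unfold sideCode
  congr 1
  ext i
  simp only [Finset.mem_filter, Finset.mem_range]
  exact and_congr_right fun hi => by rw [h i hi]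

theorem sideCode_passed (A b : ℕ → ℝ) (m k : ℕ) (E : End) :
    sideCode A m k E.j (fun i => E.Passed A b m (m + i)) = cellCode (E.cell A b m k) := by
  unfold sideCode End.cell End.Under
  congr 1
  ext i
  simp only [Finset.mem_filter]

/-- The code changes when a red line is passed. -/
theorem sideCode_pass {A : ℕ → ℝ} {m k j i : ℕ} {P P' : ℕ → Prop} (hi : i < k)
    (hA : A (m + i) ≠ A j) (hP : ¬ P i) (hP' : ∀ i' < k, P' i' ↔ P i' ∨ i' = i) :
    sideCode A m k j P' =
      sideCode A m k j P + if A (m + i) < A j then 2 ^ i else -2 ^ i := by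
  classical
  have hP'i : P' i := (hP' i hi).2 (.inr rfl)
  unfold sideCode cellCode
  rw [Finset.sum_filter, Finset.sum_filter, ← Finset.add_sum_erase _ _ (Finset.mem_range.2 hi),
    ← Finset.add_sum_erase (Finset.range k) _ (Finset.mem_range.2 hi)]
  have e : ∑ x ∈ (Finset.range k).erase i,
      (if (P' x ∧ A (m + x) < A j) ∨ (¬ P' x ∧ A j < A (m + x)) then (2 : ℝ) ^ x else 0) =
      ∑ x ∈ (Finset.range k).erase i,
      (if (P x ∧ A (m + x) < A j) ∨ (¬ P x ∧ A j < A (m + x)) then (2 : ℝ) ^ x else 0) := by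
    refine Finset.sum_congr rfl fun x hx => ?_
    rw [Finset.mem_erase, Finset.mem_range] at hx
    have : P' x ↔ P x := by rw [hP' x hx.2]; simp [hx.1]
    rw [this]
  rw [e]
  rcases lt_or_gt_of_ne hA with h | h
  · simp [hP, hP'i, h, not_lt.2 h.le]; ring
  · simp [hP, hP'i, h, not_lt.2 h.le]

/-- Compute the abscissas of the vertices, as sort keys, and the codes of the cells at the left ends
of the blue lines. The vertex of the red line `i` and the blue line `j` has the number
`i * m + j`. -/
def prepareVertices : Program :=
  .seq (.setNat itemCount 0 (redCount * blueCount)) (forLoop loopI (.var itemCount)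
    (.seq (.setNat tmpB 0 (.var loopI / blueCount))
    (.seq (.setNat tmpC 0 (NatExpr.mod (.var loopI) blueCount))
    (.seq (.setReal keyA (.var loopI) (crossExpr (blueCount + .var tmpB) (.var tmpC)))
    (.ite (.realLt (.get slopeArr (.var tmpC)) (.get slopeArr (blueCount + .var tmpB)))
      (.setReal lineCode (.var tmpC) (.get lineCode (.var tmpC) + .get powArr (.var tmpB)))
      .skip)))))

theorem vertex_bounds {m k t : ℕ} (ht : t < k * m) : t / m < k ∧ t % m < m := by
  have hm : 0 < m := by
    by_contra h
    have : m = 0 := by omega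
    simp [this] at ht
  exact ⟨(Nat.div_lt_iff_lt_mul hm).2 ht, Nat.mod_lt _ hm⟩

theorem vertex_eq_iff {m i j t : ℕ} (hj : j < m) : i * m + j = t ↔ i = t / m ∧ j = t % m := by
  constructor
  · rintro rfl
    rw [Nat.mul_comm, Nat.mul_add_div (by omega), Nat.div_eq_of_lt hj, Nat.mul_add_mod,
      Nat.mod_eq_of_lt hj]
    simp
  · rintro ⟨rfl, rfl⟩
    exact Nat.div_add_mod' t m

theorem prepareVertices_run {W m k : ℕ} {A b : ℕ → ℝ} {s : State} (hW : k * m < W) (hmW : m < W)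
    (hkW : k < W) (hl : Loaded A b m k s)
    (hpow : ∀ i ≤ k, s.real powArr i = 2 ^ i) (hcode : ∀ j, s.real lineCode j = 0) :
    Run W prepareVertices s (150 * (k * m + 1)) fun s' => s'.nat itemCount 0 = k * m ∧
      (∀ v < k * m, s'.real keyA v = cross A b (m + v / m) (v % m)) ∧
      ∀ j < m, s'.real lineCode j = sideCode A m k j fun _ => False := by
  classical
  unfold prepareVertices
  refine Run.seqFramed (T₁ := 7) (T₂ := k * m * 120 + 20)
    (Q₁ := fun s' => s' = s.putNat itemCount 0 (k * m))
    (Run.of_safe (by simp [Program.Safe, hl.blue, hl.red]; omega) (by decide)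
      (by simp [Program.eff, hl.blue, hl.red])) ?_ (by omega)
  rintro s₁ - rfl
  refine Run.forLoop (c := 90) (n := k * m) (fun t s' =>
    (∀ v < t, s'.real keyA v = cross A b (m + v / m) (v % m)) ∧
    ∀ j < m, s'.real lineCode j =
      ∑ i ∈ Finset.range k, if i * m + j < t ∧ A j < A (m + i) then 2 ^ i else 0)
    hW rfl ?_ ?_ ?_ ?_ ?_
  · intro s' hf
    simp only [NatExpr.eval_get, NatExpr.eval_zero]
    rw [hf.1 itemCount rfl]; simp
  · simp [hcode]
  · rintro t ht s' hf hv ⟨h1, h2⟩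
    obtain ⟨hi, hj⟩ := vertex_bounds ht
    have hf' : Frame prepareVertices s s' := by
      refine Frame.trans (s' := s.putNat itemCount 0 (k * m)) ?_ (hf.mono ?_ ?_)
      · refine ⟨fun a ha => ?_, fun _ _ => rfl⟩
        have : a ≠ itemCount := by rintro rfl; exact absurd ha (by decide)
        simp [this]
      all_goals simp +contextual [prepareVertices, Program.writesNat, Program.writesReal]
    have hl' : Loaded A b m k s' := hl.frame hf' rfl rfl rfl
    have hp' : s'.real powArr (t / m) = 2 ^ (t / m) := by
      rw [hf'.2 powArr rfl]; exact hpow _ hi.le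
    refine Run.seqFramed (T₁ := 8) (T₂ := 80) (Q₁ := fun s'' => s'' = s'.putNat tmpB 0 (t / m))
      (Run.of_safe (by simp [Program.Safe, hl'.blue, hv]; omega) (by decide)
        (by simp [Program.eff, hl'.blue, hv])) ?_ (by omega)
    rintro s₂ hf₂ rfl
    refine Run.seqFramed (T₁ := 20) (T₂ := 60)
      (Q₁ := fun s'' => s'' = (s'.putNat tmpB 0 (t / m)).putNat tmpC 0 (t % m))
      (Run.of_safe (by simp [Program.Safe, hl'.blue, hv]; omega) (by decide)
        (by simp [Program.eff, hl'.blue, hv])) ?_ (by omega)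
    rintro s₃ hf₃ rfl
    have hl₃ := (hl'.frame hf₂ rfl rfl rfl).frame hf₃ rfl rfl rfl
    have ec := hl₃.eval_crossExpr (i := blueCount + .var tmpB) (l := .var tmpC)
      (by simp [hl'.blue]; omega) (by simp; omega)
    simp only [NatExpr.eval_add, NatExpr.eval_get, NatExpr.eval_zero, State.nat_putNat, if_true,
      Function.update_self, if_neg (show (0 : ℕ) ≠ tmpB by decide),
      if_neg (show (0 : ℕ) ≠ tmpC by decide), if_neg (show (tmpB : ℕ) ≠ tmpC by decide),
      hl'.blue] at ec
    have hsi := hl'.slope (m + t / m) (by omega)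
    have hsj := hl'.slope (t % m) (by omega)
    refine Run.of_safe (by simp [Program.Safe]) (by decide) ⟨fun v hvt => ?_, fun j hjm => ?_⟩
    · by_cases hvt' : v = t
      · subst hvt'
        by_cases hA : A (v % m) < A (m + v / m)
        · simp [Program.eff, hv, hl'.blue, hsi, hsj, hA, ec]
        · simp [Program.eff, hv, hl'.blue, hsi, hsj, hA, ec]
      · by_cases hA : A (t % m) < A (m + t / m)
        · simp [Program.eff, hv, hl'.blue, hsi, hsj, hA, hvt']
          exact h1 v (by omega)
        · simp [Program.eff, hv, hl'.blue, hsi, hsj, hA, hvt']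
          exact h1 v (by omega)
    · have hsum : (∑ i ∈ Finset.range k, if i * m + j < t + 1 ∧ A j < A (m + i) then (2 : ℝ) ^ i
          else 0) = (∑ i ∈ Finset.range k, if i * m + j < t ∧ A j < A (m + i) then (2 : ℝ) ^ i
          else 0) + if j = t % m ∧ A j < A (m + t / m) then 2 ^ (t / m) else 0 := by
        rw [← Finset.add_sum_erase _ _ (Finset.mem_range.2 hi),
          ← Finset.add_sum_erase (Finset.range k) _ (Finset.mem_range.2 hi)]
        have e : ∀ x ∈ (Finset.range k).erase (t / m),
            (if x * m + j < t + 1 ∧ A j < A (m + x) then (2 : ℝ) ^ x else 0) =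
            if x * m + j < t ∧ A j < A (m + x) then (2 : ℝ) ^ x else 0 := by
          intro x hx
          rw [Finset.mem_erase] at hx
          have : x * m + j ≠ t := fun h => hx.1 ((vertex_eq_iff hjm).1 h).1
          simp only [show x * m + j < t + 1 ↔ x * m + j < t by omega]
        rw [Finset.sum_congr rfl e]
        have h3 := Nat.div_add_mod' t m
        by_cases hjt : j = t % m
        · subst hjt
          simp [h3]
          ring
        · have h4 : t / m * m + j ≠ t := by omega
          simp [hjt, show t / m * m + j < t + 1 ↔ t / m * m + j < t by omega]
      rw [hsum, ← h2 j hjm]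
      by_cases hA : A (t % m) < A (m + t / m)
      · by_cases hjt : j = t % m
        · subst hjt
          simp [Program.eff, hl'.blue, hsi, hsj, hA, hp']
        · simp [Program.eff, hl'.blue, hsi, hsj, hA, hjt]
      · by_cases hjt : j = t % m
        · subst hjt
          simp [Program.eff, hl'.blue, hsi, hsj, hA]
        · simp [Program.eff, hl'.blue, hsi, hsj, hA, hjt]
  · simp only [NatExpr.cost]; omega
  · rintro s' hf ⟨h1, h2⟩
    refine ⟨by rw [hf.1 itemCount rfl]; simp, h1, fun j hj => ?_⟩
    rw [h2 j hj, sideCode, cellCode, Finset.sum_filter]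
    refine Finset.sum_congr rfl fun i hi => ?_
    have : i * m + j < k * m := by
      have h3 : (i + 1) * m ≤ k * m := Nat.mul_le_mul_right _ (by simpa using hi)
      rw [add_mul] at h3
      omega
    simp [this]

end RealRAM

/-! ### The sort keys of the ends -/

namespace RealRAM

open Bowtie

/-- The end with the number `e = (2 * o + τ) * m + j`. -/
def endOf (m e : ℕ) : End := ⟨e / m / 2, e / m % 2, e % m⟩

theorem endOf_eq {m o τ j : ℕ} (hj : j < m) (hτ : τ < 2) :
    endOf m ((2 * o + τ) * m + j) = ⟨o, τ, j⟩ := by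
  have h := (vertex_eq_iff (i := 2 * o + τ) hj).1 rfl
  rw [endOf, ← h.1, ← h.2]
  congr 1 <;> omega

/-- The arrays `keyA`, `keyB`, `keyC` and `endLine` are correct for the end number `e`. -/
structure EndKey (A b : ℕ → ℝ) (m k : ℕ) (s : State) (e : ℕ) : Prop where
  cell : s.real keyA e = cellCode ((endOf m e).cell A b m k)
  zone : s.real keyB e = (endOf m e).zone A b m
  rank : s.real keyC e = (endOf m e).rank A b m
  line : s.nat endLine e = (endOf m e).j

variable {A b : ℕ → ℝ} {m k W : ℕ} {s : State}

theorem GenPos.cross_ne (hG : GenPos A b (m + k)) {i i' j : ℕ} (hi : i < k) (hi' : i' < k)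
    (hj : j < m) (hne : i ≠ i') : cross A b (m + i) j ≠ cross A b (m + i') j := by
  intro h
  have h1 := ln_sub_ln (b := b) (hG.slope (m + i) (by omega) j (by omega) (by omega))
    (cross A b (m + i) j)
  have h2 := ln_sub_ln (b := b) (hG.slope (m + i') (by omega) j (by omega) (by omega))
    (cross A b (m + i) j)
  rw [sub_self, mul_zero] at h1
  rw [← h, sub_self, mul_zero] at h2
  exact hG.triple j (by omega) (m + i) (by omega) (m + i') (by omega) (by omega) (by omega)
    (by omega) (cross A b (m + i) j) (by linarith) (by linarith)

/-- When the sweep arrives at a vertex of a blue line, exactly the vertices on its left have been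
processed. -/
theorem swept_iff (hG : GenPos A b (m + k)) {K : ℕ → Key} {o : ℕ → ℕ}
    (ho : IsSorting K (k * m) o)
    (hK : ∀ v < k * m, ∃ y z, K v = mkKey (cross A b (m + v / m) (v % m)) y z)
    {t : ℕ} (ht : t < k * m) {i : ℕ} (hi : i < k) :
    (∃ r < t, o r = i * m + o t % m) ↔
      cross A b (m + i) (o t % m) < cross A b (m + o t / m) (o t % m) := by
  have hmono : ∀ r r', r < r' → r' < k * m →
      cross A b (m + o r / m) (o r % m) ≤ cross A b (m + o r' / m) (o r' % m) := by
    intro r r' hrr hr'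
    have h1 := ho.mono r r' hrr hr'
    obtain ⟨y, z, e1⟩ := hK (o r) (ho.lt r (by omega))
    obtain ⟨y', z', e2⟩ := hK (o r') (ho.lt r' hr')
    rw [e1, e2, mkKey_le] at h1
    rcases h1 with h | h
    · exact le_of_lt h
    · exact h.1
  obtain ⟨hit, hjt⟩ := vertex_bounds (ho.lt t ht)
  constructor
  · rintro ⟨r, hr, hor⟩
    have h1 := (vertex_eq_iff hjt).1 hor.symm
    have h2 := hmono r t hr ht
    rw [← h1.1, ← h1.2] at h2
    refine lt_of_le_of_ne h2 (GenPos.cross_ne hG hi hit hjt fun h => ?_)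
    have h3 : o r = o t := by rw [hor, h]; exact Nat.div_add_mod' _ _
    have := ho.inj r (by omega) t ht h3
    omega
  · intro h
    have h3 : (i + 1) * m ≤ k * m := Nat.mul_le_mul_right _ hi
    rw [add_mul] at h3
    obtain ⟨r, hr, hor⟩ := ho.surj (e := i * m + o t % m) (by omega)
    have h1 := (vertex_eq_iff hjt).1 hor.symm
    refine ⟨r, ?_, hor⟩
    by_contra hcon
    rcases (not_lt.1 hcon).lt_or_eq with h4 | h4
    · have h2 := hmono t r h4 hr
      rw [← h1.1, ← h1.2] at h2
      exact absurd h (not_lt.2 h2)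
    · rw [h4, ← h1.1] at h
      rw [← h1.2] at h
      exact lt_irrefl _ h

theorem upper_left (A b : ℕ → ℝ) (m i j : ℕ) :
    (End.mk (i + 1) 0 j).Upper A b m ↔ ¬ A (m + i) < A j := by
  simp [End.Upper, End.Under, End.Passed, End.pos]

theorem upper_right (b : ℕ → ℝ) {i j : ℕ} (hA : A (m + i) ≠ A j) :
    (End.mk (i + 1) 1 j).Upper A b m ↔ A (m + i) < A j := by
  simp [End.Upper, End.Under, End.Passed, End.pos]
  exact ⟨fun h => lt_of_le_of_ne h hA, fun h => h.le⟩

theorem zone_left (A b : ℕ → ℝ) (m i j : ℕ) :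
    (End.mk (i + 1) 0 j).zone A b m = if A (m + i) < A j then 1 else 3 := by
  rw [End.zone, if_neg (Nat.succ_ne_zero i)]
  by_cases h : A (m + i) < A j <;>
    simp only [upper_left, h, not_true, not_false_iff, if_true, if_false]

theorem zone_right (b : ℕ → ℝ) {i j : ℕ} (hA : A (m + i) ≠ A j) :
    (End.mk (i + 1) 1 j).zone A b m = if A (m + i) < A j then 3 else 1 := by
  rw [End.zone, if_neg (Nat.succ_ne_zero i)]
  by_cases h : A (m + i) < A j <;> simp only [upper_right b hA, h, if_true, if_false]

theorem rank_left (A b : ℕ → ℝ) (m i j : ℕ) : (End.mk (i + 1) 0 j).rank A b m =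
    if A (m + i) < A j then cross A b (m + i) j else 0 - cross A b (m + i) j := by
  rw [End.rank, if_neg (Nat.succ_ne_zero i)]
  by_cases h : A (m + i) < A j <;>
    simp only [upper_left, h, not_true, not_false_iff, if_true, if_false] <;> rfl

theorem rank_right (b : ℕ → ℝ) {i j : ℕ} (hA : A (m + i) ≠ A j) :
    (End.mk (i + 1) 1 j).rank A b m =
      if A (m + i) < A j then 0 - cross A b (m + i) j else cross A b (m + i) j := by
  rw [End.rank, if_neg (Nat.succ_ne_zero i)]
  by_cases h : A (m + i) < A j <;> simp only [upper_right b hA, h, if_true, if_false] <;> rfl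

/-- Decode the next vertex. -/
def decodeVertex : Program :=
  .seq (.setNat tmpA 0 (.get orderArr (.var loopI)))
  (.seq (.setNat tmpB 0 (.var tmpA / blueCount))
  (.seq (.setNat tmpC 0 (NatExpr.mod (.var tmpA) blueCount))
  (.seq (.setNat tmpD 0 (2 * (.var tmpB + 1) * blueCount + .var tmpC))
  (.setReal crossVal 0 (crossExpr (blueCount + .var tmpB) (.var tmpC))))))

theorem decodeVertex_run (hW : 2 * m * (k + 1) < W) (hl : Loaded A b m k s) {v : ℕ}
    (hv : s.nat orderArr (s.nat loopI 0) = v) (hvk : v < k * m) :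
    Run W decodeVertex s 80 fun s' => s'.nat tmpB 0 = v / m ∧ s'.nat tmpC 0 = v % m ∧
      s'.nat tmpD 0 = (2 * (v / m + 1) + 0) * m + v % m ∧
      s'.real crossVal 0 = cross A b (m + v / m) (v % m) := by
  obtain ⟨hi, hj⟩ := vertex_bounds hvk
  have h1 : k * m + m < W := by nlinarith
  have h2 : 2 * (v / m + 1) * m + v % m < W := by
    have h3 : (v / m + 1) * m ≤ k * m := Nat.mul_le_mul_right _ hi
    nlinarith
  have h3 : v / m < W := lt_of_le_of_lt (Nat.div_le_self _ _) (by omega)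
  refine Run.of_safe ?_ (by decide) ?_
  · simp [decodeVertex, Program.Safe, Program.eff, hv, hl.blue]
    exact ⟨by omega, h3, by omega, h2⟩
  · simp [decodeVertex, Program.eff, hv, hl.blue, crossExpr, cross, hl.slope (m + v / m) (by omega),
      hl.slope (v % m) (by omega), hl.icept (m + v / m) (by omega), hl.icept (v % m) (by omega)]

/-- Write the keys of the two ends at a vertex; `tmpD` is the number of the left end. -/
def writeEnds : Program :=
  .seq (.setReal keyA (.var tmpD + blueCount) (.get lineCode (.var tmpC)))
  (.seq (.ite (.realLt (.get slopeArr (blueCount + .var tmpB)) (.get slopeArr (.var tmpC)))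
    (.seq (.setReal lineCode (.var tmpC) (.get lineCode (.var tmpC) + .get powArr (.var tmpB)))
    (.seq (.setReal keyB (.var tmpD) 1) (.seq (.setReal keyC (.var tmpD) (.var crossVal))
    (.seq (.setReal keyB (.var tmpD + blueCount) 3)
      (.setReal keyC (.var tmpD + blueCount) (0 - .var crossVal))))))
    (.seq (.setReal lineCode (.var tmpC) (.get lineCode (.var tmpC) - .get powArr (.var tmpB)))
    (.seq (.setReal keyB (.var tmpD) 3) (.seq (.setReal keyC (.var tmpD) (0 - .var crossVal))
    (.seq (.setReal keyB (.var tmpD + blueCount) 1)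
      (.setReal keyC (.var tmpD + blueCount) (.var crossVal)))))))
  (.seq (.setReal keyA (.var tmpD) (.get lineCode (.var tmpC)))
  (.seq (.setNat endLine (.var tmpD) (.var tmpC))
    (.setNat endLine (.var tmpD + blueCount) (.var tmpC)))))

theorem writeEnds_run (hl : Loaded A b m k s) {i j d : ℕ} {x : ℝ} (hi : i < k) (hj : j < m)
    (hjW : j < W) (hB : s.nat tmpB 0 = i) (hC : s.nat tmpC 0 = j) (hD : s.nat tmpD 0 = d)
    (hx : s.real crossVal 0 = x) (hp : s.real powArr i = 2 ^ i) :
    Run W writeEnds s 200 fun s' => ∃ c : ℝ,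
      c = s.real lineCode j + (if A (m + i) < A j then 2 ^ i else -2 ^ i) ∧
      s'.real lineCode = Function.update (s.real lineCode) j c ∧
      s'.real keyA =
        Function.update (Function.update (s.real keyA) (d + m) (s.real lineCode j)) d c ∧
      s'.real keyB = Function.update (Function.update (s.real keyB) d
        (if A (m + i) < A j then 1 else 3)) (d + m) (if A (m + i) < A j then 3 else 1) ∧
      s'.real keyC = Function.update (Function.update (s.real keyC) d
        (if A (m + i) < A j then x else 0 - x)) (d + m) (if A (m + i) < A j then 0 - x else x) ∧
      s'.nat endLine = Function.update (Function.update (s.nat endLine) d j) (d + m) j := by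
  have hsi := hl.slope (m + i) (by omega)
  have hsj := hl.slope j (by omega)
  by_cases hA : A (m + i) < A j
  · refine Run.of_safe ?_ (by decide) ⟨_, rfl, ?_, ?_, ?_, ?_, ?_⟩
    · simp [writeEnds, Program.Safe, Program.eff, hC, hl.blue, hB, hsi, hsj, hA, hjW]
    all_goals simp [writeEnds, Program.eff, hC, hl.blue, hB, hsi, hsj, hA, hD, hp, hx]
  · refine Run.of_safe ?_ (by decide) ⟨_, rfl, ?_, ?_, ?_, ?_, ?_⟩
    · simp [writeEnds, Program.Safe, Program.eff, hC, hl.blue, hB, hsi, hsj, hA, hjW]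
    all_goals simp [writeEnds, Program.eff, hC, hl.blue, hB, hsi, hsj, hA, hD, hp, hx,
      sub_eq_add_neg]

/-- Process the vertices from left to right. The code of each blue line is updated at its vertices,
so that it is the code before the update at the right end, and after the update at the left end, of
the two pieces of the line that meet at the vertex. -/
def sweepVertices : Program :=
  forLoop loopI (.var itemCount) (.seq decodeVertex writeEnds)

theorem endKey_of_eq {s s' : State} {e : ℕ} (h : EndKey A b m k s e)
    (h1 : s'.real keyA e = s.real keyA e) (h2 : s'.real keyB e = s.real keyB e)
    (h3 : s'.real keyC e = s.real keyC e) (h4 : s'.nat endLine e = s.nat endLine e) :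
    EndKey A b m k s' e :=
  ⟨h1.trans h.cell, h2.trans h.zone, h3.trans h.rank, h4.trans h.line⟩

theorem sweepVertices_run (hG : GenPos A b (m + k)) (hW : 2 * m * (k + 1) < W)
    (hl : Loaded A b m k s) (hpow : ∀ i ≤ k, s.real powArr i = 2 ^ i)
    (hcount : s.nat itemCount 0 = k * m)
    (hcode : ∀ j < m, s.real lineCode j = sideCode A m k j fun _ => False)
    (hleft : ∀ e < m, EndKey A b m k s e) {K : ℕ → Key}
    (ho : IsSorting K (k * m) (s.nat orderArr))
    (hK : ∀ v < k * m, ∃ y z, K v = mkKey (cross A b (m + v / m) (v % m)) y z) :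
    Run W sweepVertices s (400 * (k * m + 1)) fun s' =>
      (∀ j < m, s'.real lineCode j = sideCode A m k j fun _ => True) ∧
      (∀ e < m, EndKey A b m k s' e) ∧
      ∀ e < 2 * m * (k + 1), 2 * m ≤ e → EndKey A b m k s' e := by
  have hkm : k * m < W := by nlinarith
  set o := s.nat orderArr with hodef
  -- After `t` vertices, the code of a line is that of the cell on the right of its last vertex, and
  -- the keys of the ends at the first `t` vertices are in place.
  refine Run.forLoop (c := 300) (n := k * m) (fun t s' =>
    (∀ j < m, s'.real lineCode j = sideCode A m k j fun i => ∃ r < t, o r = i * m + j) ∧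
    (∀ e < m, EndKey A b m k s' e) ∧
    ∀ r < t, ∀ τ < 2, EndKey A b m k s' ((2 * (o r / m + 1) + τ) * m + o r % m))
    hkm rfl ?_ ?_ ?_ ?_ ?_
  · intro s' hf
    simp only [NatExpr.eval_get, NatExpr.eval_zero]
    rw [hf.1 itemCount rfl]; exact hcount
  · refine ⟨fun j hj => ?_, fun e he => ?_, fun r hr => absurd hr (by omega)⟩
    · simpa using hcode j hj
    · exact endKey_of_eq (hleft e he) rfl rfl rfl rfl
  · rintro t ht s₁ hf hv ⟨h1, h2, h3⟩
    obtain ⟨hi, hj⟩ := vertex_bounds (ho.lt t ht)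
    have hl₁ := hl.frame hf rfl rfl rfl
    have ho₁ : s₁.nat orderArr = o := hf.1 orderArr rfl
    have hp₁ : s₁.real powArr = s.real powArr := hf.2 powArr rfl
    refine Run.seqFramed (T₁ := 80) (T₂ := 200) (decodeVertex_run (v := o t) hW hl₁
      (by rw [hv, ho₁]) (ho.lt t ht)) ?_ (by omega)
    rintro s₂ hf₂ ⟨g1, g2, g3, g4⟩
    have hl₂ := hl₁.frame hf₂ rfl rfl rfl
    refine (writeEnds_run hl₂ hi hj (by nlinarith) g1 g2 g3 g4
      (by rw [hf₂.2 powArr rfl, hp₁]; exact hpow _ hi.le)).framed le_rfl ?_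
    rintro s₃ hf₃ ⟨c, hc, f1, f2, f3, f4, f5⟩
    have hlc : s₂.real lineCode = s₁.real lineCode := hf₂.2 lineCode rfl
    have hA := hG.slope (m + o t / m) (by omega) (o t % m) (by omega) (by omega)
    have hswept := fun i' (hi' : i' < k) => swept_iff hG ho hK ht hi'
    -- The code on the right of the vertex.
    have hpass : sideCode A m k (o t % m) (fun i => ∃ r < t + 1, o r = i * m + o t % m) = c := by
      rw [hc, hlc, h1 _ hj]
      refine sideCode_pass hi hA (fun h => ?_) (fun i' _ => ?_)
      · exact lt_irrefl _ ((hswept _ hi).1 h)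
      · constructor
        · rintro ⟨r, hr, h⟩
          rcases Nat.lt_succ_iff_lt_or_eq.1 hr with h' | rfl
          · exact .inl ⟨r, h', h⟩
          · exact .inr ((vertex_eq_iff hj).1 h.symm).1
        · rintro (⟨r, hr, h⟩ | rfl)
          · exact ⟨r, by omega, h⟩
          · exact ⟨t, by omega, (Nat.div_add_mod' _ _).symm⟩
    set d := (2 * (o t / m + 1) + 0) * m + o t % m with hd
    have hd1 : (2 * (o t / m + 1) + 1) * m + o t % m = d + m := by rw [hd]; ring
    have hdm : d ≠ d + m := by omega
    have key0 : EndKey A b m k s₃ d := by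
      have hE : endOf m d = ⟨o t / m + 1, 0, o t % m⟩ := endOf_eq hj (by omega)
      have hpd : ∀ l, (End.mk (o t / m + 1) 0 (o t % m)).Passed A b m l ↔
          cross A b l (o t % m) ≤ cross A b (m + o t / m) (o t % m) := by
        intro l; simp [End.Passed, End.pos]
      have hcell : cellCode ((endOf m d).cell A b m k) = c := by
        rw [hE, ← hpass, ← sideCode_passed]
        refine sideCode_congr fun i hik => ?_
        rw [hpd]
        constructor
        · intro h
          rcases h.lt_or_eq with h' | h'
          · obtain ⟨r, hr, h''⟩ := (hswept i hik).2 h'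
            exact ⟨r, by omega, h''⟩
          · have : i = o t / m := by
              by_contra hne
              exact GenPos.cross_ne hG hik hi hj hne h'
            exact ⟨t, by omega, by rw [this]; exact (Nat.div_add_mod' _ _).symm⟩
        · rintro ⟨r, hr, h⟩
          rcases Nat.lt_succ_iff_lt_or_eq.1 hr with h' | rfl
          · exact ((hswept i hik).1 ⟨r, h', h⟩).le
          · rw [((vertex_eq_iff hj).1 h.symm).1]
      refine ⟨?_, ?_, ?_, ?_⟩
      · rw [f2, hcell, Function.update_self]
      · rw [f3, Function.update_of_ne hdm, Function.update_self, hE, zone_left]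
      · rw [f4, Function.update_of_ne hdm, Function.update_self, hE, rank_left]
      · rw [f5, Function.update_of_ne hdm, Function.update_self, hE]
    have key1 : EndKey A b m k s₃ (d + m) := by
      have hE : endOf m (d + m) = ⟨o t / m + 1, 1, o t % m⟩ := by
        rw [← hd1]; exact endOf_eq hj (by omega)
      have hpd : ∀ l, (End.mk (o t / m + 1) 1 (o t % m)).Passed A b m l ↔
          cross A b l (o t % m) < cross A b (m + o t / m) (o t % m) := by
        intro l; simp [End.Passed, End.pos]
      have hcell : cellCode ((endOf m (d + m)).cell A b m k) = s₁.real lineCode (o t % m) := by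
        rw [hE, h1 _ hj, ← sideCode_passed]
        refine sideCode_congr fun i hik => ?_
        rw [hpd, ← hswept i hik]
      refine ⟨?_, ?_, ?_, ?_⟩
      · rw [f2, hcell, Function.update_of_ne hdm.symm, Function.update_self, hlc]
      · rw [f3, Function.update_self, hE, zone_right b hA]
      · rw [f4, Function.update_self, hE, rank_right b hA]
      · rw [f5, Function.update_self, hE]
    -- The other keys are not changed.
    have keep : ∀ e, e ≠ d → e ≠ d + m → EndKey A b m k s₁ e → EndKey A b m k s₃ e := by
      intro e he1 he2 h
      refine endKey_of_eq h ?_ ?_ ?_ ?_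
      · rw [f2, Function.update_of_ne he1, Function.update_of_ne he2, hf₂.2 keyA rfl]
      · rw [f3, Function.update_of_ne he2, Function.update_of_ne he1, hf₂.2 keyB rfl]
      · rw [f4, Function.update_of_ne he2, Function.update_of_ne he1, hf₂.2 keyC rfl]
      · rw [f5, Function.update_of_ne he2, Function.update_of_ne he1, hf₂.1 endLine rfl]
    have all : ∀ e, EndKey A b m k s₁ e → EndKey A b m k s₃ e := by
      intro e h
      by_cases he1 : e = d
      · rw [he1]; exact key0
      · by_cases he2 : e = d + m
        · rw [he2]; exact key1
        · exact keep e he1 he2 h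
    refine ⟨fun j hjm => ?_, fun e he => ?_, fun r hr τ hτ => ?_⟩
    · show s₃.real lineCode j = _
      rw [f1]
      by_cases hjt : j = o t % m
      · subst hjt
        rw [Function.update_self, hpass]
      · rw [Function.update_of_ne hjt, hlc, h1 j hjm]
        refine sideCode_congr fun i _ => ⟨fun ⟨r, hr, h⟩ => ⟨r, by omega, h⟩, fun ⟨r, hr, h⟩ => ?_⟩
        rcases Nat.lt_succ_iff_lt_or_eq.1 hr with h' | rfl
        · exact ⟨r, h', h⟩
        · exact absurd ((vertex_eq_iff hjm).1 h.symm).2 hjt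
    · exact endKey_of_eq (all e (h2 e he)) rfl rfl rfl rfl
    · refine endKey_of_eq (s := s₃) ?_ rfl rfl rfl rfl
      rcases Nat.lt_succ_iff_lt_or_eq.1 hr with h' | rfl
      · exact all _ (h3 r h' τ hτ)
      · rcases (show τ = 0 ∨ τ = 1 by omega) with rfl | rfl
        · exact key0
        · rw [hd1]; exact key1
  · simp only [NatExpr.cost]; omega
  · rintro s' hf ⟨h1, h2, h3⟩
    refine ⟨fun j hj => ?_, h2, fun e he hme => ?_⟩
    · rw [h1 j hj]
      refine sideCode_congr fun i hi => iff_true_intro ?_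
      have h4 : (i + 1) * m ≤ k * m := Nat.mul_le_mul_right _ hi
      rw [add_mul] at h4
      exact ho.surj (by omega)
    · have hm : 0 < m := by
        by_contra hcon
        have : m = 0 := by omega
        subst this
        simp at he
      have hj := Nat.mod_lt e hm
      have hq : e / m < 2 * (k + 1) := (Nat.div_lt_iff_lt_mul hm).2 (by nlinarith)
      have hq2 : 2 ≤ e / m := (Nat.le_div_iff_mul_le hm).2 hme
      set i := e / m / 2 - 1 with hi
      have hik : i < k := by omega
      have h4 : (i + 1) * m ≤ k * m := Nat.mul_le_mul_right _ hik
      rw [add_mul] at h4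
      obtain ⟨r, hr, hor⟩ := ho.surj (e := i * m + e % m) (by omega)
      have h5 := (vertex_eq_iff hj).1 hor.symm
      have h6 := h3 r hr (e / m % 2) (by omega)
      rw [← h5.1, ← h5.2, show 2 * (i + 1) + e / m % 2 = e / m by omega, Nat.div_add_mod'] at h6
      exact h6

end RealRAM

/-! ### The ends at infinity -/

namespace RealRAM

open Bowtie

variable {A b : ℕ → ℝ} {m k W : ℕ} {s : State}

/-- Write the keys of the left ends at infinity. -/
def writeLeftEnds : Program :=
  forLoop loopI blueCount
    (.seq (.setReal keyA (.var loopI) (.get lineCode (.var loopI)))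
    (.seq (.setReal keyB (.var loopI) 0)
    (.seq (.setReal keyC (.var loopI) (.get slopeArr (.var loopI)))
      (.setNat endLine (.var loopI) (.var loopI)))))

theorem writeLeftEnds_run (hm : m < W) (hl : Loaded A b m k s)
    (hcode : ∀ j < m, s.real lineCode j = sideCode A m k j fun _ => False) :
    Run W writeLeftEnds s (80 * (m + 1)) fun s' => ∀ e < m, EndKey A b m k s' e := by
  refine Run.forLoop (c := 50) (n := m) (fun t s' => ∀ e < t, EndKey A b m k s' e)
    hm rfl ?_ (by simp) ?_ ?_ (fun s' _ h => h)
  · intro s' hf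
    simp only [NatExpr.eval_get, NatExpr.eval_zero]
    rw [hf.1 0 rfl]; exact hl.blue
  · intro t ht s' hf hv hI
    have hl' := hl.frame hf rfl rfl rfl
    refine Run.of_safe (by simp [Program.Safe, Program.eff, hv]; omega) (by decide) ?_
    intro e he
    by_cases het : e = t
    · subst het
      have hE : endOf m e = ⟨0, 0, e⟩ := by
        have := endOf_eq (o := 0) (τ := 0) ht (by omega)
        simpa using this
      have hc : s'.real lineCode e = cellCode ((endOf m e).cell A b m k) := by
        rw [hf.2 lineCode rfl, hcode e ht, hE, ← sideCode_passed]
        exact sideCode_congr fun i _ => by simp [End.Passed]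
      refine ⟨?_, ?_, ?_, ?_⟩
      · rw [← hc]; simp [Program.eff, hv]
      · simp [Program.eff, hv, hE, End.zone]
      · simp [Program.eff, hv, hE, End.rank, hl'.slope e (by omega)]
      · simp [Program.eff, hv, hE]
    · refine endKey_of_eq (hI e (by omega)) ?_ ?_ ?_ ?_ <;> simp [Program.eff, hv, het]
  · simp only [NatExpr.cost]; omega

/-- Write the keys of the right ends at infinity. -/
def writeRightEnds : Program :=
  forLoop loopI blueCount
    (.seq (.setReal keyA (blueCount + .var loopI) (.get lineCode (.var loopI)))
    (.seq (.setReal keyB (blueCount + .var loopI) 2)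
    (.seq (.setReal keyC (blueCount + .var loopI) (.get slopeArr (.var loopI)))
      (.setNat endLine (blueCount + .var loopI) (.var loopI)))))

theorem writeRightEnds_run (hm : m < W) (hl : Loaded A b m k s)
    (hcode : ∀ j < m, s.real lineCode j = sideCode A m k j fun _ => True)
    {S : Set ℕ} (hS : ∀ e ∈ S, EndKey A b m k s e) :
    Run W writeRightEnds s (80 * (m + 1)) fun s' =>
      (∀ e ∈ S, EndKey A b m k s' e) ∧ ∀ e < m, EndKey A b m k s' (m + e) := by
  refine Run.forLoop (c := 60) (n := m) (fun t s' => (∀ e ∈ S, EndKey A b m k s' e) ∧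
    ∀ e < t, EndKey A b m k s' (m + e)) hm rfl ?_ ?_ ?_ ?_ (fun s' _ h => h)
  · intro s' hf
    simp only [NatExpr.eval_get, NatExpr.eval_zero]
    rw [hf.1 0 rfl]; exact hl.blue
  · exact ⟨fun e he => endKey_of_eq (hS e he) rfl rfl rfl rfl, by simp⟩
  · rintro t ht s' hf hv ⟨hI, hI'⟩
    have hl' := hl.frame hf rfl rfl rfl
    refine Run.of_safe (by simp [Program.Safe, Program.eff, hv]; omega) (by decide) ?_
    have new : EndKey A b m k ((Program.eff
        (.seq (.setReal keyA (blueCount + .var loopI) (.get lineCode (.var loopI)))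
        (.seq (.setReal keyB (blueCount + .var loopI) 2)
        (.seq (.setReal keyC (blueCount + .var loopI) (.get slopeArr (.var loopI)))
        (.setNat endLine (blueCount + .var loopI) (.var loopI))))) s').putNat loopI 0 (t + 1))
        (m + t) := by
      have hE : endOf m (m + t) = ⟨0, 1, t⟩ := by
        have := endOf_eq (o := 0) (τ := 1) ht (by omega)
        simpa using this
      have hc : s'.real lineCode t = cellCode ((endOf m (m + t)).cell A b m k) := by
        rw [hf.2 lineCode rfl, hcode t ht, hE, ← sideCode_passed]
        exact sideCode_congr fun i _ => by simp [End.Passed]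
      refine ⟨?_, ?_, ?_, ?_⟩
      · rw [← hc]; simp [Program.eff, hv, hl'.blue]
      · simp [Program.eff, hv, hE, End.zone, hl'.blue]
      · simp [Program.eff, hv, hE, End.rank, hl'.slope t (by omega), hl'.blue]
      · simp [Program.eff, hv, hE, hl'.blue]
    have all : ∀ e, EndKey A b m k s' e → EndKey A b m k ((Program.eff
        (.seq (.setReal keyA (blueCount + .var loopI) (.get lineCode (.var loopI)))
        (.seq (.setReal keyB (blueCount + .var loopI) 2)
        (.seq (.setReal keyC (blueCount + .var loopI) (.get slopeArr (.var loopI)))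
        (.setNat endLine (blueCount + .var loopI) (.var loopI))))) s').putNat loopI 0 (t + 1))
        e := by
      intro e h
      by_cases he : e = m + t
      · rw [he]; exact new
      · refine endKey_of_eq h ?_ ?_ ?_ ?_ <;> simp [Program.eff, hv, hl'.blue, he]
    refine ⟨fun e he => all e (hI e he), fun e he => ?_⟩
    rcases Nat.lt_succ_iff_lt_or_eq.1 he with h | rfl
    · exact all _ (hI' e h)
    · exact new
  · simp only [NatExpr.cost]; omega

/-- Sorting by the keys lists the ends cell by cell in counterclockwise order. -/
theorem endOrder_of_isSorting {o : ℕ → ℕ} (hkey : ∀ e < 2 * m * (k + 1), EndKey A b m k s e)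
    (ho : IsSorting s.key (2 * m * (k + 1)) o) :
    EndOrder A b m k (2 * m * (k + 1)) fun r => endOf m (o r) := by
  have hpos : ∀ e < 2 * m * (k + 1), 0 < m := by
    intro e he
    by_contra hcon
    have : m = 0 := by omega
    subst this
    simp at he
  have hK : ∀ e < 2 * m * (k + 1), s.key e = mkKey (cellCode ((endOf m e).cell A b m k))
      ((endOf m e).zone A b m) ((endOf m e).rank A b m) := by
    intro e he
    rw [State.key, (hkey e he).cell, (hkey e he).zone, (hkey e he).rank]
  have hmono : ∀ r r', r < r' → r' < 2 * m * (k + 1) →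
      mkKey (cellCode ((endOf m (o r)).cell A b m k)) ((endOf m (o r)).zone A b m)
        ((endOf m (o r)).rank A b m) ≤
      mkKey (cellCode ((endOf m (o r')).cell A b m k)) ((endOf m (o r')).zone A b m)
        ((endOf m (o r')).rank A b m) := by
    intro r r' h h'
    rw [← hK _ (ho.lt r (by omega)), ← hK _ (ho.lt r' h')]
    exact ho.mono r r' h h'
  refine ⟨fun r hr => ?_, fun r hr r' hr' h => ?_, fun E hE => ?_, fun r r' h h' => ?_,
    fun r r' h h' hc => ?_⟩
  · have hm := hpos r hr
    have hq : o r / m < 2 * (k + 1) :=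
      (Nat.div_lt_iff_lt_mul hm).2 (by have := ho.lt r hr; nlinarith)
    exact ⟨by simp only [endOf]; omega, by simp only [endOf]; omega, Nat.mod_lt _ hm⟩
  · refine ho.inj r hr r' hr' ?_
    simp only [endOf, End.mk.injEq] at h
    rw [← Nat.div_add_mod' (o r) m, ← Nat.div_add_mod' (o r') m, h.2.2,
      show o r / m = o r' / m by omega]
  · have ho' := hE.o
    have hj := hE.j
    have h1 : (2 * E.o + E.τ + 1) * m ≤ (2 * (k + 1)) * m :=
      Nat.mul_le_mul_right _ (by rcases hE.τ with h | h <;> omega)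
    obtain ⟨r, hr, h⟩ := ho.surj (e := (2 * E.o + E.τ) * m + E.j) (by nlinarith)
    refine ⟨r, hr, ?_⟩
    simp only [h]
    rw [endOf_eq hj (by rcases hE.τ with h | h <;> omega)]
  · rcases mkKey_le.1 (hmono r r' h h') with h1 | h1
    · exact le_of_lt h1
    · exact h1.1
  · rcases mkKey_le.1 (hmono r r' h h') with h1 | ⟨-, h1⟩
    · simp only [hc, lt_self_iff_false] at h1
    · exact h1

end RealRAM

/-! ### Writing the two lines -/

namespace RealRAM

open Bowtie

variable {A b : ℕ → ℝ} {m k W : ℕ} {s : State}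

/-- Compute an interval `(loVal, hiVal)` such that `sgnVal * x` belongs to the edge at the end
number `tmpA` for all `x` in this interval. Right ends are reflected to left ends by `sgnVal`. -/
def edgeInterval : Program :=
  .seq (.seq (.setNat tmpB 0 (.var tmpA / blueCount))
    (.seq (.setNat tmpC 0 (NatExpr.mod (.var tmpA) blueCount))
    (.seq (.setNat tmpD 0 (.var tmpB / 2))
    (.seq (.ite (.natLe (NatExpr.mod (.var tmpB) 2) 0) (.setReal sgnVal 0 1)
      (.setReal sgnVal 0 (0 - 1)))
    (.ite (.natLe (.var tmpD) 0) (.seq (.setReal loVal 0 0) (.setReal hiVal 0 0))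
      (.seq (.setReal loVal 0
          (.var sgnVal * crossExpr (blueCount + (.var tmpD - 1)) (.var tmpC)))
        (.setReal hiVal 0 (.var loVal + 1))))))))
  (.seq (forLoop loopI (blueCount + redCount)
    (.ite (.and (.natLe (.var loopI) (.var tmpC)) (.natLe (.var tmpC) (.var loopI))) .skip
      (.seq (.setReal crossVal 0 (.var sgnVal * crossExpr (.var loopI) (.var tmpC)))
        (.ite (.and (.or (.natLe (.var tmpD) 0) (.realLt (.var loVal) (.var crossVal)))
            (.realLt (.var crossVal) (.var hiVal)))
          (.setReal hiVal 0 (.var crossVal)) .skip))))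
    (.ite (.natLe (.var tmpD) 0) (.setReal loVal 0 (.var hiVal - 1)) .skip))

/-- The sign by which `edgeInterval` reflects an end. -/
noncomputable def sideSign (E : End) : ℝ := if E.τ = 0 then 1 else -1

/-- An interval that starts at the reflected end and contains no reflected vertex of the line of the
end belongs to the edge. For an end at infinity, `hi` bounds all vertices instead. -/
theorem inner_of_interval {E : End} (hτ : E.τ = 0 ∨ E.τ = 1) {lo hi x : ℝ} (hlo : lo < x)
    (hhi : x < hi)
    (h0 : E.o = 0 → ∀ l < m + k, l ≠ E.j → hi ≤ sideSign E * cross A b l E.j)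
    (h1 : E.o ≠ 0 → lo = sideSign E * E.pos A b m ∧ ∀ l < m + k, l ≠ E.j →
      lo < sideSign E * cross A b l E.j → hi ≤ sideSign E * cross A b l E.j) :
    E.Inner A b m k (sideSign E * x) := by
  intro l hl hlj
  unfold sideSign at *
  by_cases ho : E.o = 0
  · have h2 := h0 ho l hl hlj
    rcases hτ with h | h
    · simp only [h, if_true, one_mul] at h2 ⊢
      have h3 : x < cross A b l E.j := hhi.trans_le h2
      simp [End.Passed, ho, h, h3.ne', h3.le]
    · simp only [h, one_ne_zero, if_false, neg_mul, one_mul] at h2 ⊢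
      have h3 : cross A b l E.j < -x := by linarith
      simp [End.Passed, ho, h, h3.ne, h3]
  · obtain ⟨e, h2⟩ := h1 ho
    have h3 := h2 l hl hlj
    rcases hτ with h | h
    · simp only [h, if_true, one_mul] at h3 e ⊢
      simp only [End.Passed, ho, h, if_true, if_false, ← e]
      rcases le_or_gt (cross A b l E.j) lo with h4 | h4
      · have h5 := h4.trans_lt hlo
        exact ⟨h5.ne, iff_of_true h4 h5⟩
      · have h5 := hhi.trans_le (h3 h4)
        exact ⟨h5.ne', iff_of_false (not_le.2 h4) (not_lt.2 h5.le)⟩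
    · simp only [h, one_ne_zero, if_false, neg_mul, one_mul] at h3 e ⊢
      simp only [End.Passed, ho, h, one_ne_zero, if_false]
      rcases lt_or_ge (cross A b l E.j) (E.pos A b m) with h4 | h4
      · have h5 := h3 (by linarith)
        have h6 : cross A b l E.j < -x := by linarith
        exact ⟨h6.ne, iff_of_true h4 h6⟩
      · have h6 : -x < cross A b l E.j := by linarith
        exact ⟨h6.ne', iff_of_false (not_lt.2 h4) (not_lt.2 h6.le)⟩

theorem edgeInterval_run (hl : Loaded A b m k s) {e : ℕ} (he : s.nat tmpA 0 = e) (heW : e < W)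
    (hW : m + k < W) (ho : e / m / 2 ≤ k) (hj : e % m < m + k) :
    Run W edgeInterval s (200 * (m + k + 1)) fun s' => s'.nat tmpC 0 = e % m ∧
      s'.real sgnVal 0 = sideSign (endOf m e) ∧ s'.real loVal 0 < s'.real hiVal 0 ∧
      ∀ x, s'.real loVal 0 < x → x < s'.real hiVal 0 →
        (endOf m e).Inner A b m k (sideSign (endOf m e) * x) := by
  have hsgn : sideSign (endOf m e) = if e / m % 2 = 0 then 1 else -1 := rfl
  have hτ : (endOf m e).τ = 0 ∨ (endOf m e).τ = 1 := by simp only [endOf]; omega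
  have hdiv : e / m < W := lt_of_le_of_lt (Nat.div_le_self _ _) heW
  have hmod : e % m < W := by omega
  unfold edgeInterval
  refine Run.seqFramed (T₁ := 100) (T₂ := (m + k) * 130 + 60) (Q₁ := fun s' =>
    s'.nat tmpC 0 = e % m ∧ s'.nat tmpD 0 = e / m / 2 ∧
    s'.real sgnVal 0 = sideSign (endOf m e) ∧
    ((endOf m e).o ≠ 0 → s'.real loVal 0 = sideSign (endOf m e) * (endOf m e).pos A b m ∧
      s'.real loVal 0 < s'.real hiVal 0)) ?_ ?_ (by omega)
  · have hcr : e / m / 2 ≠ 0 → s.real slopeArr (m + (e / m / 2 - 1)) = A (m + (e / m / 2 - 1)) ∧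
        s.real iceptArr (m + (e / m / 2 - 1)) = b (m + (e / m / 2 - 1)) := fun h =>
      have h' := Nat.add_lt_add_left (lt_of_lt_of_le
        (Nat.sub_lt (Nat.pos_of_ne_zero h) one_pos) ho) m
      ⟨hl.slope _ h', hl.icept _ h'⟩
    have hsj := hl.slope _ hj
    have hbj := hl.icept _ hj
    rw [hsgn]
    by_cases h0 : e / m / 2 = 0
    · by_cases h1 : e / m % 2 = 0
      · refine Run.of_safe ?_ (by decide) ⟨?_, ?_, ?_, fun h => absurd h0 h⟩ <;>
          simp [Program.Safe, Program.eff, he, hl.blue, h0, h1, hdiv, hmod]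
        omega
      · refine Run.of_safe ?_ (by decide) ⟨?_, ?_, ?_, fun h => absurd h0 h⟩ <;>
          simp [Program.Safe, Program.eff, he, hl.blue, h0, h1, hdiv, hmod]
        omega
    · obtain ⟨h2, h3⟩ := hcr h0
      by_cases h1 : e / m % 2 = 0
      · refine Run.of_safe ?_ (by decide) ⟨?_, ?_, ?_, fun _ => ⟨?_, ?_⟩⟩ <;>
          simp [Program.Safe, Program.eff, he, hl.blue, h0, h1, hdiv, hmod, crossExpr, h2, h3,
            hsj, hbj, End.pos, cross, endOf]
        omega
      · refine Run.of_safe ?_ (by decide) ⟨?_, ?_, ?_, fun _ => ⟨?_, ?_⟩⟩ <;>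
          simp [Program.Safe, Program.eff, he, hl.blue, h0, h1, hdiv, hmod, crossExpr, h2, h3,
            hsj, hbj, End.pos, cross, endOf]
        omega
  rintro s₁ hf₁ ⟨hC, hD, hS, hlo⟩
  have hl₁ := hl.frame hf₁ rfl rfl rfl
  refine Run.seqFramed (T₁ := (m + k) * 130 + 40) (T₂ := 20) (Q₁ := fun s' =>
    ((endOf m e).o ≠ 0 → s₁.real loVal 0 < s'.real hiVal 0) ∧ ∀ l < m + k, l ≠ e % m →
      ((endOf m e).o = 0 ∨ s₁.real loVal 0 < sideSign (endOf m e) * cross A b l (e % m)) →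
      s'.real hiVal 0 ≤ sideSign (endOf m e) * cross A b l (e % m)) ?_ ?_ (by omega)
  · refine Run.forLoop (c := 100) (n := m + k) (fun t s' =>
      ((endOf m e).o ≠ 0 → s₁.real loVal 0 < s'.real hiVal 0) ∧ ∀ l < t, l ≠ e % m →
      ((endOf m e).o = 0 ∨ s₁.real loVal 0 < sideSign (endOf m e) * cross A b l (e % m)) →
      s'.real hiVal 0 ≤ sideSign (endOf m e) * cross A b l (e % m)) hW rfl ?_ ?_ ?_ ?_
      (fun s' _ h => h)
    · intro s' hf
      simp only [NatExpr.eval_add, NatExpr.eval_get, NatExpr.eval_zero, NatExpr.eval_one]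
      rw [hf.1 0 rfl, hl₁.blue, hl₁.red]
    · exact ⟨fun h => (hlo h).2, fun l hl => absurd hl (by omega)⟩
    · rintro t ht s' hf hv ⟨h1, h2⟩
      have hl' := hl₁.frame hf rfl rfl rfl
      have hC' : s'.nat tmpC 0 = e % m := by rw [hf.1 tmpC rfl, hC]
      have hD' : s'.nat tmpD 0 = (endOf m e).o := by rw [hf.1 tmpD rfl, hD]; rfl
      have hS' : s'.real sgnVal 0 = sideSign (endOf m e) := by rw [hf.2 sgnVal rfl, hS]
      have hL' : s'.real loVal 0 = s₁.real loVal 0 := by rw [hf.2 loVal rfl]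
      have ec := hl'.eval_crossExpr (i := .var loopI) (l := .var tmpC)
        (by simp [hv]; omega) (by simp [hC']; omega)
      simp only [NatExpr.eval_get, NatExpr.eval_zero, hv, hC'] at ec
      set c := sideSign (endOf m e) * cross A b t (e % m) with hc
      refine Run.ite (T := 60) (fun hb => Run.of_safe (by simp [Program.Safe]) (by decide) ?_)
        (fun hb => ?_) |>.mono (by
          simp only [Test.cost, NatExpr.cost]; omega) (fun _ h => h)
      · simp only [Test.holds_and, Test.holds_natLe, NatExpr.eval_get, NatExpr.eval_zero, hv,
          hC'] at hb
        refine ⟨h1, fun l hlt hlj => h2 l ?_ hlj⟩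
        omega
      · simp only [Test.holds_and, Test.holds_natLe, NatExpr.eval_get, NatExpr.eval_zero, hv,
          hC'] at hb
        refine Run.of_safe (by simp [Program.Safe]) (by decide) ?_
        by_cases hcond : ((endOf m e).o = 0 ∨ s₁.real loVal 0 < c) ∧ c < s'.real hiVal 0
        · have hval : (Program.eff (.seq (.setReal crossVal 0
              (.var sgnVal * crossExpr (.var loopI) (.var tmpC)))
              (.ite (.and (.or (.natLe (.var tmpD) 0) (.realLt (.var loVal) (.var crossVal)))
                (.realLt (.var crossVal) (.var hiVal)))
              (.setReal hiVal 0 (.var crossVal)) .skip)) s').real hiVal 0 = c := by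
            simp [Program.eff, ec, hS', hD', hL', ← hc, hcond]
          simp only [State.real_putNat, hval]
          refine ⟨fun h => (hcond.1.resolve_left h), fun l hlt hlj hl2 => ?_⟩
          rcases Nat.lt_succ_iff_lt_or_eq.1 hlt with h | rfl
          · exact hcond.2.le.trans (h2 l h hlj hl2)
          · exact le_rfl
        · have hval : (Program.eff (.seq (.setReal crossVal 0
              (.var sgnVal * crossExpr (.var loopI) (.var tmpC)))
              (.ite (.and (.or (.natLe (.var tmpD) 0) (.realLt (.var loVal) (.var crossVal)))
                (.realLt (.var crossVal) (.var hiVal)))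
              (.setReal hiVal 0 (.var crossVal)) .skip)) s').real hiVal 0 = s'.real hiVal 0 := by
            have hcond' : ¬ (((endOf m e).o = 0 ∨ s₁.real loVal 0 < c) ∧ c < s'.real hiVal 0) :=
              hcond
            simp only [Program.eff, ec, hS', hD', hL', ← hc, Test.holds_and, Test.holds_or,
              Test.holds_natLe, Test.holds_not, Test.holds_realLe, NatExpr.eval_get,
              NatExpr.eval_zero, RealExpr.eval_get, RealExpr.eval_mul, State.real_putReal,
              State.nat_putReal, if_true, Function.update_self, not_le, nonpos_iff_eq_zero,
              if_neg (show (loVal : ℕ) ≠ crossVal by decide),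
              if_neg (show (hiVal : ℕ) ≠ crossVal by decide), hcond', if_false]
          simp only [State.real_putNat, hval]
          refine ⟨h1, fun l hlt hlj hl2 => ?_⟩
          rcases Nat.lt_succ_iff_lt_or_eq.1 hlt with h | rfl
          · exact h2 l h hlj hl2
          · by_contra hcon
            exact hcond ⟨hl2, not_le.1 hcon⟩
    · simp only [NatExpr.cost]; omega
  · rintro s₂ hf₂ ⟨h1, h2⟩
    have hC₂ : s₂.nat tmpC 0 = e % m := by rw [hf₂.1 tmpC rfl, hC]
    have hD₂ : s₂.nat tmpD 0 = (endOf m e).o := by rw [hf₂.1 tmpD rfl, hD]; rfl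
    have hS₂ : s₂.real sgnVal 0 = sideSign (endOf m e) := by rw [hf₂.2 sgnVal rfl, hS]
    have hL₂ : s₂.real loVal 0 = s₁.real loVal 0 := by rw [hf₂.2 loVal rfl]
    refine Run.of_safe (by simp [Program.Safe]) (by decide) ?_
    by_cases h0 : (endOf m e).o = 0
    · simp only [Program.eff, Test.holds_natLe, NatExpr.eval_get, NatExpr.eval_zero, hD₂, h0,
        le_refl, if_true, State.nat_putReal, State.real_putReal, hC₂,
        if_neg (show (sgnVal : ℕ) ≠ loVal by decide), if_neg (show (hiVal : ℕ) ≠ loVal by decide),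
        hS₂, Function.update_self, RealExpr.eval_sub, RealExpr.eval_get, RealExpr.eval_one,
        true_and]
      refine ⟨by linarith, fun x hx hx' => inner_of_interval hτ hx hx'
        (fun _ l hl hlj => h2 l hl hlj (.inl h0)) (fun h => absurd h0 h)⟩
    · have h0' : ¬ (endOf m e).o ≤ 0 := by omega
      simp only [Program.eff, Test.holds_natLe, NatExpr.eval_get, NatExpr.eval_zero, hD₂, h0',
        if_false, hC₂, hS₂, hL₂, true_and]
      refine ⟨h1 h0, fun x hx hx' => inner_of_interval hτ hx hx' (fun h => absurd h h0)
        (fun _ => ⟨(hlo h0).1, fun l hl hlj h => h2 l hl hlj (.inr h)⟩)⟩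

end RealRAM

namespace RealRAM

open Bowtie

variable {A b : ℕ → ℝ} {m k W : ℕ} {s : State}

/-- Choose a point next to the end with the position `best` in the order of all ends. Without blue
lines, the left end of the first red line takes the place of this end. -/
def pickPoint (slot best : ℕ) : Program :=
  .seq (.ite (.natLe 1 blueCount) (.setNat tmpA 0 (.get orderArr (.var best))) (.setNat tmpA 0 0))
  (.seq edgeInterval
  (.seq (.setReal absc (.const slot) (.var sgnVal * ((.var loVal + .var hiVal) / 2)))
    (.setNat pointLine (.const slot) (.var tmpC))))

/-- The end next to which `pickPoint` chooses a point. -/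
def pickedEnd (m : ℕ) (s : State) (best : ℕ) : End :=
  endOf m (if 1 ≤ m then s.nat orderArr (s.nat best 0) else 0)

theorem pickPoint_run (hl : Loaded A b m k s) (slot best : ℕ) (hW : m + k < W)
    (hmk : 0 < m + k) (hN : 2 * m * (k + 1) < W)
    (hbest : 1 ≤ m → s.nat orderArr (s.nat best 0) < 2 * m * (k + 1)) :
    Run W (pickPoint slot best) s (200 * (m + k + 1) + 50) fun s' =>
      s'.nat pointLine = Function.update (s.nat pointLine) slot (pickedEnd m s best).j ∧
      ∃ x lo hi, s'.real absc = Function.update (s.real absc) slot x ∧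
        x = sideSign (pickedEnd m s best) * ((lo + hi) / 2) ∧ lo < hi ∧
        s'.real sgnVal 0 = sideSign (pickedEnd m s best) ∧ s'.real loVal 0 = lo ∧
        s'.real hiVal 0 = hi ∧ ∀ x, lo < x → x < hi →
          (pickedEnd m s best).Inner A b m k (sideSign (pickedEnd m s best) * x) := by
  set e := if 1 ≤ m then s.nat orderArr (s.nat best 0) else 0 with he
  have heN : e ≤ 2 * m * (k + 1) := by
    rw [he]; split_ifs with h
    · exact (hbest h).le
    · omega
  have hdec : e / m / 2 ≤ k ∧ e % m < m + k := by
    rcases Nat.eq_zero_or_pos m with h0 | h0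
    · subst h0
      simp [he]; omega
    · have h1 : e < 2 * m * (k + 1) := by
        rw [he, if_pos (show 1 ≤ m from h0)]; exact hbest h0
      have h2 : e / m < 2 * (k + 1) := (Nat.div_lt_iff_lt_mul h0).2 (by nlinarith)
      have h3 := Nat.mod_lt e h0
      exact ⟨by omega, by omega⟩
  unfold pickPoint
  refine Run.seqFramed (T₁ := 15) (T₂ := 200 * (m + k + 1) + 30)
    (Q₁ := fun s' => s' = s.putNat tmpA 0 e) ?_ ?_ (by omega)
  · refine Run.of_safe ?_ (Nat.le_of_ble_eq_true rfl) ?_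
    · simp only [Program.Safe, Test.holds_natLe, NatExpr.eval_get, NatExpr.eval_zero,
        NatExpr.eval_one, hl.blue]
      exact ⟨fun h => (hbest h).trans hN, fun _ => by omega⟩
    · simp only [Program.eff, Test.holds_natLe, NatExpr.eval_get, NatExpr.eval_zero,
        NatExpr.eval_one, hl.blue, he]
      split_ifs <;> rfl
  rintro s₁ hf₁ rfl
  have hl₁ := hl.frame hf₁ rfl rfl rfl
  refine Run.seqFramed (T₁ := 200 * (m + k + 1)) (T₂ := 20) (edgeInterval_run hl₁ (e := e)
    (by simp) (by omega) hW hdec.1 hdec.2) ?_ (by omega)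
  rintro s₂ hf₂ ⟨h1, h2, h3, h4⟩
  refine Run.of_safe ?_ (Nat.le_of_ble_eq_true rfl) ⟨?_, sideSign (pickedEnd m s best) *
    ((s₂.real loVal 0 + s₂.real hiVal 0) / 2), s₂.real loVal 0, s₂.real hiVal 0, ?_, rfl, h3,
    ?_, ?_, ?_, h4⟩
  · simp [Program.Safe, Program.eff, h1]; omega
  · have : s₂.nat pointLine = s.nat pointLine := by rw [hf₂.1 pointLine rfl]; simp
    simp [Program.eff, h1, this]
    rfl
  · have : s₂.real absc = s.real absc := by rw [hf₂.2 absc rfl]; simp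
    simp [Program.eff, h2, this]
    rfl
  · simp [Program.eff, h2]; rfl
  · simp [Program.eff]
  · simp [Program.eff]

/-- Write the line that is dual to the chosen point number `src`. -/
def writeLine (dst src : NatExpr) : Program :=
  .seq (.setReal 4 dst (.get absc src))
    (.setReal 4 (dst + 1) (.get slopeArr (.get pointLine src) * .get absc src +
      .get iceptArr (.get pointLine src)))

/-- Choose two points next to the first and the last end of the best interval, with different
abscissas, and write their dual lines in the order of their slopes. -/
def writeOutput : Program :=
  .seq (pickPoint 0 bestP) (.seq (pickPoint 1 bestQ)
  (.seq (.ite (.and (.realLe (.get absc 0) (.get absc 1)) (.realLe (.get absc 1) (.get absc 0)))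
    (.setReal absc 1 (.var sgnVal * ((3 * .var loVal + .var hiVal) / 4))) .skip)
  (.ite (.realLt (.get absc 0) (.get absc 1)) (.seq (writeLine 0 0) (writeLine 2 1))
    (.seq (writeLine 0 1) (writeLine 2 0)))))

theorem writeOutput_run (hl : Loaded A b m k s) (hW : m + k < W)
    (hmk : 0 < m + k) (hN : 2 * m * (k + 1) < W)
    (hp : 1 ≤ m → s.nat orderArr (s.nat bestP 0) < 2 * m * (k + 1))
    (hq : 1 ≤ m → s.nat orderArr (s.nat bestQ 0) < 2 * m * (k + 1)) :
    Run W writeOutput s (600 * (m + k + 1)) fun s' => ∃ x y : ℝ, x ≠ y ∧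
      (pickedEnd m s bestP).Inner A b m k x ∧ (pickedEnd m s bestQ).Inner A b m k y ∧
      (outputLine₁ s').slope = min x y ∧ (outputLine₂ s').slope = max x y ∧
      (outputLine₁ s').intercept =
        ln A b (if x < y then (pickedEnd m s bestP).j else (pickedEnd m s bestQ).j) (min x y) ∧
      (outputLine₂ s').intercept =
        ln A b (if x < y then (pickedEnd m s bestQ).j else (pickedEnd m s bestP).j) (max x y) := by
  have hj : ∀ best, (1 ≤ m → s.nat orderArr (s.nat best 0) < 2 * m * (k + 1)) →
      (pickedEnd m s best).j < m + k := by
    intro best _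
    rcases Nat.eq_zero_or_pos m with h0 | h0
    · subst h0; simpa [pickedEnd, endOf] using hmk
    · have := Nat.mod_lt (if 1 ≤ m then s.nat orderArr (s.nat best 0) else 0) h0
      simp only [pickedEnd, endOf]
      omega
  have hjp := hj _ hp
  have hjq := hj _ hq
  unfold writeOutput
  refine Run.seqFramed (T₁ := 200 * (m + k + 1) + 50) (T₂ := 200 * (m + k + 1) + 200)
    (pickPoint_run hl 0 bestP hW hmk hN hp) ?_ (by omega)
  rintro s₁ hf₁ ⟨hpl, x, lo, hi, hx, hx', hlo, -, -, -, hin⟩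
  have hl₁ := hl.frame hf₁ rfl rfl rfl
  have ho₁ : s₁.nat orderArr = s.nat orderArr := hf₁.1 orderArr rfl
  have hq₁ : s₁.nat bestQ = s.nat bestQ := hf₁.1 bestQ rfl
  have hpick : pickedEnd m s₁ bestQ = pickedEnd m s bestQ := by
    simp only [pickedEnd, ho₁, hq₁]
  refine Run.seqFramed (T₁ := 200 * (m + k + 1) + 50) (T₂ := 150)
    (pickPoint_run hl₁ 1 bestQ hW hmk hN (by rw [ho₁, hq₁]; exact hq)) ?_ (by omega)
  rw [hpick]
  rintro s₂ hf₂ ⟨hpl₂, y, lo', hi', hy, hy', hlo', hs₂, hlo₂, hhi₂, hin'⟩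
  have hl₂ := hl₁.frame hf₂ rfl rfl rfl
  rw [hx] at hy
  rw [hpl] at hpl₂
  have hxin : (pickedEnd m s bestP).Inner A b m k x := by
    rw [hx']; exact hin _ (by linarith) (by linarith)
  refine Run.seqFramed (T₁ := 40) (T₂ := 100) (Q₁ := fun s' => s'.nat = s₂.nat ∧
    s'.real slopeArr = s₂.real slopeArr ∧ s'.real iceptArr = s₂.real iceptArr ∧
    ∃ y, x ≠ y ∧ s'.real absc 0 = x ∧ s'.real absc 1 = y ∧
      (pickedEnd m s bestQ).Inner A b m k y) ?_ ?_ (by omega)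
  · -- If the two points have the same abscissa, the second one is moved within its edge.
    have hx₂ : s₂.real absc 0 = x := by simp [hy]
    have hy₂ : s₂.real absc 1 = y := by simp [hy]
    refine Run.of_safe (by simp [Program.Safe]) (Nat.le_of_ble_eq_true rfl) ?_
    by_cases hxy : x = y
    · have hne : x ≠ sideSign (pickedEnd m s bestQ) * ((3 * lo' + hi') / 4) := by
        have : sideSign (pickedEnd m s bestQ) ≠ 0 := by
          unfold sideSign; split_ifs <;> norm_num
        rw [hxy, hy']
        intro h
        have := mul_left_cancel₀ this h
        linarith
      refine ⟨by simp [Program.eff, hx₂, hy₂, hxy], by simp [Program.eff, hx₂, hy₂, hxy],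
        by simp [Program.eff, hx₂, hy₂, hxy], _, hne, ?_, ?_,
        hin' _ (by linarith) (by linarith)⟩
      · simp [Program.eff, hx₂, hy₂, hxy]
      · simp [Program.eff, hx₂, hy₂, hxy, hs₂, hlo₂, hhi₂]
    · have hne : ¬ (x ≤ y ∧ y ≤ x) := fun h => hxy (le_antisymm h.1 h.2)
      have hskip : Program.eff (.ite (.and (.realLe (.get absc 0) (.get absc 1))
          (.realLe (.get absc 1) (.get absc 0)))
          (.setReal absc 1 (.var sgnVal * ((3 * .var loVal + .var hiVal) / 4))) .skip) s₂ = s₂ := by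
        simp only [Program.eff, Test.holds_and, Test.holds_realLe, RealExpr.eval_get,
          NatExpr.eval_zero, NatExpr.eval_one, hx₂, hy₂, hne, if_false]
      rw [hskip]
      exact ⟨rfl, rfl, rfl, y, hxy, hx₂, hy₂, by
        rw [hy']; exact hin' _ (by linarith) (by linarith)⟩
  rintro s₃ - ⟨hn₃, hsl₃, hic₃, y₁, hne, hx₃, hy₃, hyin⟩
  have hP : s₃.nat pointLine 0 = (pickedEnd m s bestP).j := by rw [hn₃, hpl₂]; simp
  have hQ : s₃.nat pointLine 1 = (pickedEnd m s bestQ).j := by rw [hn₃, hpl₂]; simp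
  have e1 := hl₂.slope _ hjp
  have e2 := hl₂.slope _ hjq
  have e3 := hl₂.icept _ hjp
  have e4 := hl₂.icept _ hjq
  rw [← hsl₃] at e1 e2
  rw [← hic₃] at e3 e4
  refine Run.of_safe (by simp [writeLine, Program.Safe]) (Nat.le_of_ble_eq_true rfl)
    ⟨x, y₁, hne, hxin, hyin, ?_⟩
  by_cases hlt : x < y₁
  · simp [Program.eff, writeLine, outputLine₁, outputLine₂, hx₃, hy₃, hlt, hlt.le, hP, hQ, e1, e2,
      e3, e4, ln]
  · have hge := not_lt.1 hlt
    simp [Program.eff, writeLine, outputLine₁, outputLine₂, hx₃, hy₃, hge, hlt, hP, hQ, e1, e2,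
      e3, e4, ln]

end RealRAM

/-! ### The algorithm -/

namespace RealRAM

open Bowtie

/-- The algorithm: load the dual lines, sort the red-blue vertices by their abscissas, sweep over
them to find the sort keys of the ends, sort the ends, scan them for a best interval, and write the
lines that are dual to two points next to the first and the last end of this interval. -/
def bowtieProgram : Program :=
  .seq loadLines (.seq fillPowers (.seq sizeTree (.seq prepareVertices (.seq sortItems
  (.seq writeLeftEnds (.seq sweepVertices (.seq writeRightEnds
  (.seq (.setNat itemCount 0 (2 * blueCount * (redCount + 1)))
  (.seq sortItems (.seq scanItems writeOutput))))))))))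

theorem Paired.congr {N : ℕ} {cell cell' : ℕ → ℝ} {line line' mate : ℕ → ℕ}
    (h : Paired N cell line mate) (hc : ∀ r < N, cell' r = cell r)
    (hl : ∀ r < N, line' r = line r) : Paired N cell' line' mate := by
  refine ⟨fun r r' h1 h2 => ?_, h.lt, h.ne, h.invol, fun r hr => ?_, fun r hr => ?_,
    fun r hr r' hr' h1 h2 => ?_⟩
  · rw [hc r (by omega), hc r' h2]; exact h.mono r r' h1 h2
  · rw [hc r hr, hc _ (h.lt r hr)]; exact h.cell_mate r hr
  · rw [hl r hr, hl _ (h.lt r hr)]; exact h.line_mate r hr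
  · rw [hl r hr, hl r' hr'] at h1
    rw [hc r hr, hc r' hr'] at h2
    exact h.eq_or r hr r' hr' h1 h2

theorem IsBestInterval.congr {N : ℕ} {cell cell' : ℕ → ℝ} {mate : ℕ → ℕ} {v : ℝ} {p q : ℕ}
    (h : IsBestInterval N cell mate v p q) (hc : ∀ r < N, cell' r = cell r) :
    IsBestInterval N cell' mate v p q := by
  refine ⟨fun p' q' h1 h2 h3 => h.1 p' q' h1 h2 ?_, fun hN => ?_⟩
  · rwa [hc p' (by omega), hc q' h2] at h3
  · obtain ⟨h1, h2, h3, h4⟩ := h.2 hN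
    exact ⟨h1, h2, by rw [hc p (by omega), hc q h2, h3], h4⟩

/-- The arrays that `scanItems` uses for its own purposes are empty. -/
structure ScanReady (s : State) : Prop where
  nats : ∀ i, s.nat openAt i = 0 ∧ s.nat argBest i = 0
  reals : ∀ i, s.real sumArr i = 0 ∧ s.real sufArr i = 0 ∧ s.real bestVal i = 0

theorem ScanReady.frame {s s' : State} {p : Program} (h : ScanReady s) (hf : Frame p s s')
    (hp : (p.writesNat openAt || p.writesNat argBest || p.writesReal sumArr ||
      p.writesReal sufArr || p.writesReal bestVal) = false) : ScanReady s' := by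
  simp only [Bool.or_eq_false_iff] at hp
  obtain ⟨⟨⟨⟨h1, h2⟩, h3⟩, h4⟩, h5⟩ := hp
  constructor
  · rw [hf.1 _ h1, hf.1 _ h2]; exact h.nats
  · rw [hf.2 _ h3, hf.2 _ h4, hf.2 _ h5]; exact h.reals

/-- The memory holds the dual lines, the powers of two and the size of the tree. -/
structure Prepared (A b : ℕ → ℝ) (m k L : ℕ) (s : State) : Prop where
  loaded : Loaded A b m k s
  powers : ∀ i ≤ k, s.real powArr i = 2 ^ i
  size : s.nat treeSize 0 = 2 ^ L
  big : s.real bigVal 0 = 2 ^ L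
  ready : ScanReady s

theorem Prepared.frame {A b : ℕ → ℝ} {m k L : ℕ} {s s' : State} {p : Program}
    (h : Prepared A b m k L s) (hf : Frame p s s')
    (hp : (p.writesNat 0 || p.writesReal slopeArr || p.writesReal iceptArr || p.writesReal powArr ||
      p.writesNat treeSize || p.writesReal bigVal) = false)
    (hp' : (p.writesNat openAt || p.writesNat argBest || p.writesReal sumArr ||
      p.writesReal sufArr || p.writesReal bestVal) = false) : Prepared A b m k L s' := by
  simp only [Bool.or_eq_false_iff] at hp
  obtain ⟨⟨⟨⟨⟨h1, h2⟩, h3⟩, h4⟩, h5⟩, h6⟩ := hp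
  refine ⟨h.loaded.frame hf h1 h2 h3, ?_, ?_, ?_, h.ready.frame hf hp'⟩
  · rw [hf.2 _ h4]; exact h.powers
  · rw [hf.1 _ h5]; exact h.size
  · rw [hf.2 _ h6]; exact h.big

/-- A bound for the number of steps of the algorithm, where `2 ^ L` is the size of the tree. -/
def bowtieTime (m k L : ℕ) : ℕ :=
  50 * (m + k + 1) + (50 * (k + 1) + (50 * (L + 1) + (150 * (k * m + 1) +
    (sortTime (k * m) L + (80 * (m + 1) + (400 * (k * m + 1) + (80 * (m + 1) + (20 +
      (sortTime (2 * m * (k + 1)) L + (scanTime (2 * m * (k + 1)) L +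
        600 * (m + k + 1)))))))))))

theorem pow_clog_le (N : ℕ) : 2 ^ Nat.clog 2 N ≤ 2 * N + 1 := by
  by_cases h : 1 < N
  · have h1 := Nat.pow_pred_clog_lt_self (b := 2) (by norm_num) h
    have h2 : 0 < Nat.clog 2 N := Nat.clog_pos (by norm_num) h
    have h3 : 2 ^ Nat.clog 2 N = 2 * 2 ^ (Nat.clog 2 N).pred := by
      rw [← pow_succ']; congr 1; simp; omega
    omega
  · rw [Nat.clog_of_right_le_one (by omega)]
    omega

/-- The algorithm is correct and runs within the given time, and all natural numbers that it stores
are smaller than a word bound that is quadratic in the number of points. -/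
theorem bowtieProgram_run {W m k : ℕ} {b : Fin m → ℝ × ℝ} {r : Fin k → ℝ × ℝ}
    (hgen : GeneralPosition (Sum.elim b r)) (hmk : 0 < m + k) (hW : 16 * (m + k + 1) ^ 2 ≤ W) :
    Run W bowtieProgram (inputState b r) (bowtieTime m k (Nat.clog 2 (2 * m * (k + 1)))) fun s =>
      IsOptimal (Set.range b) (Set.range r) (outputLine₁ s) (outputLine₂ s) := by
  have hG := genPos_dual hgen
  set A := dualSlope b r
  set B := dualIntercept b r
  set N := 2 * m * (k + 1) with hN
  set L := Nat.clog 2 N with hL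
  have hNL : N ≤ 2 ^ L := Nat.le_pow_clog (by norm_num) _
  have hLN : 2 ^ L ≤ 2 * N + 1 := pow_clog_le N
  have e2 : 2 ^ (L + 1) = 2 * 2 ^ L := by ring
  have hNM : N ≤ 2 * (m + k + 1) ^ 2 := by rw [hN]; nlinarith
  have hM : m + k + 1 ≤ (m + k + 1) ^ 2 := Nat.le_self_pow (by norm_num) _
  have hkN : k * m ≤ N := by rw [hN]; nlinarith
  have hWL : 2 ^ (L + 1) ≤ W := by omega
  have hs0 : ScanReady (inputState b r) := ⟨fun _ => ⟨rfl, rfl⟩, fun _ => ⟨rfl, rfl, rfl⟩⟩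
  unfold bowtieProgram bowtieTime
  refine Run.seqFramed (loadLines_run b r (by omega) (by omega)) ?_ le_rfl
  intro s₁ f₁ hl₁
  refine Run.seqFramed (fillPowers_run (by omega) hl₁.red) ?_ le_rfl
  intro s₂ f₂ hp₂
  have hl₂ := hl₁.frame f₂ rfl rfl rfl
  refine Run.seqFramed (sizeTree_run (show 2 ^ L < W by omega) (by omega) hl₂.blue hl₂.red) ?_
    le_rfl
  rintro s₃ f₃ ⟨hsize, hbig⟩
  have P₃ : Prepared A B m k L s₃ := ⟨hl₂.frame f₃ rfl rfl rfl,
    by rw [f₃.2 powArr rfl]; exact hp₂, hsize, hbig,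
    ((hs0.frame f₁ rfl).frame f₂ rfl).frame f₃ rfl⟩
  refine Run.seqFramed (prepareVertices_run (W := W) (by omega) (by omega) (by omega)
    P₃.loaded P₃.powers
    (fun j => by rw [f₃.2 lineCode rfl, f₂.2 lineCode rfl, f₁.2 lineCode rfl]; rfl))
    ?_ le_rfl
  rintro s₄ f₄ ⟨hcount₄, hkey₄, hcode₄⟩
  have P₄ := P₃.frame f₄ rfl rfl
  have hwin : ∀ i, s₄.nat winnerArr i = 0 := fun i => by
    rw [f₄.1 winnerArr rfl, f₃.1 winnerArr rfl, f₂.1 winnerArr rfl, f₁.1 winnerArr rfl]; rfl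
  refine Run.seqFramed (sortItems_run hWL (hkN.trans hNL) hcount₄ P₄.size (fun i _ => hwin i)
    (fun i => by rw [hwin]; omega)) ?_ le_rfl
  rintro s₅ f₅ ⟨ho₅, hz₅, hlt₅⟩
  have P₅ := P₄.frame f₅ rfl rfl
  have hcode₅ : ∀ j < m, s₅.real lineCode j = sideCode A m k j fun _ => False := by
    rw [f₅.2 lineCode rfl]; exact hcode₄
  refine Run.seqFramed (writeLeftEnds_run (A := A) (b := B) (W := W) (by omega) P₅.loaded hcode₅)
    ?_ le_rfl
  rintro s₆ f₆ hleft₆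
  have P₆ := P₅.frame f₆ rfl rfl
  refine Run.seqFramed (sweepVertices_run (W := W) (K := s₄.key) hG (by omega) P₆.loaded P₆.powers
    (by rw [f₆.1 itemCount rfl, f₅.1 itemCount rfl, hcount₄])
    (by rw [f₆.2 lineCode rfl]; exact hcode₅) hleft₆
    (by rw [f₆.1 orderArr rfl]; exact ho₅)
    (fun v hv => ⟨_, _, by rw [State.key, hkey₄ v hv]⟩)) ?_ le_rfl
  rintro s₇ f₇ ⟨hcode₇, hleft₇, hmid₇⟩
  have P₇ := P₆.frame f₇ rfl rfl
  refine Run.seqFramed (writeRightEnds_run (W := W) (by omega) P₇.loaded hcode₇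
    (S := {e | e < m ∨ (2 * m ≤ e ∧ e < N)}) (fun e he => by
      rcases he with he | he
      · exact hleft₇ e he
      · exact hmid₇ e he.2 he.1)) ?_ le_rfl
  rintro s₈ f₈ ⟨hother₈, hright₈⟩
  have P₈ := P₇.frame f₈ rfl rfl
  have hends₈ : ∀ e < N, EndKey A B m k s₈ e := by
    intro e he
    by_cases h1 : e < m
    · exact hother₈ e (.inl h1)
    · by_cases h2 : e < 2 * m
      · have := hright₈ (e - m) (by omega)
        rwa [Nat.add_sub_cancel' (by omega)] at this
      · exact hother₈ e (.inr ⟨by omega, he⟩)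
  refine Run.seqFramed (T₁ := 20) (Q₁ := fun s' => s' = s₈.putNat itemCount 0 N)
    (Run.of_safe (by simp [Program.Safe, P₈.loaded.blue, P₈.loaded.red]; omega) (by decide)
      (by simp [Program.eff, P₈.loaded.blue, P₈.loaded.red, hN])) ?_ le_rfl
  intro s₉ f₉ hs₉
  have P₉ := P₈.frame f₉ rfl rfl
  have hends₉ : ∀ e < N, EndKey A B m k s₉ e := fun e he =>
    endKey_of_eq (hends₈ e he) (by simp [hs₉]) (by simp [hs₉]) (by simp [hs₉]) (by simp [hs₉])
  have hwin₉ : s₉.nat winnerArr = s₅.nat winnerArr := by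
    rw [f₉.1 winnerArr rfl, f₈.1 winnerArr rfl, f₇.1 winnerArr rfl, f₆.1 winnerArr rfl]
  refine Run.seqFramed (sortItems_run (N := N) hWL hNL (by simp [hs₉]) P₉.size
    (by rw [hwin₉]; exact hz₅) (by rw [hwin₉]; exact hlt₅)) ?_ le_rfl
  rintro s₁₀ f₁₀ ⟨ho, -, -⟩
  have P₁₀ := P₉.frame f₁₀ rfl rfl
  have hE := endOrder_of_isSorting hends₉ ho
  obtain ⟨mate, hmate⟩ := hE.exists_mate hG
  have hcell : ∀ i < N, s₁₀.real keyA (s₁₀.nat orderArr i) =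
      cellCode ((endOf m (s₁₀.nat orderArr i)).cell A B m k) := fun i hi => by
    rw [f₁₀.2 keyA rfl]; exact (hends₉ _ (ho.lt i hi)).cell
  have hline : ∀ i < N, s₁₀.nat endLine (s₁₀.nat orderArr i) =
      (endOf m (s₁₀.nat orderArr i)).j := fun i hi => by
    rw [f₁₀.1 endLine rfl]; exact (hends₉ _ (ho.lt i hi)).line
  refine Run.seqFramed (scanItems_run (N := N) (mate := mate) hWL hNL
    (by rw [f₁₀.1 itemCount rfl]; simp [hs₉]) P₁₀.size (by rw [P₁₀.big]; exact_mod_cast hNL)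
    (hmate.congr hcell hline) (fun i hi => (ho.lt i hi).trans_le (by omega))
    (fun i hi => by
      rw [hline i hi]
      have := (hE.valid i hi).j
      omega)
    (fun j => (P₁₀.ready.nats j).1) (fun i => (P₁₀.ready.reals i).1)
    (fun i => (P₁₀.ready.reals i).2.1) (fun i => (P₁₀.ready.nats i).2)
    (P₁₀.ready.reals 0).2.2) ?_ le_rfl
  rintro s₁₁ f₁₁ ⟨hbest, -⟩
  have hbest' := hbest.congr
    (cell' := fun i => cellCode ((endOf m (s₁₀.nat orderArr i)).cell A B m k))
    (fun i hi => (hcell i hi).symm)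
  have hl₁₁ := P₁₀.loaded.frame f₁₁ rfl rfl rfl
  have ho₁₁ : s₁₁.nat orderArr = s₁₀.nat orderArr := f₁₁.1 orderArr rfl
  have hpos : 1 ≤ m → N ≠ 0 := fun h => by
    rw [hN]; positivity
  have hpos' : N ≠ 0 → 1 ≤ m := fun h => by
    by_contra hcon
    have : m = 0 := by omega
    simp [hN, this] at h
  refine (writeOutput_run hl₁₁ (by omega) hmk (by omega) (fun h => ?_) (fun h => ?_)).mono le_rfl ?_
  · obtain ⟨h1, h2, -⟩ := hbest.2 (hpos h)
    rw [ho₁₁]; exact ho.lt _ (by omega)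
  · obtain ⟨h1, h2, -⟩ := hbest.2 (hpos h)
    rw [ho₁₁]; exact ho.lt _ h2
  · rintro s ⟨x, y, hxy, hx, hy, h1, h2, h3, h4⟩
    refine isOptimal_of_isBestInterval hgen hmk hE hmate hbest' (fun h => ?_) (fun h => ?_)
      (fun h => ?_) hxy hx hy h1 h2 h3 h4
    · simp only [pickedEnd, ho₁₁, if_pos (hpos' h)]
    · simp only [pickedEnd, ho₁₁, if_pos (hpos' h)]
    · have h0 : m = 0 := by
        by_contra hcon
        exact hpos (by omega) h
      simp [pickedEnd, h0, endOf]

theorem bowtieTime_le {n m k : ℕ} (hn : 2 ≤ n) (hm : m ≤ n) (hk : k ≤ n) (L : ℕ) :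
    bowtieTime m k L ≤ 10000 * (n ^ 2 * (L + 1)) := by
  have h1 : replay.time + 12 ≤ 200 := by decide
  have h2 : rejoin.time + 12 ≤ 150 := by decide
  have hkm : k * m ≤ n ^ 2 := by rw [sq]; exact Nat.mul_le_mul hk hm
  have hN : 2 * m * (k + 1) ≤ 3 * n ^ 2 := by
    have : 2 * m * (k + 1) = 2 * (k * m) + 2 * m := by ring
    nlinarith
  have hD : 2 * n ≤ n ^ 2 := by nlinarith
  have hs : ∀ N, N ≤ 3 * n ^ 2 → sortTime N L ≤ 1240 * (n ^ 2 * (L + 1)) := by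
    intro N hN
    unfold sortTime
    have h3 : L * (replay.time + 12) + 50 ≤ 200 * (L + 1) := by nlinarith
    have h4 := Nat.mul_le_mul hN h3
    have h5 : 1 ≤ n ^ 2 * (L + 1) := Nat.succ_le_of_lt (by positivity)
    nlinarith
  have hsc : scanTime (2 * m * (k + 1)) L ≤ 2570 * (n ^ 2 * (L + 1)) := by
    unfold scanTime
    have h3 : 3 * (L * (rejoin.time + 12)) + 400 ≤ 850 * (L + 1) := by nlinarith
    have h4 := Nat.mul_le_mul hN h3
    have h5 : 1 ≤ n ^ 2 * (L + 1) := Nat.succ_le_of_lt (by positivity)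
    nlinarith
  have h3 := hs _ (hkm.trans (by omega))
  have h4 := hs _ hN
  have h5 : n ^ 2 ≤ n ^ 2 * (L + 1) := Nat.le_mul_of_pos_right _ (by omega)
  have h6 : L + 1 ≤ n ^ 2 * (L + 1) := Nat.le_mul_of_pos_left _ (by positivity)
  unfold bowtieTime
  omega

theorem clog_add_one_le {n N : ℕ} (hn : 2 ≤ n) (hN : N ≤ 3 * n ^ 2) :
    ((Nat.clog 2 N + 1 : ℕ) : ℝ) ≤ 10 * Real.log n := by
  have hlog2 : (0.69 : ℝ) < Real.log 2 := by linarith [Real.log_two_gt_d9]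
  have hlogn : Real.log 2 ≤ Real.log n :=
    Real.log_le_log (by norm_num) (by exact_mod_cast hn)
  have hL : (Nat.clog 2 N : ℝ) * Real.log 2 ≤ Real.log 2 + 4 * Real.log n := by
    by_cases h : 1 < N
    · have h1 := Nat.pow_pred_clog_lt_self (b := 2) (by norm_num) h
      have h2 : 0 < Nat.clog 2 N := Nat.clog_pos (by norm_num) h
      have h3 : 4 * n ^ 2 ≤ n ^ 4 := by nlinarith [Nat.mul_le_mul hn hn]
      have h4 : 2 ^ (Nat.clog 2 N).pred ≤ n ^ 4 := by omega
      have h5 := Real.log_le_log (by positivity)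
        (show (2 : ℝ) ^ (Nat.clog 2 N).pred ≤ (n : ℝ) ^ 4 by exact_mod_cast h4)
      rw [Real.log_pow, Real.log_pow] at h5
      have h6 : ((Nat.clog 2 N : ℕ) : ℝ) = (Nat.clog 2 N).pred + 1 := by
        exact_mod_cast (Nat.succ_pred_eq_of_pos h2).symm
      rw [h6, add_mul]
      push_cast at h5
      linarith
    · rw [Nat.clog_of_right_le_one (by omega)]
      simp only [Nat.cast_zero, zero_mul]
      linarith
  push_cast
  nlinarith

end RealRAM

theorem mainTheorem4 :
    ∃ (prog : RealRAM.Program) (c C : ℕ),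
      ∀ (n m k : ℕ) (b : Fin m → ℝ × ℝ) (r : Fin k → ℝ × ℝ),
        m ≤ n → k ≤ n → 3 ≤ m + k → Bowtie.GeneralPosition (Sum.elim b r) →
        ∃ (t : ℕ) (s : RealRAM.State),
          RealRAM.Exec ((n + 2) ^ c) prog (Bowtie.inputState b r) t s ∧
          (t : ℝ) ≤ C * ((n : ℝ) ^ 2 * Real.log n) ∧
          Bowtie.IsOptimal (Set.range b) (Set.range r)
            (Bowtie.outputLine₁ s) (Bowtie.outputLine₂ s) := by
  refine ⟨RealRAM.bowtieProgram, 6, 100000, fun n m k b r hm hk hmk hgen => ?_⟩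
  have hn : 2 ≤ n := by omega
  have hW : 16 * (m + k + 1) ^ 2 ≤ (n + 2) ^ 6 := by
    have h1 : (m + k + 1) ^ 2 ≤ (2 * (n + 2)) ^ 2 := Nat.pow_le_pow_left (by omega) 2
    have h2 : 4 ^ 4 ≤ (n + 2) ^ 4 := Nat.pow_le_pow_left (by omega) 4
    have h3 : (n + 2) ^ 6 = (n + 2) ^ 4 * (n + 2) ^ 2 := by ring
    nlinarith [sq_nonneg (n + 2)]
  -- The bound for the time is `10000 * n ^ 2` times the depth of the trees.
  obtain ⟨t, s, hexec, ht, hopt⟩ := RealRAM.bowtieProgram_run hgen (by omega) hW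
  refine ⟨t, s, hexec, ?_, hopt⟩
  have h1 := ht.trans (RealRAM.bowtieTime_le hn hm hk _)
  have h2 : (t : ℝ) ≤ 10000 * ((n : ℝ) ^ 2 * ((Nat.clog 2 (2 * m * (k + 1)) + 1 : ℕ) : ℝ)) := by
    exact_mod_cast h1
  have h3 := RealRAM.clog_add_one_le hn (N := 2 * m * (k + 1)) (by nlinarith [Nat.mul_le_mul hm hk])
  have h4 := mul_le_mul_of_nonneg_left h3 (sq_nonneg (n : ℝ))
  push_cast at *
  linarith
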